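/- **Setting.** A (symmetric) link function $L$ with values in a set $I$ is a sequence of functions $L_n:\{1,\dots,n\}^2\to I$, $n\ge 1$, with $L_n(i,j)=L_n(j,i)$. Put $k_n^L=\#\{L_n(i,j):1\le i,j\le n\}$ and $\alpha_n^L=\max_{t}\#\{(i,j):L_n(i,j)=t\}$. * *Property B*: $\Delta_L=\sup_n\sup_{t}\sup_{1\le k\le n}\#\{l\le n: L_n(k,l)=t\}<\infty$. * *(Lcond)*: $k_n^L\to\infty$ and $k_n^L\alpha_n^L=O(n^2)$. * A word $w$ of length $h$ is a sequence of $h$ letters whose first occurrences are in alphabetical order; it is pair-matched if each of its letters occurs exactly twice. A circuit of length $h$ is a map $\pi:\{0,\dots,h\}\to\{1,\dots,n\}$ with $\pi(0)=\pi(h)$. Let $\Pi_L(w)$ be the set of circuits of length $h$ such that, for all $i,j$, $w[i]=w[j]\Leftrightarrow L_n(\pi(i-1),\pi(i))=L_n(\pi(j-1),\pi(j))$, and let $\Pi_L^*(w)$ be defined with $\Rightarrow$ in place of $\Leftrightarrow$. * $p_L(w)$ exists, for a pair-matched word $w$ of length $2k$, if $p_L(w)=\lim_n n^{-(1+k)}\#\Pi_L(w)$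 exists as a finite limit. An input sequence is a family $(x_t)_{t\in I}$ of independent real random variables with mean $0$ and variance $1$ that are (A1) uniformly bounded, or (A2) identically distributed, or (A3) have uniformly bounded moments of every order. A probability measure $\mu$ on $\mathbb R$ is called *the LSD for the link $L$* if, for every input sequence satisfying (A1), (A2) or (A3), the distribution functions of the empirical spectral measures of the matrices $n^{-1/2}(x_{L_n(i,j)})_{i,j\le n}$ converge to that of $\mu$ at all continuity points of the latter, in the following sense: almost surely under (A1) and under (A3); almost surely under (A2) whenever $\#\bigcup_{m\le n}\{L_m(i,j):i,j\le m\}=O(k_n^L)$ (which holds if $L_n$ does not depend on $n$, or if the value sets increase with $n$); and in probability under (A2) in all cases. **Proposition.** Let $L_X$ be a symmetric link function that satisfies Property B and (Lcond), and suppose that $p_X(w)$ exists for every pair-matched word $w$. Let $L_Y=\rho\circ L_X$, where $\rho=\rho_n$ (possibly depending on $n$) is injective on the set of values of $L_{X,n}$, for every $n$. Then $L_Y$ satisfies Property B and (Lcond); $\Pi_X^*(w)=\Pi_Y^*(w)$ for every word $w$ and every $n$; and there is a probability measure $\mathcal L_X$ which is the LSD for the link $L_X$ and also the LSD for the link $L_Y$.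 **Example.** The Toeplitz link $L_T(i,j)=|i-j|$ satisfies Property B and (Lcond), $p_T(w)$ exists for every pair-matched word $w$, and there is a probability measure $\mathcal L_T$ which is the LSD both for the Toeplitz link and for the link $(i,j)\mapsto (i-j)^2$. -/

import Mathlib

open MeasureTheory ProbabilityTheory Filter Topology Asymptotics
open scoped ENNReal

universe u v w

noncomputable section

/-! ### Link functions -/

/-- A symmetric link function: a sequence `L n` of symmetric functions on pairs of indices with
values in a set `ι` of labels (for instance `ℕ` or `ℕ × ℕ`). The index set `{1, …, n}` is
represented by `Fin n`. The functions may depend on `n`. -/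
structure SymmLink (ι : Type u) where
  toFun : ∀ n : ℕ, Fin n → Fin n → ι
  symm : ∀ n i j, toFun n i j = toFun n j i

namespace SymmLink

variable {ι : Type u} {κ : Type v}

/-- The composed link `ρ ∘ L`, where the transformation may depend on `n`. -/
def map (L : SymmLink ι) (ρ : ℕ → ι → κ) : SymmLink κ where
  toFun n i j := ρ n (L.toFun n i j)
  symm n i j := by rw [L.symm]

/-- The set of values `{L n (i, j) : 1 ≤ i, j ≤ n}`. -/
def values (L : SymmLink ι) (n : ℕ) : Set ι :=
  Set.range fun p : Fin n × Fin n => L.toFun n p.1 p.2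

/-- `Δ_L`: the largest number of times a label occurs in a row, over all `n`. -/
def rowMultiplicity (L : SymmLink ι) : ℕ∞ :=
  ⨆ (n : ℕ) (t ∈ L.values n) (k : Fin n), Set.encard {l : Fin n | L.toFun n k l = t}

/-- Property B. -/
def PropertyB (L : SymmLink ι) : Prop := L.rowMultiplicity < ⊤

/-- `k_n`: the number of distinct labels in the `n × n` matrix. -/
def numValues (L : SymmLink ι) (n : ℕ) : ℕ := (L.values n).ncard

/-- `α_n`: the largest number of occurrences of a label in the `n × n` matrix. -/
def maxOccurrences (L : SymmLink ι) (n : ℕ) : ℕ :=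
  ⨆ t : ι, Set.ncard {p : Fin n × Fin n | L.toFun n p.1 p.2 = t}

/-- The conditions `k_n → ∞` and `k_n α_n = O(n²)`. -/
def LinkCond (L : SymmLink ι) : Prop :=
  Tendsto L.numValues atTop atTop ∧
    (fun n : ℕ => (L.numValues n : ℝ) * (L.maxOccurrences n : ℝ)) =O[atTop]
      fun n : ℕ => (n : ℝ) ^ 2

/-- The number of distinct labels used by the first `n` matrices together is `O(k_n)`. This holds
with constant `1` when the sets of values increase with `n`, in particular when the link function
does not depend on `n`. -/
def CumulativeValuesBound (L : SymmLink ι) : Prop :=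
  (fun n : ℕ => ((⋃ m ∈ Finset.range (n + 1), L.values m).ncard : ℝ)) =O[atTop]
    fun n : ℕ => (L.numValues n : ℝ)

end SymmLink

/-! ### Words and circuits -/

/-- A word of length `h`, with letters `a = 0, b = 1, c = 2, …`: the first occurrences of the
letters are in alphabetical order, so that every letter is preceded by all earlier letters. -/
structure Word (h : ℕ) where
  letter : Fin h → ℕ
  alphabetical : ∀ i, ∀ m < letter i, ∃ j < i, letter j = m

/-- Every letter occurs exactly twice. -/
def Word.PairMatched {h : ℕ} (W : Word h) : Prop :=
  ∀ i, Set.ncard {j | W.letter j = W.letter i} = 2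

namespace SymmLink

variable {ι : Type u}

/-- The `L`-value `L(π(i-1), π(i))` of the `i`-th step of a path `π` (with `i` counted from `0`). -/
def stepValue (L : SymmLink ι) {n h : ℕ} (π : Fin (h + 1) → Fin n) (i : Fin h) : ι :=
  L.toFun n (π i.castSucc) (π i.succ)

/-- `Π(w)`: the circuits of length `h` in `{1, …, n}` whose `L`-values match exactly as the
letters of `w` do. -/
def circuits (L : SymmLink ι) {h : ℕ} (W : Word h) (n : ℕ) : Set (Fin (h + 1) → Fin n) :=
  {π | π 0 = π (Fin.last h) ∧
    ∀ i j, W.letter i = W.letter j ↔ L.stepValue π i = L.stepValue π j}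

/-- `Π*(w)`: the circuits whose `L`-values match at least where the letters of `w` do. -/
def circuitsStar (L : SymmLink ι) {h : ℕ} (W : Word h) (n : ℕ) : Set (Fin (h + 1) → Fin n) :=
  {π | π 0 = π (Fin.last h) ∧
    ∀ i j, W.letter i = W.letter j → L.stepValue π i = L.stepValue π j}

/-- The limit `p(w) = lim n^{-(1+k)} #Π(w)` exists for every `k` and every pair-matched word `w`
of length `2k`. -/
def WordLimitsExist (L : SymmLink ι) : Prop :=
  ∀ (k : ℕ) (W : Word (2 * k)), W.PairMatched →
    ∃ p : ℝ, Tendsto (fun n : ℕ => ((L.circuits W n).ncard : ℝ) / (n : ℝ) ^ (1 + k)) atTop (𝓝 p)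

end SymmLink

/-! ### Input sequences -/

section Input

variable {ι : Type u} {Ω : Type w} [MeasurableSpace Ω]

/-- Independent, with mean `0` and variance `1`. -/
structure IsStandardizedInput (x : ι → Ω → ℝ) (P : Measure Ω) : Prop where
  measurable : ∀ t, Measurable (x t)
  indep : iIndepFun x P
  memLp : ∀ t, MemLp (x t) 2 P
  mean : ∀ t, ∫ ω, x t ω ∂P = 0
  variance : ∀ t, variance (x t) P = 1

/-- (A1): independent, uniformly bounded, mean `0`, variance `1`. -/
def InputA1 (x : ι → Ω → ℝ) (P : Measure Ω) : Prop :=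
  IsStandardizedInput x P ∧ ∃ C : ℝ, ∀ t, ∀ᵐ ω ∂P, |x t ω| ≤ C

/-- (A2): independent and identically distributed, mean `0`, variance `1`. -/
def InputA2 (x : ι → Ω → ℝ) (P : Measure Ω) : Prop :=
  IsStandardizedInput x P ∧ ∀ s t, IdentDistrib (x s) (x t) P P

/-- (A3): independent, mean `0`, variance `1`, uniformly bounded moments of all orders. -/
def InputA3 (x : ι → Ω → ℝ) (P : Measure Ω) : Prop :=
  IsStandardizedInput x P ∧
    ∀ k : ℕ, ∃ C : ℝ, ∀ t, Integrable (fun ω => |x t ω| ^ k) P ∧ ∫ ω, |x t ω| ^ k ∂P ≤ C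

end Input

/-! ### Patterned matrices and limiting spectral distributions -/

/-- The empirical spectral measure `n⁻¹ ∑ δ_{λ_i}` of a real symmetric matrix. -/
def empiricalSpectralMeasure {n : ℕ} (A : Matrix (Fin n) (Fin n) ℝ) (hA : A.IsHermitian) :
    Measure ℝ :=
  (n : ℝ≥0∞)⁻¹ • ∑ i, Measure.dirac (hA.eigenvalues i)

namespace SymmLink

variable {ι : Type u}

/-- The scaled patterned matrix `n^{-1/2} (x_{L(i,j)})`. -/
def scaledMatrix (L : SymmLink ι) (x : ι → ℝ) (n : ℕ) : Matrix (Fin n) (Fin n) ℝ :=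
  Matrix.of fun i j => (Real.sqrt n)⁻¹ * x (L.toFun n i j)

theorem scaledMatrix_isHermitian (L : SymmLink ι) (x : ι → ℝ) (n : ℕ) :
    (L.scaledMatrix x n).IsHermitian := by
  ext i j
  simp [scaledMatrix, L.symm n j i]

/-- The distribution function of the empirical spectral measure of `n^{-1/2} (x_{L(i,j)})`. -/
def esd (L : SymmLink ι) (x : ι → ℝ) (n : ℕ) (s : ℝ) : ℝ :=
  (empiricalSpectralMeasure (L.scaledMatrix x n) (L.scaledMatrix_isHermitian x n)).real (Set.Iic s)

variable {Ω : Type w} [MeasurableSpace Ω]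

/-- Weak convergence of the ESD to `μ`, almost surely. -/
def ESDTendstoAlmostSurely (L : SymmLink ι) (x : ι → Ω → ℝ) (P : Measure Ω) (μ : Measure ℝ) :
    Prop :=
  ∀ᵐ ω ∂P, ∀ s : ℝ, ContinuousAt (fun r => μ.real (Set.Iic r)) s →
    Tendsto (fun n => L.esd (fun t => x t ω) n s) atTop (𝓝 (μ.real (Set.Iic s)))

/-- Weak convergence of the ESD to `μ`, in probability. -/
def ESDTendstoInProbability (L : SymmLink ι) (x : ι → Ω → ℝ) (P : Measure Ω) (μ : Measure ℝ) :
    Prop :=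
  ∀ s : ℝ, ContinuousAt (fun r => μ.real (Set.Iic r)) s →
    TendstoInMeasure P (fun n ω => L.esd (fun t => x t ω) n s) atTop
      (fun _ => μ.real (Set.Iic s))

/-- The non-random law `μ` is the LSD of `n^{-1/2} (x_{L(i,j)})`, for every input sequence:
the convergence is almost sure under (A1) and under (A3), and also under (A2) if the matrices
together use only `O(k_n)` variables up to size `n`; under (A2) it is always in probability. -/
def IsLSD (L : SymmLink ι) (μ : Measure ℝ) : Prop :=
  IsProbabilityMeasure μ ∧
  ∀ (Ω : Type w) [MeasurableSpace Ω] (P : Measure Ω) [IsProbabilityMeasure P] (x : ι → Ω → ℝ),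
    (InputA1 x P → L.ESDTendstoAlmostSurely x P μ) ∧
    (InputA3 x P → L.ESDTendstoAlmostSurely x P μ) ∧
    (InputA2 x P → L.CumulativeValuesBound → L.ESDTendstoAlmostSurely x P μ) ∧
    (InputA2 x P → L.ESDTendstoInProbability x P μ)

end SymmLink

/-! ### Two links -/

/-- The Toeplitz link `|i - j|`. -/
def toeplitzLink : SymmLink ℕ where
  toFun _ i j := ((i : ℤ) - (j : ℤ)).natAbs
  symm n i j := by rw [← Int.natAbs_neg, neg_sub]

/-- The link `(i - j)²`. -/
def squaredDifferenceLink : SymmLink ℕ where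
  toFun _ i j := (((i : ℤ) - (j : ℤ)) ^ 2).natAbs
  symm n i j := by rw [← neg_sub, neg_sq]

end

/-! ### Counting walks with prescribed coincidences of labels -/

/-! The proof is the method of moments. The `j`-th moment of the empirical spectral measure is a
normalized trace of a `j`-th power, that is, a sum over closed walks of length `j` of the products
of the inputs at the labels of the steps (`trace_pow_succ`,
`SymmLink.integral_pow_empiricalSpectralMeasure`). All counting rests on one consequence of Property
B: a step whose label is already known has at most `D` possible endpoints. Hence a walk is
determined, up to a power of `D`, by its starting point and one free choice per distinct label
(`ncard_walksWithWord_le`).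

Independence and mean zero remove every walk with a label that occurs only once. If every label
occurs at least twice and one of them more often, there are too few labels, and such walks are
negligible. The mean of the moment therefore has the limit `β j`, the sum of `p(w)` over the
pair-matched words of length `j` (`exists_mean_bound`). The fourth central moment is a sum over
quadruples of walks in which each label is repeated and each walk shares a label with another one. A
closing step imposes a condition for which no free choice was made, and this saves enough factors
`n` to leave `O(n⁻²)` after normalization (`ncard_closedWalkFamilies_four_le`), which is summable.
So all moments converge almost surely under (A3), and (A1) is a special case.

Since `β (2k) ≤ (2k)^k D^(2k)`, Taylor polynomials of characteristic functions can be compared: two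
sequences of laws with moment limits `β` have asymptotically equal characteristic functions
(`tendsto_charFun_sub_of_moments`). The limit law itself is a limit point, by tightness, of the
spectral laws of one realization with random signs (`exists_limit_of_moments`).

For (A2) the inputs are replaced by bounded ones that are close in mean square. Integrals of
Lipschitz functions against spectral measures are Lipschitz in the Frobenius norm
(`abs_sum_eigenvalues_sub_le`). The Frobenius error is controlled by (Lcond) and the strong law of
large numbers for the almost sure statement, and by Markov's inequality for the statement in
probability.

A relabelling that is injective on the values does not change which labels coincide, so it preserves
the sets of circuits, `β`, and thus the limit law. For the Toeplitz link, equal labels mean equal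
steps up to sign. Opposite signs at matched positions make the walk close automatically and leave
the lattice points of a dilated polytope, whose normalized number tends to its volume. Any other
choice of signs adds a linear relation and is negligible. -/

theorem Set.ncard_le_mul_ncard_image {A B : Type*} [Finite A] [Finite B] (S : Set A) (f : A → B)
    (m : ℕ) (h : ∀ b ∈ f '' S, {a ∈ S | f a = b}.ncard ≤ m) :
    S.ncard ≤ m * (f '' S).ncard := by
  classical
  have := Fintype.ofFinite A
  have := Fintype.ofFinite B
  have key := Finset.card_le_mul_card_image (f := f) (S.toFinset) m (by
    intro b hb
    have hb' : b ∈ f '' S := by simpa using hb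
    have := h b hb'
    rw [Set.ncard_eq_toFinset_card'] at this
    convert this using 2
    ext a; simp)
  rw [Set.ncard_eq_toFinset_card', Set.ncard_eq_toFinset_card', Set.toFinset_image]
  exact key

section Walks

variable {V : Type*} {ι : Type*} {α : Type*}

/-- Walks whose steps have the label `v a` at letters `a ∈ K` of the word, and equal labels at
equal letters. -/
def walksWithWord (ℓ : V → V → ι) {l : ℕ} (w : Fin l → α) (K : Set α) (v : α → ι) :
    Set (Fin (l + 1) → V) :=
  {π | (∀ i, w i ∈ K → ℓ (π i.castSucc) (π i.succ) = v (w i)) ∧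
    ∀ i j, w i = w j → ℓ (π i.castSucc) (π i.succ) = ℓ (π j.castSucc) (π j.succ)}

/-- Build the walk one step at a time. A step whose letter lies in `K` or has occurred before has a
forced label, hence at most `D` endpoints. A step with a new letter outside `K` has at most `|V|`
endpoints and adds one to the number of free letters. The remaining factor `|V|` is the starting
point. -/
theorem ncard_walksWithWord_le [Finite V] {ℓ : V → V → ι} {D : ℕ}
    (hD : ∀ x t, {y | ℓ x y = t}.ncard ≤ D) {l : ℕ} (w : Fin l → α) (K : Set α) (v : α → ι) :
    (walksWithWord ℓ w K v).ncard ≤ Nat.card V ^ (1 + (Set.range w \ K).ncard) * D ^ l := by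
  induction l with
  | zero =>
    have : Set.range w = ∅ := Set.range_eq_empty w
    calc _ ≤ (Set.univ : Set (Fin 1 → V)).ncard := Set.ncard_le_ncard (Set.subset_univ _)
      _ = _ := by simp [Set.ncard_univ, this, Nat.card_fun]
  | succ l ih =>
    have hsub : Fin.init '' walksWithWord ℓ w K v ⊆ walksWithWord ℓ (Fin.init w) K v := by
      rintro _ ⟨π, ⟨h1, h2⟩, rfl⟩
      exact ⟨fun i hi => h1 i.castSucc hi, fun i j hij => h2 i.castSucc j.castSucc hij⟩
    have himg := (Set.ncard_le_ncard hsub).trans (ih (Fin.init w))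
    have hrange : Set.range (Fin.init w) ⊆ Set.range w := by
      rintro _ ⟨i, rfl⟩; exact ⟨i.castSucc, rfl⟩
    rcases Nat.eq_zero_or_pos (Nat.card V) with h0 | hpos
    · have : IsEmpty V := by
        rcases Nat.card_eq_zero.1 h0 with h | h
        · exact h
        · exact absurd ‹Finite V› (not_finite_iff_infinite.2 h)
      rw [Set.eq_empty_of_isEmpty (walksWithWord ℓ w K v)]; simp
    by_cases hlast : w (Fin.last l) ∈ K ∪ Set.range (Fin.init w)
    · have hfib : ∀ b ∈ Fin.init '' walksWithWord ℓ w K v,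
          {π ∈ walksWithWord ℓ w K v | Fin.init π = b}.ncard ≤ D := by
        rintro _ ⟨π₀, h₀, rfl⟩
        have hinit : ∀ π : Fin (l + 2) → V, Fin.init π = (Fin.init π₀ : Fin (l + 1) → V) →
            ∀ i : Fin (l + 1), π i.castSucc = π₀ i.castSucc := fun π h i => congrFun h i
        refine le_trans (Set.ncard_le_ncard_of_injOn (fun π => π (Fin.last (l + 1))) (t :=
          {y | ℓ (π₀ (Fin.last l).castSucc) y =
            ℓ (π₀ (Fin.last l).castSucc) (π₀ (Fin.last l).succ)}) ?_ ?_) (hD _ _)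
        · rintro π ⟨hπ, he⟩
          have e := hinit π he
          simp only [Set.mem_ofPred_eq]
          rw [← e (Fin.last l), ← Fin.succ_last]
          rcases hlast with hK | ⟨i, hi⟩
          · rw [hπ.1 _ hK, e, ← h₀.1 _ hK]
          · have hi' : w (Fin.last l) = w i.castSucc := hi.symm
            rw [hπ.2 _ _ hi', e (Fin.last l), h₀.2 _ _ hi', e, ← Fin.castSucc_succ, e]
        · rintro π ⟨-, he⟩ π' ⟨-, he'⟩ hl
          rw [← Fin.snoc_init_self π, ← Fin.snoc_init_self π', he, he']
          simp only at hl
          rw [hl]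
      calc _ ≤ D * _ := Set.ncard_le_mul_ncard_image _ _ _ hfib
        _ ≤ D * (Nat.card V ^ (1 + (Set.range (Fin.init w) \ K).ncard) * D ^ l) := by gcongr
        _ ≤ D * (Nat.card V ^ (1 + (Set.range w \ K).ncard) * D ^ l) := by
            gcongr
            exact (Set.finite_range w).sdiff
        _ = _ := by ring
    · have hfib : ∀ b ∈ Fin.init '' walksWithWord ℓ w K v,
          {π ∈ walksWithWord ℓ w K v | Fin.init π = b}.ncard ≤ Nat.card V := by
        rintro b -
        rw [← Set.ncard_univ]
        refine Set.ncard_le_ncard_of_injOn (fun π => π (Fin.last (l + 1))) (by simp) ?_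
        rintro π ⟨-, he⟩ π' ⟨-, he'⟩ hl
        rw [← Fin.snoc_init_self π, ← Fin.snoc_init_self π', he, he']
        simp only at hl
        rw [hl]
      have hlt : (Set.range (Fin.init w) \ K).ncard + 1 ≤ (Set.range w \ K).ncard := by
        apply Set.ncard_lt_ncard _ ((Set.finite_range w).sdiff)
        rw [Set.ssubset_iff_of_subset (Set.sdiff_subset_sdiff_left hrange)]
        exact ⟨w (Fin.last l), ⟨⟨_, rfl⟩, fun h => hlast (Or.inl h)⟩,
          fun h => hlast (Or.inr h.1)⟩
      -- A free step uses no factor `D`, so passing to `D ^ (l + 1)` needs `1 ≤ D`. The label of a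
      -- loop at `x` occurs in row `x`.
      have hDpos : 1 ≤ D := by
        obtain ⟨⟨x⟩⟩ := (Nat.card_pos_iff.1 hpos)
        refine le_trans ?_ (hD x (ℓ x x))
        exact (Set.ncard_pos).2 ⟨x, rfl⟩
      calc _ ≤ Nat.card V * _ := Set.ncard_le_mul_ncard_image _ _ _ hfib
        _ ≤ Nat.card V * (Nat.card V ^ (1 + (Set.range (Fin.init w) \ K).ncard) * D ^ l) := by
            gcongr
        _ = Nat.card V ^ (1 + ((Set.range (Fin.init w) \ K).ncard + 1)) * D ^ l := by ring
        _ ≤ _ := by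
            gcongr ?_ ^ ?_ * ?_ ^ ?_
            all_goals omega

/-- The label of the step from `c i` to `c (i + 1)` of a closed walk, indices being cyclic. -/
def cyclicStep (ℓ : V → V → ι) {m : ℕ} (c : Fin (m + 1) → V) (i : Fin (m + 1)) : ι :=
  ℓ (c i) (c (i + 1))

/-- Closed walks whose steps have the label `v a` at letters `a ∈ K` of the word, and equal labels
at equal letters. -/
def closedWalksWithWord (ℓ : V → V → ι) {m : ℕ} (w : Fin (m + 1) → α) (K : Set α) (v : α → ι) :
    Set (Fin (m + 1) → V) :=
  {c | (∀ i, w i ∈ K → cyclicStep ℓ c i = v (w i)) ∧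
    ∀ i j, w i = w j → cyclicStep ℓ c i = cyclicStep ℓ c j}

theorem closedWalksWithWord_subset (ℓ : V → V → ι) {m : ℕ} (w : Fin (m + 1) → α) (K : Set α)
    (v : α → ι) : closedWalksWithWord ℓ w K v ⊆ walksWithWord ℓ (fun i => w i.castSucc) K v := by
  rintro c ⟨h1, h2⟩
  have e : ∀ i : Fin m, cyclicStep ℓ c i.castSucc = ℓ (c i.castSucc) (c i.succ) := fun i => by
    rw [cyclicStep, Fin.coeSucc_eq_succ]
  exact ⟨fun i hi => by rw [← e]; exact h1 _ hi, fun i j hij => by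
    rw [← e, ← e]; exact h2 _ _ hij⟩

theorem ncard_closedWalksWithWord_le [Finite V] {ℓ : V → V → ι} {D : ℕ}
    (hD : ∀ x t, {y | ℓ x y = t}.ncard ≤ D) {m : ℕ} (w : Fin (m + 1) → α) (K : Set α)
    (v : α → ι) :
    (closedWalksWithWord ℓ w K v).ncard ≤
      Nat.card V ^ (1 + (Set.range w \ K).ncard) * D ^ m := by
  refine (Set.ncard_le_ncard (closedWalksWithWord_subset ℓ w K v)).trans
    ((ncard_walksWithWord_le hD _ K v).trans ?_)
  have hle : (Set.range (fun i : Fin m => w i.castSucc) \ K).ncard ≤ (Set.range w \ K).ncard := by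
    apply Set.ncard_le_ncard _ ((Set.finite_range w).sdiff)
    apply Set.sdiff_subset_sdiff_left
    rintro _ ⟨i, rfl⟩; exact ⟨_, rfl⟩
  rcases Nat.eq_zero_or_pos (Nat.card V) with h0 | hpos
  · rw [h0, pow_add, pow_add]; simp
  · gcongr

/-- The closing step joins two vertices that are already chosen. If its letter occurs nowhere else
and lies outside `K`, forgetting this step removes one free letter from the count, which saves a
factor `|V|`. -/
theorem ncard_closedWalksWithWord_le_of_last [Finite V] {ℓ : V → V → ι} {D : ℕ}
    (hD : ∀ x t, {y | ℓ x y = t}.ncard ≤ D) {m : ℕ} (w : Fin (m + 1) → α) (K : Set α)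
    (v : α → ι) (hK : w (Fin.last m) ∉ K) (hu : ∀ i, w i = w (Fin.last m) → i = Fin.last m) :
    (closedWalksWithWord ℓ w K v).ncard ≤ Nat.card V ^ (Set.range w \ K).ncard * D ^ m := by
  refine (Set.ncard_le_ncard (closedWalksWithWord_subset ℓ w K v)).trans
    ((ncard_walksWithWord_le hD _ K v).trans ?_)
  have hle : (Set.range (fun i : Fin m => w i.castSucc) \ K).ncard + 1 ≤
      (Set.range w \ K).ncard := by
    apply Set.ncard_lt_ncard _ ((Set.finite_range w).sdiff)
    rw [Set.ssubset_iff_of_subset (Set.sdiff_subset_sdiff_left (by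
      rintro _ ⟨i, rfl⟩; exact ⟨_, rfl⟩))]
    refine ⟨w (Fin.last m), ⟨⟨_, rfl⟩, hK⟩, fun h => ?_⟩
    obtain ⟨i, hi⟩ := h.1
    exact (Fin.castSucc_ne_last i) (hu _ hi)
  rcases Nat.eq_zero_or_pos (Nat.card V) with h0 | hpos
  · rw [h0, pow_add]; simp
  · gcongr
    omega

/-- A closed walk may be rotated so that any chosen step becomes the closing one. -/
theorem ncard_closedWalksWithWord_le_of_unique [Finite V] {ℓ : V → V → ι} {D : ℕ}
    (hD : ∀ x t, {y | ℓ x y = t}.ncard ≤ D) {m : ℕ} (w : Fin (m + 1) → α) (K : Set α)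
    (v : α → ι) (i₀ : Fin (m + 1)) (hK : w i₀ ∉ K) (hu : ∀ i, w i = w i₀ → i = i₀) :
    (closedWalksWithWord ℓ w K v).ncard ≤ Nat.card V ^ (Set.range w \ K).ncard * D ^ m := by
  let s : Fin (m + 1) := i₀ - Fin.last m
  have hs : Fin.last m + s = i₀ := by simp [s]
  let w' : Fin (m + 1) → α := fun i => w (i + s)
  have hr : Set.range w' = Set.range w := (Equiv.addRight s).surjective.range_comp w
  rw [← hr]
  refine le_trans ?_ (ncard_closedWalksWithWord_le_of_last hD w' K v (by simpa [w', hs] using hK)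
    (fun i hi => ?_))
  · refine Set.ncard_le_ncard_of_injOn (fun c i => c (i + s)) ?_ ?_
    · rintro c ⟨h1, h2⟩
      have e : ∀ i, cyclicStep ℓ (fun i => c (i + s)) i = cyclicStep ℓ c (i + s) := fun i => by
        simp only [cyclicStep]; rw [add_right_comm]
      exact ⟨fun i hi => by rw [e]; exact h1 _ hi, fun i j hij => by
        rw [e, e]; exact h2 _ _ hij⟩
    · intro c _ c' _ h
      funext i
      have := congrFun h (i - s)
      simpa using this
  · simp only [w', hs] at hi
    have := hu _ hi
    rw [← hs] at this
    exact add_right_cancel this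

/-! ### Families of closed walks, counted by adding one member at a time -/

section Families

variable {J : Type*} {m : ℕ}

/-- Families of closed walks with equal labels at equal letters. -/
def closedWalkFamilies (ℓ : V → V → ι) (w : J → Fin (m + 1) → α) :
    Set (J → Fin (m + 1) → V) :=
  {c | ∀ j i j' i', w j i = w j' i' → cyclicStep ℓ (c j) i = cyclicStep ℓ (c j') i'}

/-- The letters of the words with index in `P`. -/
def lettersIn (w : J → Fin (m + 1) → α) (P : Finset J) : Set α := {a | ∃ j ∈ P, ∃ i, w j i = a}

open Classical in
/-- Forget the members of a family whose index is not in `P`. -/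
noncomputable def forgetOutside {C : Type*} (P : Finset J) (c : J → C) : J → Option C :=
  fun j => if j ∈ P then some (c j) else none

/-- `n ^ (|P| + #letters - s)` is, up to a power of `D`, a bound for the number of partial families
with index set `P`. -/
def FamilyBound (ℓ : V → V → ι) (w : J → Fin (m + 1) → α) (D s : ℕ) (P : Finset J) : Prop :=
  (forgetOutside P '' closedWalkFamilies ℓ w).ncard * Nat.card V ^ s ≤
    Nat.card V ^ (P.card + (lettersIn w P).ncard) * D ^ (m * P.card)

variable {ℓ : V → V → ι} {w : J → Fin (m + 1) → α} {D : ℕ}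

theorem familyBound_empty : FamilyBound ℓ w D 0 ∅ := by
  have h : (forgetOutside ∅ '' closedWalkFamilies ℓ w).Subsingleton := by
    rintro _ ⟨c, -, rfl⟩ _ ⟨c', -, rfl⟩
    funext j; simp [forgetOutside]
  have hl : lettersIn w ∅ = ∅ := by ext; simp [lettersIn]
  have : Finite (forgetOutside ∅ '' closedWalkFamilies ℓ w) := h.finite
  have := Set.ncard_le_one_iff_subsingleton.2 h
  simpa [FamilyBound, hl] using this

theorem lettersIn_insert [DecidableEq J] (w : J → Fin (m + 1) → α) (P : Finset J) (j : J) :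
    lettersIn w (insert j P) = lettersIn w P ∪ Set.range (w j) := by
  ext a
  simp only [lettersIn, Finset.mem_insert, Set.mem_ofPred_eq, Set.mem_union, Set.mem_range]
  constructor
  · rintro ⟨k, rfl | hk, i, rfl⟩
    · exact Or.inr ⟨i, rfl⟩
    · exact Or.inl ⟨k, hk, i, rfl⟩
  · rintro (⟨k, hk, i, rfl⟩ | ⟨i, rfl⟩)
    · exact ⟨k, Or.inr hk, i, rfl⟩
    · exact ⟨j, Or.inl rfl, i, rfl⟩

theorem finite_lettersIn [Finite J] (w : J → Fin (m + 1) → α) (P : Finset J) :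
    (lettersIn w P).Finite := by
  refine (Set.finite_range (fun e : J × Fin (m + 1) => w e.1 e.2)).subset ?_
  rintro a ⟨j, -, i, rfl⟩
  exact ⟨(j, i), rfl⟩

theorem ncard_lettersIn_insert [Finite J] [DecidableEq J] (w : J → Fin (m + 1) → α)
    (P : Finset J) (j : J) : (lettersIn w (insert j P)).ncard =
      (lettersIn w P).ncard + (Set.range (w j) \ lettersIn w P).ncard := by
  rw [lettersIn_insert, ← Set.union_sdiff_self, Set.ncard_union_eq Set.disjoint_sdiff_right
    (finite_lettersIn w P) ((Set.finite_range _).sdiff)]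

/-- Once the members with index in `P` are fixed, the labels of all letters occurring in them are
known. The member `j` is then a closed walk with prescribed labels on `lettersIn w P`, so `M` bounds
the fibres of the map that forgets it. -/
theorem ncard_forgetOutside_insert_le [Finite V] [Finite J] [DecidableEq J] (P : Finset J) (j : J)
    (M : ℕ) (hM : ∀ v : α → ι, (closedWalksWithWord ℓ (w j) (lettersIn w P) v).ncard ≤ M) :
    (forgetOutside (insert j P) '' closedWalkFamilies ℓ w).ncard ≤
      M * (forgetOutside P '' closedWalkFamilies ℓ w).ncard := by
  classical
  let f : (J → Option (Fin (m + 1) → V)) → J → Option (Fin (m + 1) → V) :=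
    fun b k => if k ∈ P then b k else none
  have hf : ∀ c : J → Fin (m + 1) → V,
      f (forgetOutside (insert j P) c) = forgetOutside P c := fun c => by
    funext k
    by_cases hk : k ∈ P <;> simp [f, forgetOutside, hk]
  have himg : f '' (forgetOutside (insert j P) '' closedWalkFamilies ℓ w) =
      forgetOutside P '' closedWalkFamilies ℓ w := by
    rw [Set.image_image]; simp only [hf]
  rw [← himg]
  apply Set.ncard_le_mul_ncard_image
  rintro _ ⟨_, ⟨c₀, hc₀, rfl⟩, rfl⟩
  rcases isEmpty_or_nonempty ι with hι | ⟨⟨t₀⟩⟩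
  · exact (hι.false (cyclicStep ℓ (c₀ j) 0)).elim
  -- The prescribed labels are read off the fixed representative `c₀`; on letters that do not occur
  -- in `P` the value `t₀` is arbitrary.
  let v : α → ι := fun a => if h : ∃ e : J × Fin (m + 1), e.1 ∈ P ∧ w e.1 e.2 = a then
    cyclicStep ℓ (c₀ h.choose.1) h.choose.2 else t₀
  -- The entry at `j` is always present in the families considered, so the default `c₀ j` is never
  -- taken.
  refine le_trans (Set.ncard_le_ncard_of_injOn (fun b => (b j).getD (c₀ j)) ?_ ?_) (hM v)
  · rintro _ ⟨⟨c, hc, rfl⟩, he⟩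
    have hP : ∀ k ∈ P, c k = c₀ k := fun k hk => by
      have := congrFun he k
      simpa [f, forgetOutside, hk] using this
    have hj : ((forgetOutside (insert j P) c j).getD (c₀ j)) = c j := by simp [forgetOutside]
    simp only [hj]
    refine ⟨fun i hi => ?_, fun i i' h => hc _ _ _ _ h⟩
    obtain ⟨k, hk, i', hi'⟩ := hi
    have hex : ∃ e : J × Fin (m + 1), e.1 ∈ P ∧ w e.1 e.2 = w j i := ⟨(k, i'), hk, hi'⟩
    have hv : v (w j i) = cyclicStep ℓ (c₀ hex.choose.1) hex.choose.2 := dif_pos hex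
    rw [hv, ← hP _ hex.choose_spec.1]
    exact hc _ _ _ _ hex.choose_spec.2.symm
  · rintro _ ⟨⟨c, hc, rfl⟩, he⟩ _ ⟨⟨c', hc', rfl⟩, he'⟩ h
    funext k
    have hcc := congrFun (he.trans he'.symm) k
    by_cases hkj : k = j
    · subst hkj
      simpa [forgetOutside] using h
    · by_cases hk : k ∈ P
      · simpa [f, forgetOutside, hk] using hcc
      · simp [forgetOutside, hk, hkj]

theorem FamilyBound.insert_member [Finite V] [Finite J] [DecidableEq J]
    (hD : ∀ x t, {y | ℓ x y = t}.ncard ≤ D) {s : ℕ} {P : Finset J} (h : FamilyBound ℓ w D s P)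
    {j : J} (hj : j ∉ P) : FamilyBound ℓ w D s (insert j P) := by
  have h1 := ncard_forgetOutside_insert_le (ℓ := ℓ) (w := w) P j _
    (fun v => ncard_closedWalksWithWord_le hD (w j) (lettersIn w P) v)
  unfold FamilyBound at *
  rw [Finset.card_insert_of_notMem hj, ncard_lettersIn_insert]
  calc _ ≤ (Nat.card V ^ (1 + (Set.range (w j) \ lettersIn w P).ncard) * D ^ m *
        (forgetOutside P '' closedWalkFamilies ℓ w).ncard) * Nat.card V ^ s := by gcongr
    _ = (Nat.card V ^ (1 + (Set.range (w j) \ lettersIn w P).ncard) * D ^ m) *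
        ((forgetOutside P '' closedWalkFamilies ℓ w).ncard * Nat.card V ^ s) := by ring
    _ ≤ (Nat.card V ^ (1 + (Set.range (w j) \ lettersIn w P).ncard) * D ^ m) *
        (Nat.card V ^ (P.card + (lettersIn w P).ncard) * D ^ (m * P.card)) := by gcongr
    _ = _ := by ring

/-- The exponent `s` counts the saved factors `|V|`. A new walk that has a letter occurring once in
it, and in none of the earlier walks, saves one more. -/
theorem FamilyBound.insert_of_unique [Finite V] [Finite J] [DecidableEq J]
    (hD : ∀ x t, {y | ℓ x y = t}.ncard ≤ D) {s : ℕ} {P : Finset J} (h : FamilyBound ℓ w D s P)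
    {j : J} (hj : j ∉ P) (i₀ : Fin (m + 1)) (hK : w j i₀ ∉ lettersIn w P)
    (hu : ∀ i, w j i = w j i₀ → i = i₀) : FamilyBound ℓ w D (s + 1) (insert j P) := by
  have h1 := ncard_forgetOutside_insert_le (ℓ := ℓ) (w := w) P j _
    (fun v => ncard_closedWalksWithWord_le_of_unique hD (w j) (lettersIn w P) v i₀ hK hu)
  unfold FamilyBound at *
  rw [Finset.card_insert_of_notMem hj, ncard_lettersIn_insert]
  calc _ ≤ (Nat.card V ^ ((Set.range (w j) \ lettersIn w P).ncard) * D ^ m *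
        (forgetOutside P '' closedWalkFamilies ℓ w).ncard) * Nat.card V ^ (s + 1) := by gcongr
    _ = (Nat.card V ^ (1 + (Set.range (w j) \ lettersIn w P).ncard) * D ^ m) *
        ((forgetOutside P '' closedWalkFamilies ℓ w).ncard * Nat.card V ^ s) := by ring
    _ ≤ (Nat.card V ^ (1 + (Set.range (w j) \ lettersIn w P).ncard) * D ^ m) *
        (Nat.card V ^ (P.card + (lettersIn w P).ncard) * D ^ (m * P.card)) := by gcongr
    _ = _ := by ring

theorem FamilyBound.union [Finite V] [Finite J] [DecidableEq J]
    (hD : ∀ x t, {y | ℓ x y = t}.ncard ≤ D) {s : ℕ} {P : Finset J} (h : FamilyBound ℓ w D s P)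
    (Q : Finset J) : FamilyBound ℓ w D s (Q ∪ P) := by
  induction Q using Finset.induction_on with
  | empty => simpa using h
  | insert j Q hj ih =>
    rw [Finset.insert_union]
    by_cases hjP : j ∈ Q ∪ P
    · rwa [Finset.insert_eq_of_mem hjP]
    · exact ih.insert_member hD hjP

theorem FamilyBound.ncard_le [Finite V] [Fintype J]
    (hD : ∀ x t, {y | ℓ x y = t}.ncard ≤ D) {s : ℕ} {P : Finset J} (h : FamilyBound ℓ w D s P) :
    (closedWalkFamilies ℓ w).ncard * Nat.card V ^ s ≤
      Nat.card V ^ (Fintype.card J + (Set.range fun e : J × Fin (m + 1) => w e.1 e.2).ncard) *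
        D ^ (m * Fintype.card J) := by
  classical
  have h2 := h.union hD Finset.univ
  rw [Finset.union_eq_left.2 (Finset.subset_univ P)] at h2
  have hinj : Function.Injective (forgetOutside (Finset.univ : Finset J) (C := Fin (m + 1) → V)) :=
    fun c c' hc => by
      funext j
      have := congrFun hc j
      simpa [forgetOutside] using congrArg (fun o => o.getD (c j)) this
  have hl : lettersIn w Finset.univ = Set.range fun e : J × Fin (m + 1) => w e.1 e.2 := by
    ext a; simp [lettersIn]
  rw [FamilyBound, Set.ncard_image_of_injective _ hinj, hl, Finset.card_univ] at h2
  exact h2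

end Families

end Walks

/-! ### Quadruples of closed walks -/

section Quadruples

variable {V : Type*} {ι : Type*} {α : Type*} {m : ℕ}

open Classical in
/-- The number of occurrences of a letter in a word. -/
noncomputable def letterCount {h : ℕ} (w : Fin h → α) (a : α) : ℕ :=
  (Finset.univ.filter fun i => w i = a).card

theorem letterCount_pos {h : ℕ} (w : Fin h → α) (i : Fin h) : 1 ≤ letterCount w (w i) :=
  Finset.card_pos.2 ⟨i, by simp⟩

theorem two_le_letterCount {h : ℕ} {w : Fin h → α} {i i' : Fin h} (hne : i' ≠ i)
    (he : w i' = w i) : 2 ≤ letterCount w (w i) :=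
  Finset.one_lt_card.2 ⟨i', by simp [he], i, by simp, hne⟩

theorem eq_of_letterCount_le_one {h : ℕ} {w : Fin h → α} {i i' : Fin h}
    (hc : letterCount w (w i) ≤ 1) (he : w i' = w i) : i' = i :=
  by_contra fun hne => by have := two_le_letterCount hne he; omega

theorem sum_letterCount [DecidableEq α] {h : ℕ} (w : Fin h → α) (I : Finset α)
    (hI : ∀ i, w i ∈ I) : ∑ a ∈ I, letterCount w a = h := by
  classical
  have := Finset.card_eq_sum_card_fiberwise (f := w) (s := Finset.univ) (t := I)
    (fun i _ => hI i)
  simp only [Finset.card_univ, Fintype.card_fin] at this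
  conv_rhs => rw [this]
  refine Finset.sum_congr rfl fun a _ => ?_
  unfold letterCount
  congr

theorem exists_notMem_pair (a b : Fin 4) : ∃ j : Fin 4, j ≠ a ∧ j ≠ b := by
  revert a b; decide

theorem add_le_sum_fin_four (f : Fin 4 → ℕ) {a b : Fin 4} (h : a ≠ b) :
    f a + f b ≤ ∑ j, f j := by
  rw [← Finset.sum_pair h]
  exact Finset.sum_le_sum_of_subset (Finset.subset_univ _)

theorem add_add_le_sum_fin_four (f : Fin 4 → ℕ) {a b c : Fin 4} (h : a ≠ b) (h' : a ≠ c)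
    (h'' : b ≠ c) : f a + f b + f c ≤ ∑ j, f j := by
  have : ∑ j ∈ ({a, b, c} : Finset (Fin 4)), f j = f a + f b + f c := by
    rw [Finset.sum_insert (by simp [h, h']), Finset.sum_pair h'']; ring
  rw [← this]
  exact Finset.sum_le_sum_of_subset (Finset.subset_univ _)

/-- Quadruples of closed walks of length `m + 1` in which every label occurs at least twice and
every walk shares a label with another one number `O(n ^ (2 (m + 1) + 2))`. -/
theorem ncard_closedWalkFamilies_four_le [Finite V] {ℓ : V → V → ι} {D : ℕ}
    (hD : ∀ x t, {y | ℓ x y = t}.ncard ≤ D) (w : Fin 4 → Fin (m + 1) → α)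
    (hmatch : ∀ j i, ∃ j' i', (j' ≠ j ∨ i' ≠ i) ∧ w j' i' = w j i)
    (hcross : ∀ j, ∃ i j' i', j' ≠ j ∧ w j' i' = w j i) :
    (closedWalkFamilies ℓ w).ncard ≤ Nat.card V ^ (2 * (m + 1) + 2) * D ^ (4 * m) := by
  classical
  rcases Nat.eq_zero_or_pos (Nat.card V) with h0 | hpos
  · have : IsEmpty V := by
      rcases Nat.card_eq_zero.1 h0 with h | h
      · exact h
      · exact absurd ‹Finite V› (not_finite_iff_infinite.2 h)
    rw [Set.eq_empty_of_isEmpty (closedWalkFamilies ℓ w)]; simp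
  set I : Finset α := Finset.univ.image fun e : Fin 4 × Fin (m + 1) => w e.1 e.2 with hIdef
  have hI : ∀ j i, w j i ∈ I := fun j i => Finset.mem_image.2 ⟨(j, i), by simp⟩
  have hIr : (Set.range fun e : Fin 4 × Fin (m + 1) => w e.1 e.2).ncard = I.card := by
    rw [← Set.ncard_coe_finset]; simp [hIdef]
  let M : α → ℕ := fun a => ∑ j, letterCount (w j) a
  have hsum : ∑ a ∈ I, M a = 4 * (m + 1) := by
    simp only [M]
    rw [Finset.sum_comm]
    simp [sum_letterCount _ I (hI _)]
  have hM2 : ∀ a ∈ I, 2 ≤ M a := by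
    intro a ha
    obtain ⟨⟨j, i⟩, -, rfl⟩ := Finset.mem_image.1 ha
    obtain ⟨j', i', hne, he⟩ := hmatch j i
    by_cases hjj : j' = j
    · subst hjj
      have h1 := two_le_letterCount (by simpa using hne) he
      have h2 : letterCount (w j') (w j' i) ≤ M (w j' i) :=
        Finset.single_le_sum (f := fun k => letterCount (w k) (w j' i)) (by simp)
          (Finset.mem_univ j')
      exact h1.trans h2
    · have h1 := letterCount_pos (w j) i
      have h2 := letterCount_pos (w j') i'
      rw [he] at h2
      have := add_le_sum_fin_four (fun k => letterCount (w k) (w j i)) hjj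
      simp only [M]; omega
  -- The excess, the sum of `M a - 2` over all letters, equals `4 (m + 1) - 2 |I|` and is even. The
  -- cases below are excess at least `4`, equal to `2`, and equal to `0`; they require `0`, `1` and
  -- `2` saved factors.
  have hexc : ∑ a ∈ I, (M a - 2) + 2 * I.card = 4 * (m + 1) := by
    rw [← hsum, mul_comm, ← smul_eq_mul, ← Finset.sum_const, ← Finset.sum_add_distrib]
    exact Finset.sum_congr rfl fun a ha => Nat.sub_add_cancel (hM2 a ha)
  have hexc1 : ∀ a ∈ I, M a - 2 + 2 * I.card ≤ 4 * (m + 1) := fun a ha => by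
    rw [← hexc]
    gcongr
    exact Finset.single_le_sum (f := fun a => M a - 2) (by simp) ha
  have hexc2 : ∀ a ∈ I, ∀ b ∈ I, a ≠ b → M a - 2 + (M b - 2) + 2 * I.card ≤ 4 * (m + 1) :=
    fun a ha b hb hab => by
    rw [← hexc, ← Finset.sum_pair (f := fun a => M a - 2) hab]
    gcongr
    intro x hx
    rcases Finset.mem_insert.1 hx with rfl | hx
    · exact ha
    · rw [Finset.mem_singleton.1 hx]; exact hb
  -- Four walks have four starting points and `|I|` free letters, so with `s` savings the exponent
  -- is `4 + |I| - s`.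
  have finish : ∀ (s : ℕ) (P : Finset (Fin 4)), FamilyBound ℓ w D s P →
      I.card ≤ 2 * (m + 1) + s - 2 → (closedWalkFamilies ℓ w).ncard ≤
        Nat.card V ^ (2 * (m + 1) + 2) * D ^ (4 * m) := by
    intro s P hP hs
    have h1 := hP.ncard_le hD
    rw [hIr, Fintype.card_fin, mul_comm m 4] at h1
    have h2 : (closedWalkFamilies ℓ w).ncard * Nat.card V ^ s ≤
        (Nat.card V ^ (2 * (m + 1) + 2) * D ^ (4 * m)) * Nat.card V ^ s := by
      refine h1.trans ?_
      rw [mul_right_comm, ← pow_add]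
      gcongr ?_ * _
      exact Nat.pow_le_pow_right hpos (by omega)
    exact Nat.le_of_mul_le_mul_right h2 (by positivity)
  by_cases hc : I.card + 2 ≤ 2 * (m + 1)
  · exact finish 0 ∅ familyBound_empty (by omega)
  by_cases hc1 : I.card + 1 ≤ 2 * (m + 1)
  · by_cases hgood : ∃ j i, ∀ i', w j i' = w j i → i' = i
    · obtain ⟨j, i, hu⟩ := hgood
      refine finish 1 {j} ?_ (by omega)
      have := (familyBound_empty (ℓ := ℓ) (w := w) (D := D)).insert_of_unique hD
        (j := j) (by simp) i (by simp [lettersIn]) hu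
      simpa using this
    -- Here every letter of a walk occurs at least twice in that walk, so a letter shared by two
    -- walks has excess at least `2`. Walk `0` shares a letter with `k`, and a walk `j` outside `{0,
    -- k}` shares one with `l`. Either this is one letter in three walks, or there are two different
    -- shared letters; both give excess at least `4`.
    · exfalso
      push Not at hgood
      have hge : ∀ j i, 2 ≤ letterCount (w j) (w j i) := fun j i => by
        obtain ⟨i', he, hne⟩ := hgood j i
        exact two_le_letterCount hne he
      obtain ⟨i, k, i', hk, he⟩ := hcross 0
      obtain ⟨j, hj0, hjk⟩ := exists_notMem_pair 0 k
      obtain ⟨i₁, l, i₁', hl, he₁⟩ := hcross j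
      have g1 := hge 0 i
      have g2 := hge k i'
      have g3 := hge j i₁
      have g4 := hge l i₁'
      rw [he] at g2
      rw [he₁] at g4
      by_cases hab : w 0 i = w j i₁
      · rw [← hab] at g3
        have := add_add_le_sum_fin_four (fun k => letterCount (w k) (w 0 i)) hk.symm hj0.symm
          hjk.symm
        have h4 := hexc1 _ (hI 0 i)
        simp only [M] at h4
        omega
      · have h1 := add_le_sum_fin_four (fun k => letterCount (w k) (w 0 i)) hk
        have h2 := add_le_sum_fin_four (fun k => letterCount (w k) (w j i₁)) hl
        have h4 := hexc2 _ (hI 0 i) _ (hI j i₁) hab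
        simp only [M] at h4
        omega
  -- With excess `0` every letter occurs exactly twice, so a shared letter occurs once in each of
  -- two walks and in no other walk.
  · have hM : ∀ j i, M (w j i) ≤ 2 := fun j i => by
      have := hexc1 _ (hI j i)
      omega
    have two : ∀ (j k : Fin 4) (i i' : Fin (m + 1)), (∀ x, w j x = w j i → x = i) →
        j ≠ k → (∀ x, w j x ≠ w k i') → (∀ x, w k x = w k i' → x = i') →
        (closedWalkFamilies ℓ w).ncard ≤ Nat.card V ^ (2 * (m + 1) + 2) * D ^ (4 * m) := by
      intro j k i i' hj hjk hn hk
      refine finish 2 {k, j} ?_ (by omega)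
      have h1 := (familyBound_empty (ℓ := ℓ) (w := w) (D := D)).insert_of_unique hD
        (j := j) (by simp) i (by simp [lettersIn]) hj
      refine h1.insert_of_unique hD (j := k) (by simpa using hjk.symm) i' ?_ hk
      rintro ⟨x, hx, y, hy⟩
      have : x = j := by simpa using hx
      subst this
      exact hn y hy
    have once : ∀ (j k : Fin 4) (i i' : Fin (m + 1)), j ≠ k → w j i = w k i' →
        (∀ x, w j x = w j i → x = i) ∧ ∀ l, l ≠ j → l ≠ k → ∀ x, w l x ≠ w j i := by
      intro j k i i' hjk he
      have h1 := letterCount_pos (w j) i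
      have h2 := letterCount_pos (w k) i'
      have h3 := hM j i
      rw [← he] at h2
      simp only [M] at h3
      refine ⟨fun x hx => eq_of_letterCount_le_one ?_ hx, fun l hlj hlk x hx => ?_⟩
      · have := add_le_sum_fin_four (fun k => letterCount (w k) (w j i)) hjk
        omega
      · have h4 := letterCount_pos (w l) x
        rw [hx] at h4
        have := add_add_le_sum_fin_four (fun k => letterCount (w k) (w j i)) hjk hlj.symm hlk.symm
        omega
    obtain ⟨i, p, i', hp, he⟩ := hcross 0
    obtain ⟨k, hk0, hkp⟩ := exists_notMem_pair 0 p
    obtain ⟨i₁, q, i₁', hq, he₁⟩ := hcross k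
    have o1 := once 0 p i i' hp.symm he.symm
    have o1' := once p 0 i' i hp he
    have o2 := once k q i₁ i₁' hq.symm he₁.symm
    -- The letter linking `k` to `q` is absent from walk `0` unless `q = 0`, and then walks `0` and
    -- `k` provide the two savings. If `q = 0`, use walk `p` instead: the letter linking it to `0`
    -- is absent from walk `k`.
    by_cases hq0 : q = 0
    · exact two k p i₁ i' o2.1 hkp (o1'.2 k hkp hk0) o1'.1
    · exact two 0 k i i₁ o1.1 hk0.symm (o2.2 0 hk0.symm (Ne.symm hq0)) o2.1

end Quadruples

/-! ### Words -/

theorem Nat.exists_count_eq (p : ℕ → Prop) [DecidablePred p] {m r : ℕ} (h : m < Nat.count p r) :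
    ∃ s < r, p s ∧ Nat.count p s = m := by
  induction r with
  | zero => simp at h
  | succ r ih =>
    by_cases hm : m < Nat.count p r
    · obtain ⟨s, hs, h1⟩ := ih hm
      exact ⟨s, hs.trans (Nat.lt_succ_self r), h1⟩
    · rw [Nat.count_succ] at h
      by_cases hp : p r
      · rw [if_pos hp] at h
        exact ⟨r, Nat.lt_succ_self r, hp, by omega⟩
      · rw [if_neg hp] at h
        omega

/-- The letter at a position is the number of first occurrences that precede the first occurrence of
its value. Every smaller number `m` is the letter of an earlier first occurrence, which is the
alphabetical condition. -/
theorem exists_word {α : Type*} {h : ℕ} (f : Fin h → α) :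
    ∃ W : Word h, ∀ i j, W.letter i = W.letter j ↔ f i = f j := by
  classical
  let isFirst : ℕ → Prop := fun r => ∃ hr : r < h, ∀ j < (⟨r, hr⟩ : Fin h), f j ≠ f ⟨r, hr⟩
  have hex : ∀ i : Fin h, ∃ r : ℕ, ∃ hr : r < h, f ⟨r, hr⟩ = f i := fun i => ⟨i, i.2, rfl⟩
  let r : Fin h → ℕ := fun i => Nat.find (hex i)
  have hr : ∀ i, ∃ hr : r i < h, f ⟨r i, hr⟩ = f i := fun i => Nat.find_spec (hex i)
  have hri : ∀ i, r i ≤ i := fun i => Nat.find_min' (hex i) ⟨i.2, rfl⟩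
  have hfirst : ∀ i, isFirst (r i) := fun i => by
    obtain ⟨h1, h2⟩ := hr i
    refine ⟨h1, fun j hj he => ?_⟩
    exact Nat.find_min (hex i) (m := j) hj ⟨j.2, by rw [← h2, ← he]⟩
  have hr_eq : ∀ i j, r i = r j ↔ f i = f j := fun i j => by
    constructor
    · intro h'
      obtain ⟨h1, h2⟩ := hr i
      obtain ⟨h3, h4⟩ := hr j
      rw [← h2, ← h4]
      congr 2
    · intro h'
      simp only [r, h']
  refine ⟨⟨fun i => Nat.count isFirst (r i), fun i m hm => ?_⟩, fun i j => ?_⟩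
  · obtain ⟨s, hs, ⟨hsh, h1⟩, h2⟩ := Nat.exists_count_eq _ hm
    refine ⟨⟨s, hsh⟩, lt_of_lt_of_le (b := r i) hs (hri i), ?_⟩
    have : r ⟨s, hsh⟩ = s := by
      refine le_antisymm (hri _) ?_
      by_contra hlt
      obtain ⟨h3, h4⟩ := hr ⟨s, hsh⟩
      exact h1 ⟨r ⟨s, hsh⟩, h3⟩ (not_le.1 hlt) h4
    simp only [this, h2]
  · rw [← hr_eq]
    exact ⟨fun h' => Nat.count_injective (hfirst i) (hfirst j) h', fun h' => by simp [h']⟩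

theorem Word.ext_letter {h : ℕ} {W W' : Word h} (he : ∀ i, W.letter i = W'.letter i) :
    W = W' := by
  cases W; cases W'; congr; exact funext he

/-- If `W'` had a larger letter at `i`, its alphabetical order would place the letter `W.letter i`
at an earlier position. There the two words agree, so `i` would not be a first occurrence in `W`. -/
theorem Word.letter_le_of_agree {h : ℕ} {W W' : Word h} {i : Fin h}
    (hlt : ∀ j < i, W.letter j = W'.letter j) (hfirst : ∀ j < i, W.letter j ≠ W.letter i) :
    W'.letter i ≤ W.letter i := by
  by_contra hcon
  obtain ⟨j, hj, he⟩ := W'.alphabetical i _ (not_le.1 hcon)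
  exact hfirst j hj (by rw [hlt j hj, he])

theorem Word.eq_of_forall_iff {h : ℕ} {W W' : Word h}
    (he : ∀ i j, W.letter i = W.letter j ↔ W'.letter i = W'.letter j) : W = W' := by
  apply Word.ext_letter
  intro i
  induction i using WellFoundedLT.induction with
  | ind i ih =>
    by_cases hf : ∃ j < i, W.letter j = W.letter i
    · obtain ⟨j, hj, hji⟩ := hf
      rw [← hji, ih j hj]
      exact (he j i).1 hji
    · push Not at hf
      refine le_antisymm (Word.letter_le_of_agree (fun j hj => (ih j hj).symm) fun j hj h' => ?_)
        (Word.letter_le_of_agree ih hf)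
      exact hf j hj ((he j i).2 h')

theorem letterCount_eq_ncard {α : Type*} {h : ℕ} (w : Fin h → α) (a : α) :
    letterCount w a = {i | w i = a}.ncard := by
  rw [letterCount, ← Set.ncard_coe_finset]
  congr 1
  ext; simp

theorem Word.PairMatched.letterCount_eq {h : ℕ} {W : Word h} (hW : W.PairMatched) (i : Fin h) :
    letterCount W.letter (W.letter i) = 2 := by
  rw [← hW i, letterCount_eq_ncard]

/-- The letters form an initial segment of `ℕ`, and `2k` positions leave room for only `k` letters
that occur twice. -/
theorem Word.PairMatched.letter_lt {k : ℕ} {W : Word (2 * k)} (hW : W.PairMatched)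
    (i : Fin (2 * k)) : W.letter i < k := by
  classical
  by_contra hcon
  set I := Finset.univ.image W.letter
  have h1 := sum_letterCount W.letter I fun i => Finset.mem_image_of_mem _ (Finset.mem_univ i)
  rw [Finset.sum_congr rfl (g := fun _ => 2)] at h1
  · rw [Finset.sum_const, smul_eq_mul] at h1
    have h2 : Finset.range (k + 1) ⊆ I := by
      intro a ha
      have ha' : a ≤ W.letter i := by have := Finset.mem_range.1 ha; omega
      rcases ha'.eq_or_lt with rfl | hlt
      · exact Finset.mem_image_of_mem _ (Finset.mem_univ i)
      · obtain ⟨j, -, rfl⟩ := W.alphabetical i a hlt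
        exact Finset.mem_image_of_mem _ (Finset.mem_univ j)
    have := Finset.card_le_card h2
    rw [Finset.card_range] at this
    omega
  · intro a ha
    obtain ⟨j, -, rfl⟩ := Finset.mem_image.1 ha
    exact hW.letterCount_eq j

/-- A pair-matched word is determined by the positions of the second occurrences of its letters. -/
theorem Word.exists_injective_pairMatched (k : ℕ) :
    ∃ s : {W : Word (2 * k) // W.PairMatched} → Fin k → Fin (2 * k), Function.Injective s := by
  classical
  rcases Nat.eq_zero_or_pos k with rfl | hk
  · refine ⟨fun _ i => i.elim0, fun W W' _ => ?_⟩
    exact Subtype.ext (Word.ext_letter fun i => Fin.elim0 i)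
  have : NeZero (2 * k) := ⟨by omega⟩
  have hmax : ∀ (W : {W : Word (2 * k) // W.PairMatched}) (a : Fin k), ∃ p : Fin (2 * k),
      (∃ i, W.1.letter i = a) → W.1.letter p = a ∧ ∀ i, W.1.letter i = a → i ≤ p := by
    intro W a
    by_cases h : ∃ i, W.1.letter i = a
    · have hne : (Finset.univ.filter fun i => W.1.letter i = a).Nonempty := by
        obtain ⟨i, hi⟩ := h
        exact ⟨i, by simp [hi]⟩
      refine ⟨Finset.max' _ hne, fun _ => ⟨?_, fun i hi => Finset.le_max' _ _ (by simp [hi])⟩⟩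
      have := Finset.max'_mem _ hne
      simpa using this
    · exact ⟨0, fun h' => (h h').elim⟩
  choose s hs using hmax
  refine ⟨s, fun W W' h => ?_⟩
  have second : ∀ (W W' : {W : Word (2 * k) // W.PairMatched}), s W = s W' →
      ∀ i, (∀ j < i, W.1.letter j = W'.1.letter j) → (∃ j < i, W.1.letter j = W.1.letter i) →
        W.1.letter i = W'.1.letter i := by
    rintro W W' h i hlt ⟨j, hj, hji⟩
    obtain ⟨h1, h2⟩ := hs W ⟨_, W.2.letter_lt i⟩ ⟨i, rfl⟩
    -- Otherwise `j`, `i` and the last occurrence would be three positions of one letter.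
    have h3 : s W ⟨_, W.2.letter_lt i⟩ = i := by
      by_contra hne
      have : ({j, i, s W ⟨_, W.2.letter_lt i⟩} : Finset (Fin (2 * k))) ⊆
          Finset.univ.filter fun x => W.1.letter x = W.1.letter i := by
        intro x hx
        simp only [Finset.mem_insert, Finset.mem_singleton] at hx
        rcases hx with rfl | rfl | rfl
        · simp [hji]
        · simp
        · simp at h1; simp [h1]
      have hcard := Finset.card_le_card this
      have hle := h2 i rfl
      rw [Finset.card_insert_of_notMem, Finset.card_pair (Ne.symm hne)] at hcard
      · have hcard' : 2 + 1 ≤ letterCount W.1.letter (W.1.letter i) := by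
          unfold letterCount; convert hcard
        have := hcard'.trans_eq (W.2.letterCount_eq i)
        omega
      · simp only [Finset.mem_insert, Finset.mem_singleton, not_or]
        exact ⟨hj.ne, (lt_of_lt_of_le hj hle).ne⟩
    have h4 := (hs W' ⟨_, W.2.letter_lt i⟩ ⟨j, by rw [← hlt j hj, hji]⟩).1
    rw [← h, h3] at h4
    exact h4.symm
  apply Subtype.ext
  apply Word.ext_letter
  intro i
  induction i using WellFoundedLT.induction with
  | ind i ih =>
    by_cases hf : ∃ j < i, W.1.letter j = W.1.letter i
    · exact second W W' h i ih hf
    by_cases hf' : ∃ j < i, W'.1.letter j = W'.1.letter i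
    · exact (second W' W h.symm i (fun j hj => (ih j hj).symm) hf').symm
    push Not at hf hf'
    exact le_antisymm (Word.letter_le_of_agree (fun j hj => (ih j hj).symm) hf')
      (Word.letter_le_of_agree ih hf)

instance Word.finite_pairMatched (k : ℕ) : Finite {W : Word (2 * k) // W.PairMatched} := by
  obtain ⟨s, hs⟩ := Word.exists_injective_pairMatched k
  exact Finite.of_injective s hs

theorem Word.card_pairMatched_le (k : ℕ) :
    Nat.card {W : Word (2 * k) // W.PairMatched} ≤ (2 * k) ^ k := by
  obtain ⟨s, hs⟩ := Word.exists_injective_pairMatched k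
  simpa [Nat.card_fun] using Nat.card_le_card_of_injective s hs

/-! ### Pair-matched circuits -/

namespace SymmLink

variable {ι : Type u}

theorem PropertyB.exists_bound {L : SymmLink ι} (hB : L.PropertyB) :
    ∃ D : ℕ, 1 ≤ D ∧ ∀ n (k : Fin n) t, {l | L.toFun n k l = t}.ncard ≤ D := by
  obtain ⟨D, hD⟩ := ENat.ne_top_iff_exists.1 (ne_of_lt hB)
  refine ⟨max 1 D, le_max_left _ _, fun n k t => ?_⟩
  by_cases ht : t ∈ L.values n
  · have h1 : Set.encard {l | L.toFun n k l = t} ≤ L.rowMultiplicity :=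
      le_iSup_of_le n (le_iSup_of_le t (le_iSup_of_le ht (le_iSup_of_le k le_rfl)))
    rw [← hD, ← Set.Finite.cast_ncard_eq (Set.toFinite _), ENat.natCast_le_natCast] at h1
    exact h1.trans (le_max_right _ _)
  · have : {l | L.toFun n k l = t} = ∅ := by
      ext l
      simp only [Set.mem_ofPred_eq, Set.mem_empty_iff_false, iff_false]
      rintro rfl
      exact ht ⟨(k, l), rfl⟩
    simp [this]

/-- The circuits of length `h` in `{1, …, n}` in which each label occurs exactly twice. -/
def pairCircuits (L : SymmLink ι) (h n : ℕ) : Set (Fin (h + 1) → Fin n) :=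
  {π | π 0 = π (Fin.last h) ∧ ∀ i, letterCount (L.stepValue π) (L.stepValue π i) = 2}

theorem pairCircuits_eq_iUnion (L : SymmLink ι) (k n : ℕ) :
    L.pairCircuits (2 * k) n = ⋃ W : {W : Word (2 * k) // W.PairMatched}, L.circuits W.1 n := by
  classical
  ext π
  simp only [Set.mem_iUnion]
  constructor
  · rintro ⟨h0, h1⟩
    obtain ⟨W, hW⟩ := exists_word (L.stepValue π)
    refine ⟨⟨W, fun i => ?_⟩, h0, hW⟩
    refine Eq.trans ?_ (h1 i)
    simp only [letterCount_eq_ncard, hW]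
  · rintro ⟨⟨W, hP⟩, h0, hW⟩
    refine ⟨h0, fun i => ?_⟩
    refine Eq.trans ?_ (hP i)
    simp only [letterCount_eq_ncard, ← hW]

/-- A circuit determines its word, so the sets of circuits of different words are disjoint. -/
theorem ncard_pairCircuits (L : SymmLink ι) (k n : ℕ) :
    (L.pairCircuits (2 * k) n).ncard =
      ∑ᶠ W : {W : Word (2 * k) // W.PairMatched}, (L.circuits W.1 n).ncard := by
  rw [pairCircuits_eq_iUnion, Set.ncard_iUnion_of_finite (fun _ => Set.toFinite _)]
  intro W W' hne
  refine Set.disjoint_left.2 fun π h h' => hne (Subtype.ext (Word.eq_of_forall_iff fun i j => ?_))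
  rw [h.2 i j, h'.2 i j]

theorem ncard_circuits_le {L : SymmLink ι} {D : ℕ}
    (hD : ∀ n (k : Fin n) t, {l | L.toFun n k l = t}.ncard ≤ D) {k : ℕ} {W : Word (2 * k)}
    (hW : W.PairMatched) (n : ℕ) :
    (L.circuits W n).ncard ≤ n ^ (1 + k) * D ^ (2 * k) := by
  rcases Nat.eq_zero_or_pos n with rfl | hn
  · rw [Set.eq_empty_of_isEmpty (L.circuits W 0)]; simp
  let v : ℕ → ι := fun _ => L.toFun n ⟨0, hn⟩ ⟨0, hn⟩
  have hsub : L.circuits W n ⊆ walksWithWord (L.toFun n) W.letter ∅ v :=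
    fun π hπ => ⟨fun i hi => hi.elim, fun i j hij => (hπ.2 i j).1 hij⟩
  refine (Set.ncard_le_ncard hsub).trans ((ncard_walksWithWord_le (hD n) W.letter ∅ v).trans ?_)
  rw [Nat.card_eq_fintype_card, Fintype.card_fin]
  gcongr
  calc _ ≤ (Set.Iio k).ncard := by
          refine Set.ncard_le_ncard ?_ (Set.finite_Iio k)
          rintro _ ⟨⟨i, rfl⟩, -⟩
          exact hW.letter_lt i
    _ = k := by rw [← Finset.coe_Iio, Set.ncard_coe_finset, Nat.card_Iio]

theorem pairCircuits_odd (L : SymmLink ι) (k n : ℕ) : L.pairCircuits (2 * k + 1) n = ∅ := by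
  classical
  refine Set.eq_empty_of_forall_notMem fun π hπ => ?_
  have h1 := sum_letterCount (L.stepValue π) (Finset.univ.image (L.stepValue π))
    fun i => Finset.mem_image_of_mem _ (Finset.mem_univ i)
  rw [Finset.sum_congr rfl (g := fun _ => 2)] at h1
  · rw [Finset.sum_const, smul_eq_mul] at h1
    omega
  · intro a ha
    obtain ⟨j, -, rfl⟩ := Finset.mem_image.1 ha
    exact hπ.2 j

/-- The normalized numbers of pair-matched circuits converge, for every length, to `β`. -/
def HasPairLimits (L : SymmLink ι) (β : ℕ → ℝ) : Prop :=
  ∀ h, Tendsto (fun n : ℕ => ((L.pairCircuits h n).ncard : ℝ) / (n * √n ^ h)) atTop (𝓝 (β h))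

/-- For even lengths `β` is the finite sum of the word limits; for odd lengths it vanishes because
there are no pair-matched circuits. The growth bound multiplies the number of pair-matched words by
the Property B estimate for each word. -/
theorem exists_hasPairLimits {L : SymmLink ι} {D : ℕ}
    (hD : ∀ n (k : Fin n) t, {l | L.toFun n k l = t}.ncard ≤ D) (hL : L.WordLimitsExist) :
    ∃ β : ℕ → ℝ, L.HasPairLimits β ∧ ∀ k, β (2 * k) ≤ ((2 * k) ^ k : ℕ) * (D : ℝ) ^ (2 * k) := by
  have heven : ∀ (k n : ℕ), (n : ℝ) * √n ^ (2 * k) = (n : ℝ) ^ (1 + k) := fun k n => by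
    rw [pow_mul, Real.sq_sqrt (Nat.cast_nonneg n)]; ring
  have key : ∀ h, ∃ b : ℝ, Tendsto (fun n : ℕ =>
      ((L.pairCircuits h n).ncard : ℝ) / (n * √n ^ h)) atTop (𝓝 b) := by
    intro h
    obtain ⟨k, rfl | rfl⟩ := Nat.even_or_odd' h
    · have := Fintype.ofFinite {W : Word (2 * k) // W.PairMatched}
      choose p hp using hL k
      refine ⟨∑ W : {W : Word (2 * k) // W.PairMatched}, p W.1 W.2, ?_⟩
      have : ∀ n : ℕ, ((L.pairCircuits (2 * k) n).ncard : ℝ) / (n * √n ^ (2 * k)) =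
          ∑ W : {W : Word (2 * k) // W.PairMatched},
            ((L.circuits W.1 n).ncard : ℝ) / (n : ℝ) ^ (1 + k) := fun n => by
        rw [heven, ncard_pairCircuits, finsum_eq_sum_of_fintype, Nat.cast_sum, Finset.sum_div]
      simp only [this]
      exact tendsto_finsetSum _ fun W _ => hp W.1 W.2
    · refine ⟨0, ?_⟩
      simp [pairCircuits_odd]
  choose β hβ using key
  refine ⟨β, hβ, fun k => le_of_tendsto (hβ (2 * k)) ?_⟩
  filter_upwards [eventually_gt_atTop 0] with n hn
  have hn' : (0 : ℝ) < n := by exact_mod_cast hn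
  rw [heven, div_le_iff₀ (by positivity)]
  have := Fintype.ofFinite {W : Word (2 * k) // W.PairMatched}
  have hle : (L.pairCircuits (2 * k) n).ncard ≤ (2 * k) ^ k * (n ^ (1 + k) * D ^ (2 * k)) := by
    rw [ncard_pairCircuits, finsum_eq_sum_of_fintype]
    calc _ ≤ ∑ W : {W : Word (2 * k) // W.PairMatched}, n ^ (1 + k) * D ^ (2 * k) :=
          Finset.sum_le_sum fun W _ => ncard_circuits_le hD W.2 n
      _ ≤ _ := by
          rw [Finset.sum_const, smul_eq_mul, Finset.card_univ, ← Nat.card_eq_fintype_card]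
          gcongr
          exact Word.card_pairMatched_le k
  calc ((L.pairCircuits (2 * k) n).ncard : ℝ)
      ≤ (((2 * k) ^ k * (n ^ (1 + k) * D ^ (2 * k)) : ℕ) : ℝ) := by exact_mod_cast hle
    _ = _ := by push_cast; ring

end SymmLink

/-! ### Products of independent inputs -/

theorem prod_abs_le_one_add_sum {E : Type*} [Fintype E] (a : E → ℝ) :
    ∏ e, |a e| ≤ 1 + ∑ e, |a e| ^ Fintype.card E := by
  rcases isEmpty_or_nonempty E with hE | hE
  · simp
  obtain ⟨e₀, -, he₀⟩ := Finset.exists_max_image Finset.univ (fun e => |a e|)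
    Finset.univ_nonempty
  have h1 : ∏ e, |a e| ≤ |a e₀| ^ Fintype.card E := by
    calc ∏ e, |a e| ≤ ∏ _e : E, |a e₀| :=
          Finset.prod_le_prod (fun e _ => abs_nonneg _) fun e he => he₀ e he
      _ = _ := by simp
  have h2 : |a e₀| ^ Fintype.card E ≤ ∑ e, |a e| ^ Fintype.card E :=
    Finset.single_le_sum (f := fun e => |a e| ^ Fintype.card E) (fun e _ => by positivity)
      (Finset.mem_univ e₀)
  linarith

section Products

variable {ι : Type u} {Ω : Type w} [mΩ : MeasurableSpace Ω] {P : Measure Ω} {x : ι → Ω → ℝ}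

/-- The σ-algebra generated by the variables with index in `S`. -/
@[reducible]
def sigmaOf (x : ι → Ω → ℝ) (S : Set ι) : MeasurableSpace Ω :=
  ⨆ t ∈ S, MeasurableSpace.comap (x t) inferInstance

omit mΩ in
theorem measurable_sigmaOf {S : Set ι} {t : ι} (ht : t ∈ S) : Measurable[sigmaOf x S] (x t) :=
  (comap_measurable (x t)).mono (le_iSup₂_of_le t ht le_rfl) le_rfl

omit mΩ in
theorem measurable_sigmaOf_prod {S : Set ι} {E : Type*} (s : Finset E) {f : E → ι}
    (hf : ∀ e ∈ s, f e ∈ S) : Measurable[sigmaOf x S] fun ω => ∏ e ∈ s, x (f e) ω :=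
  Finset.measurable_fun_prod (m := sigmaOf x S) s fun e he => measurable_sigmaOf (hf e he)

/-- Functions of disjoint sets of inputs are independent, so the integral factors. Both vanishing
results for centered products are instances of this. -/
theorem integral_mul_eq_zero_of_disjoint (hx : IsStandardizedInput x P) {S T : Set ι}
    (hST : Disjoint S T) {U W : Ω → ℝ} (hU : Measurable[sigmaOf x S] U)
    (hW : Measurable[sigmaOf x T] W) (h0 : ∫ ω, U ω ∂P = 0) : ∫ ω, U ω * W ω ∂P = 0 := by
  have hle : ∀ t, MeasurableSpace.comap (x t) inferInstance ≤ mΩ := fun t =>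
    (hx.measurable t).comap_le
  have hleS : ∀ S : Set ι, sigmaOf x S ≤ mΩ := fun S => iSup₂_le fun t _ => hle t
  have hind := indep_iSup_of_disjoint hle hx.indep hST
  have hUW : IndepFun U W P := by
    rw [IndepFun_iff_Indep]
    exact indep_of_indep_of_le_left (indep_of_indep_of_le_right hind hW.comap_le) hU.comap_le
  rw [hUW.integral_fun_mul_eq_mul_integral (hU.mono (hleS S) le_rfl).aestronglyMeasurable
    (hW.mono (hleS T) le_rfl).aestronglyMeasurable, h0, zero_mul]

theorem integral_prod_eq_zero_of_unique (hx : IsStandardizedInput x P) {E : Type*} [Fintype E]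
    (f : E → ι) (e₀ : E) (hu : ∀ e, f e = f e₀ → e = e₀) : ∫ ω, ∏ e, x (f e) ω ∂P = 0 := by
  classical
  have h := integral_mul_eq_zero_of_disjoint hx (S := {f e₀}) (T := {f e₀}ᶜ)
    disjoint_compl_right (measurable_sigmaOf (x := x) (Set.mem_singleton (f e₀)))
    (measurable_sigmaOf_prod (Finset.univ.erase e₀) (f := f) fun e he => fun h' =>
      (Finset.mem_erase.1 he).1 (hu e h')) (hx.mean _)
  rw [← h]
  congr with ω
  exact (Finset.mul_prod_erase Finset.univ (fun e => x (f e) ω) (Finset.mem_univ e₀)).symm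

theorem IsStandardizedInput.integral_sq (hx : IsStandardizedInput x P) (t : ι) :
    ∫ ω, x t ω ^ 2 ∂P = 1 := by
  rw [← hx.variance t, variance_of_integral_eq_zero (hx.measurable t).aemeasurable (hx.mean t)]

theorem integral_prod_eq_one_of_pairs (hx : IsStandardizedInput x P) {h : ℕ} (f : Fin h → ι)
    (hf : ∀ i, letterCount f (f i) = 2) : ∫ ω, ∏ i, x (f i) ω ∂P = 1 := by
  classical
  set I := Finset.univ.image f
  have h1 : ∀ ω, ∏ i, x (f i) ω = ∏ a : I, (fun y : ℝ => y ^ 2) (x a ω) := fun ω => by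
    rw [Finset.prod_comp (fun a => x a ω) f, Finset.prod_coe_sort I fun a => x a ω ^ 2]
    refine Finset.prod_congr rfl fun a ha => ?_
    obtain ⟨i, -, rfl⟩ := Finset.mem_image.1 ha
    have := hf i
    rw [letterCount] at this
    congr 1
  simp only [h1]
  have hind : iIndepFun (fun a : I => x a) P := hx.indep.precomp Subtype.val_injective
  rw [hind.integral_fun_prod_comp (f := fun _ y => y ^ 2)
    (fun a => (hx.measurable a).aemeasurable)
    (fun a => (by fun_prop : Measurable fun y : ℝ => y ^ 2).aestronglyMeasurable)]
  simp [hx.integral_sq]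

theorem InputA3.exists_bound (hx : InputA3 x P) : ∃ C : ℕ → ℝ, ∀ k, 0 ≤ C k ∧
    ∀ t, Integrable (fun ω => |x t ω| ^ k) P ∧ ∫ ω, |x t ω| ^ k ∂P ≤ C k := by
  choose C hC using hx.2
  exact ⟨fun k => max 0 (C k), fun k => ⟨le_max_left _ _, fun t =>
    ⟨(hC k t).1, (hC k t).2.trans (le_max_right _ _)⟩⟩⟩

theorem measurable_prod_inputs (hx : IsStandardizedInput x P) {E : Type*} [Fintype E]
    (f : E → ι) : Measurable fun ω => ∏ e, x (f e) ω :=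
  Finset.measurable_fun_prod _ fun e _ => hx.measurable (f e)

variable [IsProbabilityMeasure P]

theorem integrable_one_add_sum {C : ℕ → ℝ}
    (hC : ∀ k, 0 ≤ C k ∧ ∀ t, Integrable (fun ω => |x t ω| ^ k) P ∧ ∫ ω, |x t ω| ^ k ∂P ≤ C k)
    {E : Type*} [Fintype E] (f : E → ι) (k : ℕ) :
    Integrable (fun ω => 1 + ∑ e, |x (f e) ω| ^ k) P ∧
      ∫ ω, (1 + ∑ e, |x (f e) ω| ^ k) ∂P ≤ 1 + Fintype.card E * C k := by
  have h1 : Integrable (fun ω => ∑ e, |x (f e) ω| ^ k) P :=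
    integrable_finsetSum _ fun e _ => ((hC k).2 (f e)).1
  refine ⟨(integrable_const 1).add h1, ?_⟩
  rw [integral_add (integrable_const 1) h1, integral_finsetSum _ fun e _ => ((hC k).2 (f e)).1]
  simp only [integral_const, probReal_univ, smul_eq_mul, mul_one, add_le_add_iff_left]
  calc ∑ e, ∫ ω, |x (f e) ω| ^ k ∂P ≤ ∑ _e : E, C k :=
        Finset.sum_le_sum fun e _ => ((hC k).2 (f e)).2
    _ = _ := by simp

theorem integrable_prod_inputs (hx : IsStandardizedInput x P) {C : ℕ → ℝ}
    (hC : ∀ k, 0 ≤ C k ∧ ∀ t, Integrable (fun ω => |x t ω| ^ k) P ∧ ∫ ω, |x t ω| ^ k ∂P ≤ C k)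
    {E : Type*} [Fintype E] (f : E → ι) :
    Integrable (fun ω => ∏ e, x (f e) ω) P ∧
      |∫ ω, ∏ e, x (f e) ω ∂P| ≤ 1 + Fintype.card E * C (Fintype.card E) := by
  obtain ⟨h1, h2⟩ := integrable_one_add_sum hC f (Fintype.card E)
  have h3 : ∀ ω, ‖∏ e, x (f e) ω‖ ≤ 1 + ∑ e, |x (f e) ω| ^ Fintype.card E := fun ω => by
    rw [Real.norm_eq_abs, Finset.abs_prod]
    exact prod_abs_le_one_add_sum _
  refine ⟨h1.mono' (measurable_prod_inputs hx f).aestronglyMeasurable (ae_of_all _ h3), ?_⟩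
  refine le_trans ?_ h2
  exact norm_integral_le_of_norm_le h1 (ae_of_all _ h3)

/-! ### Centered products along several walks -/

section Centered

variable {m : ℕ}

/-- The centered product of the inputs along a sequence of labels. -/
noncomputable def centeredProduct (x : ι → Ω → ℝ) (P : Measure Ω) {h : ℕ} (f : Fin h → ι)
    (ω : Ω) : ℝ :=
  ∏ i, x (f i) ω - ∫ ω', ∏ i, x (f i) ω' ∂P

omit [IsProbabilityMeasure P] in
theorem measurable_sigmaOf_centeredProduct {S : Set ι} {h : ℕ} {f : Fin h → ι}
    (hf : ∀ i, f i ∈ S) : Measurable[sigmaOf x S] (centeredProduct x P f) :=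
  Measurable.sub_const (m := sigmaOf x S) (measurable_sigmaOf_prod _ fun i _ => hf i) _

omit [IsProbabilityMeasure P] in
theorem measurable_sigmaOf_prod_centeredProduct {S : Set ι} {J : Type*} (s : Finset J) {h : ℕ}
    {f : J → Fin h → ι} (hf : ∀ j ∈ s, ∀ i, f j i ∈ S) :
    Measurable[sigmaOf x S] fun ω => ∏ j ∈ s, centeredProduct x P (f j) ω :=
  Finset.measurable_fun_prod (m := sigmaOf x S) s fun j hj =>
    measurable_sigmaOf_centeredProduct (hf j hj)

/-- A walk that shares no label with the others contributes an independent centered factor. -/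
theorem integral_prod_centered_eq_zero_of_not_cross (hx : IsStandardizedInput x P) {C : ℕ → ℝ}
    (hC : ∀ k, 0 ≤ C k ∧ ∀ t, Integrable (fun ω => |x t ω| ^ k) P ∧ ∫ ω, |x t ω| ^ k ∂P ≤ C k)
    {J : Type*} [Fintype J] {h : ℕ} (f : J → Fin h → ι) (j₀ : J)
    (hj : ∀ i j i', j ≠ j₀ → f j i' ≠ f j₀ i) :
    ∫ ω, ∏ j, centeredProduct x P (f j) ω ∂P = 0 := by
  classical
  have h0 : ∫ ω, centeredProduct x P (f j₀) ω ∂P = 0 := by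
    unfold centeredProduct
    rw [integral_sub (integrable_prod_inputs hx hC _).1 (integrable_const _)]
    simp
  have h1 := integral_mul_eq_zero_of_disjoint hx (S := Set.range (f j₀))
    (T := (Set.range (f j₀))ᶜ) disjoint_compl_right
    (measurable_sigmaOf_centeredProduct (P := P) (f := f j₀) fun i => ⟨i, rfl⟩)
    (measurable_sigmaOf_prod_centeredProduct (P := P) (Finset.univ.erase j₀) (f := f)
      fun j hj' i' => by
        rintro ⟨i, hi⟩
        exact hj i j i' (Finset.mem_erase.1 hj').1 hi.symm) h0
  rw [← h1]
  congr with ω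
  exact (Finset.mul_prod_erase Finset.univ (fun j => centeredProduct x P (f j) ω)
    (Finset.mem_univ j₀)).symm

omit [IsProbabilityMeasure P] in
-- A label that occurs once makes the mean subtracted from its own walk vanish. The corresponding
-- input then splits off as an independent factor with mean `0`.
theorem integral_prod_centered_eq_zero_of_unique (hx : IsStandardizedInput x P)
    {J : Type*} [Fintype J] {h : ℕ} (f : J → Fin h → ι) (j₀ : J) (i₀ : Fin h)
    (hu : ∀ j i, (j ≠ j₀ ∨ i ≠ i₀) → f j i ≠ f j₀ i₀) :
    ∫ ω, ∏ j, centeredProduct x P (f j) ω ∂P = 0 := by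
  classical
  have h0 : ∫ ω, ∏ i, x (f j₀ i) ω ∂P = 0 :=
    integral_prod_eq_zero_of_unique hx (f j₀) i₀ fun i hi => by
      by_contra hne
      exact hu j₀ i (Or.inr hne) hi
  have h1 := integral_mul_eq_zero_of_disjoint hx (S := {f j₀ i₀}) (T := {f j₀ i₀}ᶜ)
    disjoint_compl_right (measurable_sigmaOf (x := x) (Set.mem_singleton (f j₀ i₀)))
    (Measurable.mul (m := sigmaOf x {f j₀ i₀}ᶜ)
      (measurable_sigmaOf_prod (Finset.univ.erase i₀) (f := f j₀)
        fun i hi => hu j₀ i (Or.inr (Finset.mem_erase.1 hi).1))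
      (measurable_sigmaOf_prod_centeredProduct (P := P) (Finset.univ.erase j₀) (f := f)
        fun j hj i => hu j i (Or.inl (Finset.mem_erase.1 hj).1))) (hx.mean _)
  rw [← h1]
  congr with ω
  rw [← Finset.mul_prod_erase Finset.univ (fun j => centeredProduct x P (f j) ω)
    (Finset.mem_univ j₀)]
  simp only [Pi.mul_apply]
  rw [← mul_assoc, Finset.mul_prod_erase Finset.univ (fun i => x (f j₀ i) ω) (Finset.mem_univ i₀)]
  simp only [centeredProduct, h0, sub_zero]

/-- The bound depends on the length and on the moment bounds only, not on the labels. The product of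
the four factors is at most `1` plus the sum of their fourth powers, and `8 = 2 ^ 3` comes from `(a
+ B) ^ 4 ≤ 2 ^ 3 (a ^ 4 + B ^ 4)`. -/
theorem abs_integral_prod_centered_le (hx : IsStandardizedInput x P) {C : ℕ → ℝ}
    (hC : ∀ k, 0 ≤ C k ∧ ∀ t, Integrable (fun ω => |x t ω| ^ k) P ∧ ∫ ω, |x t ω| ^ k ∂P ≤ C k)
    {h : ℕ} (f : Fin 4 → Fin h → ι) :
    Integrable (fun ω => ∏ j, centeredProduct x P (f j) ω) P ∧
    |∫ ω, ∏ j, centeredProduct x P (f j) ω ∂P| ≤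
      1 + 4 * (8 * ((1 + h * C (4 * h)) + (1 + h * C h) ^ 4)) := by
  set B : ℝ := 1 + h * C h with hB
  let G : Ω → ℝ := fun ω => 1 + ∑ j, 8 * ((1 + ∑ i, |x (f j i) ω| ^ (4 * h)) + B ^ 4)
  have hG1 : ∀ j, Integrable (fun ω => 8 * ((1 + ∑ i, |x (f j i) ω| ^ (4 * h)) + B ^ 4)) P :=
    fun j => ((integrable_one_add_sum hC (f j) (4 * h)).1.add (integrable_const _)).const_mul _
  have hG2 : Integrable (fun ω => ∑ j, 8 * ((1 + ∑ i, |x (f j i) ω| ^ (4 * h)) + B ^ 4)) P :=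
    integrable_finsetSum _ fun j _ => hG1 j
  have hG : Integrable G P := (integrable_const _).add hG2
  have hGle : ∫ ω, G ω ∂P ≤ 1 + 4 * (8 * ((1 + h * C (4 * h)) + B ^ 4)) := by
    simp only [G]
    rw [integral_add (integrable_const _) hG2, integral_finsetSum _ fun j _ => hG1 j]
    simp only [integral_const, probReal_univ, smul_eq_mul, mul_one, add_le_add_iff_left]
    calc _ ≤ ∑ _j : Fin 4, 8 * ((1 + h * C (4 * h)) + B ^ 4) := by
          refine Finset.sum_le_sum fun j _ => ?_
          rw [integral_const_mul, integral_add (integrable_one_add_sum hC (f j) (4 * h)).1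
            (integrable_const _)]
          have := (integrable_one_add_sum hC (f j) (4 * h)).2
          simp only [Fintype.card_fin] at this
          simp only [integral_const, probReal_univ, smul_eq_mul, one_mul]
          linarith
      _ = _ := by simp
  have hle : ∀ ω, ‖∏ j, centeredProduct x P (f j) ω‖ ≤ G ω := fun ω => by
    rw [Real.norm_eq_abs, Finset.abs_prod]
    refine (prod_abs_le_one_add_sum _).trans ?_
    simp only [G, Fintype.card_fin]
    gcongr with j
    have h1 : |centeredProduct x P (f j) ω| ≤ ∏ i, |x (f j i) ω| + B := by
      unfold centeredProduct
      refine (abs_sub _ _).trans ?_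
      rw [Finset.abs_prod]
      gcongr
      have := (integrable_prod_inputs hx hC (f j)).2
      simpa using this
    have hB0 : 0 ≤ B := by have := (hC h).1; positivity
    have h0 : 0 ≤ ∏ i, |x (f j i) ω| := Finset.prod_nonneg fun i _ => abs_nonneg _
    calc |centeredProduct x P (f j) ω| ^ 4 ≤ (∏ i, |x (f j i) ω| + B) ^ 4 := by gcongr
      _ ≤ 2 ^ (4 - 1) * ((∏ i, |x (f j i) ω|) ^ 4 + B ^ 4) := add_pow_le h0 hB0 4
      _ = 8 * (∏ i, |x (f j i) ω ^ 4| + B ^ 4) := by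
          rw [← Finset.prod_pow]; norm_num
      _ ≤ 8 * ((1 + ∑ i, |x (f j i) ω| ^ (4 * h)) + B ^ 4) := by
          gcongr
          refine (prod_abs_le_one_add_sum _).trans (le_of_eq ?_)
          simp [pow_mul]
  have hmeas : Measurable fun ω => ∏ j, centeredProduct x P (f j) ω :=
    Finset.measurable_fun_prod _ fun j _ => (measurable_prod_inputs hx (f j)).sub_const _
  exact ⟨hG.mono' hmeas.aestronglyMeasurable (ae_of_all _ hle),
    (norm_integral_le_of_norm_le hG (ae_of_all _ hle)).trans hGle⟩

end Centered

end Products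

/-! ### Moments of sums over closed walks -/

/-- Taking positions as letters gives a finite alphabet that is independent of the label set and of
`n`, so sums over all coincidence patterns have boundedly many terms. -/
theorem exists_kernel_word {E ι : Type*} [Nonempty E] (f : E → ι) :
    ∃ w : E → E, ∀ e e', w e = w e' ↔ f e = f e' := by
  refine ⟨fun e => Function.invFun f (f e), fun e e' => ⟨fun h => ?_, fun h => congrArg _ h⟩⟩
  have h1 := Function.invFun_eq (f := f) ⟨e, rfl⟩
  have h2 := Function.invFun_eq (f := f) ⟨e', rfl⟩
  simp only at h
  rw [← h1, ← h2, h]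

section WalkSums

variable {V : Type*} {ι : Type u} {m : ℕ} {ℓ : V → V → ι} {D : ℕ}

/-- Quadruples of closed walks in which each label occurs twice and each walk shares a label with
another one. -/
def linkedQuadruples (ℓ : V → V → ι) (m : ℕ) : Set (Fin 4 → Fin (m + 1) → V) :=
  {c | (∀ j i, ∃ j' i', (j' ≠ j ∨ i' ≠ i) ∧ cyclicStep ℓ (c j') i' = cyclicStep ℓ (c j) i) ∧
    ∀ j, ∃ i j' i', j' ≠ j ∧ cyclicStep ℓ (c j') i' = cyclicStep ℓ (c j) i}

theorem ncard_linkedQuadruples_le [Finite V] (hD : ∀ x t, {y | ℓ x y = t}.ncard ≤ D) :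
    (linkedQuadruples ℓ m).ncard ≤ Fintype.card (Fin 4 → Fin (m + 1) → Fin 4 × Fin (m + 1)) *
      (Nat.card V ^ (2 * (m + 1) + 2) * D ^ (4 * m)) := by
  classical
  let good : (Fin 4 → Fin (m + 1) → Fin 4 × Fin (m + 1)) → Prop := fun w =>
    (∀ j i, ∃ j' i', (j' ≠ j ∨ i' ≠ i) ∧ w j' i' = w j i) ∧
    ∀ j, ∃ i j' i', j' ≠ j ∧ w j' i' = w j i
  have hsub : linkedQuadruples ℓ m ⊆
      ⋃ w ∈ (Finset.univ.filter good), closedWalkFamilies ℓ w := by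
    intro c hc
    obtain ⟨w, hw⟩ := exists_kernel_word
      (fun e : Fin 4 × Fin (m + 1) => cyclicStep ℓ (c e.1) e.2)
    simp only [Set.mem_iUnion]
    refine ⟨fun j i => w (j, i), Finset.mem_filter.2 ⟨Finset.mem_univ _, ?_, ?_⟩, ?_⟩
    · intro j i
      obtain ⟨j', i', h1, h2⟩ := hc.1 j i
      exact ⟨j', i', h1, (hw (j', i') (j, i)).2 h2⟩
    · intro j
      obtain ⟨i, j', i', h1, h2⟩ := hc.2 j
      exact ⟨i, j', i', h1, (hw (j', i') (j, i)).2 h2⟩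
    · exact fun j i j' i' h => (hw (j, i) (j', i')).1 h
  refine (Set.ncard_le_ncard hsub (Set.toFinite _)).trans ?_
  refine (Finset.set_ncard_biUnion_le _ _).trans ?_
  refine (Finset.sum_le_card_nsmul _ _ (Nat.card V ^ (2 * (m + 1) + 2) * D ^ (4 * m)) ?_).trans ?_
  · intro w hw
    have := (Finset.mem_filter.1 hw).2
    exact ncard_closedWalkFamilies_four_le hD w this.1 this.2
  · rw [smul_eq_mul]
    gcongr
    exact Finset.card_le_univ _

/-- Closed walks in which each label occurs at least twice, and not each exactly twice. -/
def excessWalks (ℓ : V → V → ι) (m : ℕ) : Set (Fin (m + 1) → V) :=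
  {c | (∀ i, ∃ i', i' ≠ i ∧ cyclicStep ℓ c i' = cyclicStep ℓ c i) ∧
    ¬ ∀ i, letterCount (cyclicStep ℓ c) (cyclicStep ℓ c i) = 2}

/-- The `m + 1` positions carry every letter at least twice and one letter more often, so twice the
number of letters is less than `m + 1`. -/
theorem ncard_range_le_of_excess {α : Type*} (w : Fin (m + 1) → α)
    (h2 : ∀ i, ∃ i', i' ≠ i ∧ w i' = w i) (h3 : ¬ ∀ i, letterCount w (w i) = 2) :
    (Set.range w).ncard ≤ m / 2 := by
  classical
  set I := Finset.univ.image w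
  have hI : ∀ i, w i ∈ I := fun i => Finset.mem_image_of_mem _ (Finset.mem_univ i)
  have hsum := sum_letterCount w I hI
  have hge : ∀ a ∈ I, 2 ≤ letterCount w a := by
    intro a ha
    obtain ⟨i, -, rfl⟩ := Finset.mem_image.1 ha
    obtain ⟨i', hne, he⟩ := h2 i
    exact two_le_letterCount hne he
  push Not at h3
  obtain ⟨i, hi⟩ := h3
  have hlt : ∑ _a ∈ I, 2 < ∑ a ∈ I, letterCount w a :=
    Finset.sum_lt_sum hge ⟨w i, hI i, lt_of_le_of_ne (hge _ (hI i)) (Ne.symm hi)⟩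
  rw [hsum, Finset.sum_const, smul_eq_mul] at hlt
  have hr : (Set.range w).ncard = I.card := by
    rw [← Set.ncard_coe_finset]; simp [I]
  omega

theorem ncard_excessWalks_le [Finite V] (hD : ∀ x t, {y | ℓ x y = t}.ncard ≤ D) :
    (excessWalks ℓ m).ncard ≤ Fintype.card (Fin (m + 1) → Fin (m + 1)) *
      (Nat.card V ^ (1 + m / 2) * D ^ m) := by
  classical
  rcases Nat.eq_zero_or_pos (Nat.card V) with h0 | hpos
  · have : IsEmpty V := by
      rcases Nat.card_eq_zero.1 h0 with h | h
      · exact h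
      · exact absurd ‹Finite V› (not_finite_iff_infinite.2 h)
    rw [Set.eq_empty_of_isEmpty (excessWalks ℓ m)]; simp
  obtain ⟨⟨y⟩⟩ := (Nat.card_pos_iff.1 hpos)
  let v : Fin (m + 1) → ι := fun _ => ℓ y y
  let good : (Fin (m + 1) → Fin (m + 1)) → Prop := fun w =>
    (∀ i, ∃ i', i' ≠ i ∧ w i' = w i) ∧ ¬ ∀ i, letterCount w (w i) = 2
  have hsub : excessWalks ℓ m ⊆
      ⋃ w ∈ (Finset.univ.filter good), closedWalksWithWord ℓ w ∅ v := by
    intro c hc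
    obtain ⟨w, hw⟩ := exists_kernel_word (cyclicStep ℓ c)
    simp only [Set.mem_iUnion]
    refine ⟨w, Finset.mem_filter.2 ⟨Finset.mem_univ _, ?_, ?_⟩, ?_⟩
    · intro i
      obtain ⟨i', h1, h2⟩ := hc.1 i
      exact ⟨i', h1, (hw _ _).2 h2⟩
    · simpa only [letterCount_eq_ncard, hw] using hc.2
    · exact ⟨fun i hi => hi.elim, fun i j h => (hw _ _).1 h⟩
  refine (Set.ncard_le_ncard hsub (Set.toFinite _)).trans ?_
  refine (Finset.set_ncard_biUnion_le _ _).trans ?_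
  refine (Finset.sum_le_card_nsmul _ _ (Nat.card V ^ (1 + m / 2) * D ^ m) ?_).trans ?_
  · intro w hw
    have := (Finset.mem_filter.1 hw).2
    refine (ncard_closedWalksWithWord_le hD w ∅ v).trans ?_
    rw [Set.sdiff_empty]
    gcongr ?_ * _
    refine Nat.pow_le_pow_right hpos ?_
    have := ncard_range_le_of_excess w this.1 this.2
    omega
  · rw [smul_eq_mul]
    gcongr
    exact Finset.card_le_univ _

/-- The sum of the products of `y` along the labels of all closed walks of length `m + 1`. -/
noncomputable def walkSum [Fintype V] (ℓ : V → V → ι) (m : ℕ) (y : ι → ℝ) : ℝ :=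
  ∑ c : Fin (m + 1) → V, ∏ i, y (cyclicStep ℓ c i)

variable {Ω : Type w} [MeasurableSpace Ω] {P : Measure Ω} {x : ι → Ω → ℝ}

theorem measurable_walkSum [Fintype V] (hx : IsStandardizedInput x P) :
    Measurable fun ω => walkSum ℓ m fun t => x t ω :=
  Finset.measurable_fun_sum _ fun c _ => measurable_prod_inputs hx (cyclicStep ℓ c)

variable [IsProbabilityMeasure P]

theorem walkSum_sub_integral [Fintype V] (hx : InputA3 x P) (ω : Ω) :
    walkSum ℓ m (fun t => x t ω) - ∫ ω', walkSum ℓ m (fun t => x t ω') ∂P =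
      ∑ c : Fin (m + 1) → V, centeredProduct x P (cyclicStep ℓ c) ω := by
  obtain ⟨C, hC⟩ := hx.exists_bound
  unfold walkSum
  rw [integral_finsetSum _ fun c _ => (integrable_prod_inputs hx.1 hC (cyclicStep ℓ c)).1,
    ← Finset.sum_sub_distrib]
  rfl

/-- The fourth central moment of the sum over closed walks of length `m + 1` is
`O(n ^ (2 (m + 1) + 2))`, uniformly in the labelling. -/
theorem exists_fourth_moment_bound (hx : InputA3 x P) (m D : ℕ) : ∃ K : ℝ,
    ∀ (n : ℕ) (ℓ : Fin n → Fin n → ι), (∀ x t, {y | ℓ x y = t}.ncard ≤ D) →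
      Integrable (fun ω => (walkSum ℓ m (fun t => x t ω) -
        ∫ ω', walkSum ℓ m (fun t => x t ω') ∂P) ^ 4) P ∧
      ∫ ω, (walkSum ℓ m (fun t => x t ω) - ∫ ω', walkSum ℓ m (fun t => x t ω') ∂P) ^ 4 ∂P ≤
        K * (n : ℝ) ^ (2 * (m + 1) + 2) := by
  classical
  obtain ⟨C, hC⟩ := hx.exists_bound
  obtain ⟨M, hM⟩ : ∃ M : ℝ, M = 1 + 4 * (8 * ((1 + (m + 1 : ℕ) * C (4 * (m + 1))) +
    (1 + (m + 1 : ℕ) * C (m + 1)) ^ 4)) := ⟨_, rfl⟩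
  have hM0 : 0 ≤ M := by
    have h1 := (hC (4 * (m + 1))).1
    have h2 := (hC (m + 1)).1
    rw [hM]; positivity
  refine ⟨M * ((Fintype.card (Fin 4 → Fin (m + 1) → Fin 4 × Fin (m + 1)) : ℝ) * D ^ (4 * m)),
    fun n ℓ hD => ?_⟩
  have hexp : ∀ ω, (walkSum ℓ m (fun t => x t ω) - ∫ ω', walkSum ℓ m (fun t => x t ω') ∂P) ^ 4 =
      ∑ c : Fin 4 → Fin (m + 1) → Fin n, ∏ j, centeredProduct x P (cyclicStep ℓ (c j)) ω := by
    intro ω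
    rw [walkSum_sub_integral hx, Fintype.sum_pow]
  simp only [hexp]
  have hint := fun c : Fin 4 → Fin (m + 1) → Fin n =>
    abs_integral_prod_centered_le hx.1 hC fun j => cyclicStep ℓ (c j)
  refine ⟨integrable_finsetSum _ fun c _ => (hint c).1, ?_⟩
  rw [integral_finsetSum _ fun c _ => (hint c).1]
  have hterm : ∀ c : Fin 4 → Fin (m + 1) → Fin n,
      ∫ ω, ∏ j, centeredProduct x P (cyclicStep ℓ (c j)) ω ∂P ≤
        if c ∈ linkedQuadruples ℓ m then M else 0 := by
    intro c
    split_ifs with hc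
    · exact (le_abs_self _).trans ((hint c).2.trans_eq hM.symm)
    · apply le_of_eq
      by_cases h1 : ∀ j i, ∃ j' i', (j' ≠ j ∨ i' ≠ i) ∧
          cyclicStep ℓ (c j') i' = cyclicStep ℓ (c j) i
      · have h2 : ¬ ∀ j, ∃ i j' i', j' ≠ j ∧ cyclicStep ℓ (c j') i' = cyclicStep ℓ (c j) i :=
          fun h2 => hc ⟨h1, h2⟩
        push Not at h2
        obtain ⟨j₀, hj₀⟩ := h2
        exact integral_prod_centered_eq_zero_of_not_cross hx.1 hC _ j₀ hj₀
      · push Not at h1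
        obtain ⟨j₀, i₀, h1⟩ := h1
        exact integral_prod_centered_eq_zero_of_unique hx.1 (fun j => cyclicStep ℓ (c j)) j₀ i₀ h1
  refine (Finset.sum_le_sum fun c _ => hterm c).trans ?_
  rw [← Finset.sum_filter, Finset.sum_const, nsmul_eq_mul, mul_comm, mul_assoc]
  gcongr
  have hcard := ncard_linkedQuadruples_le (m := m) hD
  rw [Set.ncard_eq_toFinset_card', Set.toFinset_card, Fintype.card_subtype,
    Nat.card_eq_fintype_card, Fintype.card_fin] at hcard
  have hcard' : ((Finset.univ.filter fun c => c ∈ linkedQuadruples ℓ m).card : ℝ) ≤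
    ((Fintype.card (Fin 4 → Fin (m + 1) → Fin 4 × Fin (m + 1)) *
      (n ^ (2 * (m + 1) + 2) * D ^ (4 * m)) : ℕ) : ℝ) := by exact_mod_cast hcard
  refine hcard'.trans_eq ?_
  push_cast; ring

open Classical in
/-- The mean of the sum over closed walks is the number of pair-matched closed walks, up to terms
of lower order. -/
theorem exists_mean_bound (hx : InputA3 x P) (m D : ℕ) : ∃ K : ℝ,
    ∀ (n : ℕ) (ℓ : Fin n → Fin n → ι), (∀ x t, {y | ℓ x y = t}.ncard ≤ D) →
      |∫ ω, walkSum ℓ m (fun t => x t ω) ∂P -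
        {c : Fin (m + 1) → Fin n | ∀ i, letterCount (cyclicStep ℓ c) (cyclicStep ℓ c i) = 2}.ncard| ≤
        K * (n : ℝ) ^ (1 + m / 2) := by
  obtain ⟨C, hC⟩ := hx.exists_bound
  set B : ℝ := 1 + (m + 1 : ℕ) * C (m + 1) with hB
  have hB0 : 0 ≤ B := by have := (hC (m + 1)).1; positivity
  refine ⟨B * (Fintype.card (Fin (m + 1) → Fin (m + 1)) * D ^ m), fun n ℓ hD => ?_⟩
  have hint := fun c : Fin (m + 1) → Fin n => integrable_prod_inputs hx.1 hC (cyclicStep ℓ c)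
  -- The mean is `1` for a pair-matched walk and `0` for a walk with a label that occurs once. In
  -- the remaining, excess walks it is bounded by `B`.
  have hterm : ∀ c : Fin (m + 1) → Fin n, |∫ ω, ∏ i, x (cyclicStep ℓ c i) ω ∂P -
      if ∀ i, letterCount (cyclicStep ℓ c) (cyclicStep ℓ c i) = 2 then 1 else 0| ≤
        if c ∈ excessWalks ℓ m then B else 0 := by
    intro c
    by_cases h1 : ∀ i, letterCount (cyclicStep ℓ c) (cyclicStep ℓ c i) = 2
    · rw [if_pos h1, integral_prod_eq_one_of_pairs hx.1 _ h1]
      split_ifs <;> simp [hB0]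
    · rw [if_neg h1, sub_zero]
      by_cases h2 : ∀ i, ∃ i', i' ≠ i ∧ cyclicStep ℓ c i' = cyclicStep ℓ c i
      · rw [if_pos ⟨h2, h1⟩]
        simpa [hB] using (hint c).2
      · push Not at h2
        obtain ⟨i₀, hi₀⟩ := h2
        rw [integral_prod_eq_zero_of_unique hx.1 (cyclicStep ℓ c) i₀ fun i hi => by
          by_contra hne; exact hi₀ i hne hi]
        split_ifs <;> simp [hB0]
  have hpair : (({c | ∀ i, letterCount (cyclicStep ℓ c) (cyclicStep ℓ c i) = 2} :
      Set (Fin (m + 1) → Fin n)).ncard : ℝ) = ∑ c : Fin (m + 1) → Fin n,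
      if ∀ i, letterCount (cyclicStep ℓ c) (cyclicStep ℓ c i) = 2 then 1 else 0 := by
    rw [Finset.sum_boole, Set.ncard_eq_toFinset_card', Set.toFinset_card, Fintype.card_subtype]
    rfl
  unfold walkSum
  rw [hpair, integral_finsetSum _ fun c _ => (hint c).1, ← Finset.sum_sub_distrib]
  refine (Finset.abs_sum_le_sum_abs _ _).trans ((Finset.sum_le_sum fun c _ => hterm c).trans ?_)
  rw [← Finset.sum_filter, Finset.sum_const, nsmul_eq_mul, mul_comm, mul_assoc]
  gcongr
  have hcard := ncard_excessWalks_le (m := m) hD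
  rw [Set.ncard_eq_toFinset_card', Set.toFinset_card, Fintype.card_subtype,
    Nat.card_eq_fintype_card, Fintype.card_fin] at hcard
  have hcard' : ((Finset.univ.filter fun c => c ∈ excessWalks ℓ m).card : ℝ) ≤
    ((Fintype.card (Fin (m + 1) → Fin (m + 1)) * (n ^ (1 + m / 2) * D ^ m) : ℕ) : ℝ) := by
    exact_mod_cast hcard
  refine hcard'.trans_eq ?_
  push_cast; ring

end WalkSums

/-- The expectation of the sum of the fourth powers is finite, so the sum is finite almost surely
and its terms tend to `0`. -/
theorem ae_tendsto_zero_of_fourth_moment {Ω : Type w} [MeasurableSpace Ω] {P : Measure Ω}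
    {Z : ℕ → Ω → ℝ} (hm : ∀ n, Measurable (Z n)) (hi : ∀ n, Integrable (fun ω => Z n ω ^ 4) P)
    {b : ℕ → ℝ} (hb : Summable b) (hle : ∀ n, ∫ ω, Z n ω ^ 4 ∂P ≤ b n) :
    ∀ᵐ ω ∂P, Tendsto (fun n => Z n ω) atTop (𝓝 0) := by
  have hnn : ∀ n ω, 0 ≤ Z n ω ^ 4 := fun n ω => by positivity
  have h0 : ∀ n, 0 ≤ ∫ ω, Z n ω ^ 4 ∂P := fun n => integral_nonneg (hnn n)
  have hfin : ∫⁻ ω, ∑' n, ENNReal.ofReal (Z n ω ^ 4) ∂P ≠ ⊤ := by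
    rw [lintegral_tsum fun n => ((hm n).pow_const 4).ennreal_ofReal.aemeasurable]
    have : ∀ n, ∫⁻ ω, ENNReal.ofReal (Z n ω ^ 4) ∂P ≤ ENNReal.ofReal (b n) := fun n => by
      rw [← ofReal_integral_eq_lintegral_ofReal (hi n) (ae_of_all _ (hnn n))]
      exact ENNReal.ofReal_le_ofReal (hle n)
    refine ne_top_of_le_ne_top ?_ (ENNReal.tsum_le_tsum this)
    exact hb.tsum_ofReal_ne_top
  have hae := ae_lt_top' (AEMeasurable.tsum fun n =>
    ((hm n).pow_const 4).ennreal_ofReal.aemeasurable) hfin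
  filter_upwards [hae] with ω hω
  have h1 := ENNReal.tendsto_atTop_zero_of_tsum_ne_top hω.ne
  have h2 : Tendsto (fun n => Z n ω ^ 4) atTop (𝓝 0) := by
    have := (ENNReal.tendsto_toReal ENNReal.zero_ne_top).comp h1
    simpa [Function.comp_def, ENNReal.toReal_ofReal (hnn _ _)] using this
  -- The fourth root is taken as a square root applied twice.
  have h3 := (Real.continuous_sqrt.comp Real.continuous_sqrt).continuousAt.tendsto.comp h2
  refine (tendsto_zero_iff_abs_tendsto_zero _).2 ?_
  simp only [Function.comp_def, Real.sqrt_zero] at h3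
  refine h3.congr fun n => ?_
  rw [show Z n ω ^ 4 = (Z n ω ^ 2) ^ 2 by ring, Real.sqrt_sq (sq_nonneg _), Real.sqrt_sq_eq_abs]
  rfl

namespace SymmLink

variable {ι : Type u}

/-- Dropping the final vertex, which repeats the first one, turns a circuit into a cyclically
indexed closed walk. The inverse appends `c 0`. -/
theorem ncard_pairCircuits_succ (L : SymmLink ι) (m n : ℕ) : (L.pairCircuits (m + 1) n).ncard =
    {c : Fin (m + 1) → Fin n | ∀ i, letterCount (cyclicStep (L.toFun n) c)
      (cyclicStep (L.toFun n) c i) = 2}.ncard := by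
  have hstep : ∀ π : Fin (m + 1 + 1) → Fin n, π 0 = π (Fin.last (m + 1)) →
      L.stepValue π = cyclicStep (L.toFun n) (Fin.init π : Fin (m + 1) → Fin n) := by
    intro π hπ
    funext i
    simp only [stepValue, cyclicStep, Fin.init]
    congr 1
    induction i using Fin.lastCases with
    | last => simp [← hπ]
    | cast j => rw [Fin.coeSucc_eq_succ, Fin.succ_castSucc]
  refine Set.ncard_congr (fun π _ => Fin.init π) ?_ ?_ ?_
  · rintro π ⟨h0, h1⟩
    rw [hstep π h0] at h1
    exact h1
  · rintro π π' ⟨h0, -⟩ ⟨h0', -⟩ h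
    rw [← Fin.snoc_init_self π, ← Fin.snoc_init_self π', h, ← h0, ← h0']
    congr 1
    exact congrFun h 0
  · intro c hc
    have h0 : (Fin.snoc c (c 0) : Fin (m + 1 + 1) → Fin n) 0 =
        (Fin.snoc c (c 0) : Fin (m + 1 + 1) → Fin n) (Fin.last (m + 1)) := by
      rw [Fin.snoc_last]
      exact Fin.snoc_castSucc (α := fun _ => Fin n) (c 0) c 0
    refine ⟨Fin.snoc c (c 0), ⟨h0, ?_⟩, Fin.init_snoc _ _⟩
    rw [hstep _ h0, Fin.init_snoc]
    exact hc

/-- Almost sure convergence of the moments of the spectral distribution. -/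
theorem ae_tendsto_walkSum {L : SymmLink ι} {D : ℕ}
    (hD : ∀ n (k : Fin n) t, {l | L.toFun n k l = t}.ncard ≤ D) {β : ℕ → ℝ}
    (hβ : L.HasPairLimits β) {Ω : Type w} [MeasurableSpace Ω] {P : Measure Ω}
    [IsProbabilityMeasure P] {x : ι → Ω → ℝ} (hx : InputA3 x P) (m : ℕ) :
    ∀ᵐ ω ∂P, Tendsto (fun n : ℕ => walkSum (L.toFun n) m (fun t => x t ω) /
      (n * √n ^ (m + 1))) atTop (𝓝 (β (m + 1))) := by
  obtain ⟨K, hK⟩ := exists_fourth_moment_bound hx m D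
  obtain ⟨K', hK'⟩ := exists_mean_bound hx m D
  -- The fourth power of the normalization exceeds the fourth moment bound by exactly `n ^ 2`, which
  -- leaves the summable bound `K / n ^ 2`.
  have hpow : ∀ n : ℕ, ((n : ℝ) * √n ^ (m + 1)) ^ 4 = n ^ (2 * (m + 1) + 2) * (n : ℝ) ^ 2 := by
    intro n
    have : √(n : ℝ) ^ 2 = n := Real.sq_sqrt (Nat.cast_nonneg n)
    calc ((n : ℝ) * √n ^ (m + 1)) ^ 4 = n ^ 4 * (√n ^ 2) ^ (2 * (m + 1)) := by ring
      _ = _ := by rw [this]; ring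
  have hvar := ae_tendsto_zero_of_fourth_moment (P := P)
    (Z := fun n ω => (walkSum (L.toFun n) m (fun t => x t ω) -
      ∫ ω', walkSum (L.toFun n) m (fun t => x t ω') ∂P) / (n * √n ^ (m + 1)))
    (b := fun n => K * (1 / (n : ℝ) ^ 2))
    (fun n => ((measurable_walkSum hx.1).sub_const _).div_const _)
    (fun n => by
      simp only [div_pow]
      exact (hK n _ (hD n)).1.div_const _)
    ((Real.summable_one_div_nat_pow.2 one_lt_two).mul_left K)
    (fun n => by
      simp only [div_pow]
      rw [integral_div, hpow]
      rcases Nat.eq_zero_or_pos n with rfl | hn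
      · simp
      have hn' : (0 : ℝ) < n := by exact_mod_cast hn
      rw [div_le_iff₀ (by positivity)]
      refine (hK n _ (hD n)).2.trans_eq ?_
      field_simp)
  have hmean : Tendsto (fun n : ℕ => (∫ ω, walkSum (L.toFun n) m (fun t => x t ω) ∂P -
      (L.pairCircuits (m + 1) n).ncard) / (n * √n ^ (m + 1))) atTop (𝓝 0) := by
    have hlim : Tendsto (fun n : ℕ => |K'| * (√n)⁻¹) atTop (𝓝 0) := by
      have := (tendsto_inv_atTop_zero.comp
        (Real.tendsto_sqrt_atTop.comp tendsto_natCast_atTop_atTop)).const_mul |K'|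
      simpa [Function.comp_def] using this
    refine squeeze_zero_norm' ?_ hlim
    filter_upwards [eventually_gt_atTop 0] with n hn
    have hn' : (1 : ℝ) ≤ n := by exact_mod_cast hn
    have hs1 : 1 ≤ √(n : ℝ) := Real.one_le_sqrt.2 hn'
    have hs0 : 0 < √(n : ℝ) := by linarith
    rw [Real.norm_eq_abs, abs_div, abs_of_nonneg (a := (n : ℝ) * √n ^ (m + 1)) (by positivity),
      div_le_iff₀ (by positivity), ncard_pairCircuits_succ]
    refine (hK' n _ (hD n)).trans ?_
    -- The error of the mean is `O(n * √n ^ m)`, one factor `√n` below the normalization `n * √n ^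
    -- (m + 1)`.
    have h1 : (n : ℝ) ^ (m / 2) ≤ √n ^ m := by
      calc (n : ℝ) ^ (m / 2) = √n ^ (2 * (m / 2)) := by
            rw [pow_mul, Real.sq_sqrt (Nat.cast_nonneg n)]
        _ ≤ √n ^ m := pow_le_pow_right₀ hs1 (by omega)
    calc K' * (n : ℝ) ^ (1 + m / 2) ≤ |K'| * (n * √n ^ m) := by
          rw [pow_add, pow_one]
          gcongr
          exact le_abs_self _
      _ = _ := by rw [pow_succ]; field_simp
  filter_upwards [hvar] with ω hω
  have := (hω.add hmean).add (hβ (m + 1))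
  simp only [zero_add] at this
  refine this.congr fun n => ?_
  ring

end SymmLink

/-! ### Traces of powers and spectral distributions -/

section Trace

variable {V : Type*} [Fintype V]

/-- The starting vertex and the terminal weight `g` are kept general so that the induction can split
off the first step. For the trace, `g` is a column of `M` and supplies the closing step. -/
theorem sum_prod_path_eq_mulVec [DecidableEq V] (M : Matrix V V ℝ) (m : ℕ) (g : V → ℝ) (a : V) :
    ∑ c : Fin m → V, (∏ i : Fin m, M ((Fin.cons a c : Fin (m + 1) → V) i.castSucc)
      ((Fin.cons a c : Fin (m + 1) → V) i.succ)) * g ((Fin.cons a c : Fin (m + 1) → V) (Fin.last m))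
      = ((M ^ m).mulVec g) a := by
  induction m generalizing a with
  | zero => simp
  | succ m ih =>
    rw [pow_succ', ← Matrix.mulVec_mulVec, Matrix.mulVec, dotProduct]
    simp only [← ih]
    rw [← (Fin.consEquiv fun _ => V).sum_comp, Fintype.sum_prod_type]
    refine Finset.sum_congr rfl fun b _ => ?_
    rw [Finset.mul_sum]
    refine Finset.sum_congr rfl fun c _ => ?_
    rw [Fin.prod_univ_succ, ← mul_assoc]
    rfl

theorem trace_pow_succ [DecidableEq V] (M : Matrix V V ℝ) (m : ℕ) :
    (M ^ (m + 1)).trace = ∑ c : Fin (m + 1) → V, ∏ i, M (c i) (c (i + 1)) := by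
  have h1 : ∀ c : Fin (m + 1) → V, ∏ i, M (c i) (c (i + 1)) =
      (∏ i : Fin m, M (c i.castSucc) (c i.succ)) * M (c (Fin.last m)) (c 0) := fun c => by
    rw [Fin.prod_univ_castSucc]
    simp only [Fin.coeSucc_eq_succ, Fin.last_add_one]
  simp only [h1]
  rw [← (Fin.consEquiv fun _ => V).sum_comp, Fintype.sum_prod_type, Matrix.trace]
  refine Finset.sum_congr rfl fun a _ => ?_
  rw [Matrix.diag_apply, pow_succ]
  exact (sum_prod_path_eq_mulVec M m (fun v => M v a) a).symm

variable [DecidableEq V]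

theorem Matrix.IsHermitian.trace_pow_eq_sum {A : Matrix V V ℝ} (hA : A.IsHermitian) (k : ℕ) :
    (A ^ k).trace = ∑ i, hA.eigenvalues i ^ k := by
  conv_lhs => rw [hA.spectral_theorem, ← map_pow, Unitary.conjStarAlgAut_apply,
    Matrix.trace_mul_comm, ← mul_assoc, Unitary.coe_star_mul_self, one_mul, Matrix.diagonal_pow,
    Matrix.trace_diagonal]
  simp

omit [DecidableEq V] in
theorem sum_sq_eq_trace (X : Matrix V V ℝ) : ∑ i, ∑ j, X i j ^ 2 = (star X * X).trace := by
  rw [Finset.sum_comm, Matrix.trace]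
  refine Finset.sum_congr rfl fun j _ => ?_
  simp [Matrix.mul_apply, Matrix.star_apply, sq]

theorem sum_sq_unitary_conj (X : Matrix V V ℝ) (U W : Matrix.unitaryGroup V ℝ) :
    ∑ i, ∑ j, (star (U : Matrix V V ℝ) * X * W) i j ^ 2 = ∑ i, ∑ j, X i j ^ 2 := by
  rw [sum_sq_eq_trace, sum_sq_eq_trace]
  simp only [star_mul, star_star]
  calc _ = (star (W : Matrix V V ℝ) * (star X * ((U : Matrix V V ℝ) * star (U : Matrix V V ℝ)) * X
        * W)).trace := by simp only [mul_assoc]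
    _ = _ := by
      rw [(Unitary.mem_iff.1 U.2).2, mul_one, Matrix.trace_mul_comm, mul_assoc,
        (Unitary.mem_iff.1 W.2).2, mul_one]

/-- Linear spectral statistics of Lipschitz functions are Lipschitz in the Frobenius norm. -/
theorem abs_sum_eigenvalues_sub_le {A B : Matrix V V ℝ} (hA : A.IsHermitian) (hB : B.IsHermitian)
    {f : ℝ → ℝ} {K : ℝ} (hK : 0 ≤ K) (hf : ∀ s t, |f s - f t| ≤ K * |s - t|) :
    |∑ i, f (hA.eigenvalues i) - ∑ i, f (hB.eigenvalues i)| ≤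
      K * (√(Fintype.card V) * √(∑ i, ∑ j, (A i j - B i j) ^ 2)) := by
  set U := hA.eigenvectorUnitary
  set W := hB.eigenvectorUnitary
  -- The squared entries of the orthogonal matrix `Q` form a doubly stochastic matrix. It couples
  -- the two families of eigenvalues, so no ordering or optimal matching of the eigenvalues is
  -- needed.
  set Q : Matrix V V ℝ := star (U : Matrix V V ℝ) * W with hQ
  have hrow : ∀ i, ∑ j, Q i j ^ 2 = 1 := fun i => by
    have h : Q * star Q = 1 := by
      rw [hQ, star_mul, star_star, mul_assoc, ← mul_assoc (W : Matrix V V ℝ),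
        (Unitary.mem_iff.1 W.2).2, one_mul, Unitary.coe_star_mul_self]
    have := congrFun (congrFun h i) i
    simpa [Matrix.mul_apply, Matrix.star_apply, sq] using this
  have hcol : ∀ j, ∑ i, Q i j ^ 2 = 1 := fun j => by
    have h : star Q * Q = 1 := by
      rw [hQ, star_mul, star_star, mul_assoc, ← mul_assoc (U : Matrix V V ℝ),
        (Unitary.mem_iff.1 U.2).2, one_mul, Unitary.coe_star_mul_self]
    have := congrFun (congrFun h j) j
    simpa [Matrix.mul_apply, Matrix.star_apply, sq] using this
  have hAU : star (U : Matrix V V ℝ) * A = Matrix.diagonal hA.eigenvalues * star (U : Matrix V V ℝ)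
      := by
    conv_lhs => rw [hA.spectral_theorem, Unitary.conjStarAlgAut_apply, ← mul_assoc, ← mul_assoc,
      Unitary.coe_star_mul_self, one_mul]
    rfl
  have hBW : B * (W : Matrix V V ℝ) = W * Matrix.diagonal hB.eigenvalues := by
    conv_lhs => rw [hB.spectral_theorem, Unitary.conjStarAlgAut_apply, mul_assoc,
      Unitary.coe_star_mul_self, mul_one]
    rfl
  -- With the eigenbasis of `A` on the left and that of `B` on the right, the entries of `A - B`
  -- become `Q i j` times the difference of the eigenvalues, and the Frobenius norm is unchanged.
  have hfrob : ∑ i, ∑ j, (A i j - B i j) ^ 2 =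
      ∑ i, ∑ j, (Q i j * (hA.eigenvalues i - hB.eigenvalues j)) ^ 2 := by
    have h1 := sum_sq_unitary_conj (A - B) U W
    have h2 : star (U : Matrix V V ℝ) * (A - B) * W =
        Matrix.diagonal hA.eigenvalues * Q - Q * Matrix.diagonal hB.eigenvalues := by
      rw [mul_sub, sub_mul, hAU, mul_assoc _ B, hBW, hQ, mul_assoc, mul_assoc]
    rw [h2] at h1
    simp only [Matrix.sub_apply, Matrix.diagonal_mul, Matrix.mul_diagonal] at h1
    rw [← h1]
    refine Finset.sum_congr rfl fun i _ => Finset.sum_congr rfl fun j _ => ?_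
    ring
  have hsumA : ∑ i, f (hA.eigenvalues i) = ∑ i, ∑ j, Q i j ^ 2 * f (hA.eigenvalues i) :=
    Finset.sum_congr rfl fun i _ => by rw [← Finset.sum_mul, hrow, one_mul]
  have hsumB : ∑ j, f (hB.eigenvalues j) = ∑ i, ∑ j, Q i j ^ 2 * f (hB.eigenvalues j) := by
    rw [Finset.sum_comm]
    exact Finset.sum_congr rfl fun i _ => by rw [← Finset.sum_mul, hcol, one_mul]
  rw [hsumA, hsumB, ← Finset.sum_sub_distrib]
  simp only [← Finset.sum_sub_distrib, ← mul_sub]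
  simp only [← Finset.sum_product'] at hfrob ⊢
  calc |∑ p ∈ Finset.univ ×ˢ Finset.univ,
        Q p.1 p.2 ^ 2 * (f (hA.eigenvalues p.1) - f (hB.eigenvalues p.2))|
      ≤ ∑ p ∈ Finset.univ ×ˢ Finset.univ,
        K * (|Q p.1 p.2| * |Q p.1 p.2 * (hA.eigenvalues p.1 - hB.eigenvalues p.2)|) := by
        refine (Finset.abs_sum_le_sum_abs _ _).trans (Finset.sum_le_sum fun p _ => ?_)
        rw [abs_mul, abs_pow, sq, abs_mul]
        calc _ ≤ |Q p.1 p.2| * |Q p.1 p.2| *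
              (K * |hA.eigenvalues p.1 - hB.eigenvalues p.2|) := by gcongr; exact hf _ _
          _ = _ := by ring
    _ ≤ K * (√(∑ p ∈ Finset.univ ×ˢ Finset.univ, |Q p.1 p.2| ^ 2) *
          √(∑ p ∈ Finset.univ ×ˢ Finset.univ,
            |Q p.1 p.2 * (hA.eigenvalues p.1 - hB.eigenvalues p.2)| ^ 2)) := by
        rw [← Finset.mul_sum]
        gcongr
        exact Real.sum_mul_le_sqrt_mul_sqrt _ _ _
    _ = _ := by
        rw [hfrob]
        congr 3
        · simp only [sq_abs]
          rw [Finset.sum_product' (f := fun i j => Q i j ^ 2)]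
          simp [hrow]
        · simp only [sq_abs]

end Trace

/-! ### Integrals against empirical spectral measures -/

section EmpiricalMeasure

variable {n : ℕ} {A B : Matrix (Fin n) (Fin n) ℝ}

theorem isProbabilityMeasure_empiricalSpectralMeasure (hA : A.IsHermitian) (hn : 0 < n) :
    IsProbabilityMeasure (empiricalSpectralMeasure A hA) := by
  constructor
  simp only [empiricalSpectralMeasure, Measure.smul_apply, Measure.finsetSum_apply, measure_univ,
    smul_eq_mul, Finset.sum_const, Finset.card_univ, Fintype.card_fin, nsmul_eq_mul, mul_one]
  exact ENNReal.inv_mul_cancel (by exact_mod_cast hn.ne') (ENNReal.natCast_ne_top n)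

theorem integral_empiricalSpectralMeasure (hA : A.IsHermitian) (f : ℝ → ℝ) :
    ∫ s, f s ∂empiricalSpectralMeasure A hA = (n : ℝ)⁻¹ * ∑ i, f (hA.eigenvalues i) := by
  rw [empiricalSpectralMeasure, integral_smul_measure, integral_finsetSum_measure]
  · simp
  · exact fun i _ => integrable_dirac (by simp)

theorem integrable_empiricalSpectralMeasure (hA : A.IsHermitian) (hn : 0 < n) (f : ℝ → ℝ) :
    Integrable f (empiricalSpectralMeasure A hA) := by
  refine Integrable.smul_measure ?_ (by simpa using hn.ne')
  exact integrable_finsetSum_measure.2 fun i _ => integrable_dirac (by simp)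

theorem abs_integral_empiricalSpectralMeasure_sub_le (hA : A.IsHermitian) (hB : B.IsHermitian)
    {f : ℝ → ℝ} {K : ℝ} (hK : 0 ≤ K) (hf : ∀ s t, |f s - f t| ≤ K * |s - t|) :
    |∫ s, f s ∂empiricalSpectralMeasure A hA - ∫ s, f s ∂empiricalSpectralMeasure B hB| ≤
      K * √((n : ℝ)⁻¹ * ∑ i, ∑ j, (A i j - B i j) ^ 2) := by
  rw [integral_empiricalSpectralMeasure, integral_empiricalSpectralMeasure, ← mul_sub, abs_mul,
    abs_of_nonneg (a := (n : ℝ)⁻¹) (by positivity)]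
  have h1 := abs_sum_eigenvalues_sub_le hA hB hK hf
  rw [Fintype.card_fin] at h1
  rw [Real.sqrt_mul (by positivity), Real.sqrt_inv]
  rcases Nat.eq_zero_or_pos n with rfl | hn
  · simp
  have hn' : (0 : ℝ) < n := by exact_mod_cast hn
  have hs : 0 < √(n : ℝ) := Real.sqrt_pos.2 hn'
  calc _ ≤ (n : ℝ)⁻¹ * (K * (√n * √(∑ i, ∑ j, (A i j - B i j) ^ 2))) := by gcongr
    _ = K * ((√(n : ℝ))⁻¹ * √(∑ i, ∑ j, (A i j - B i j) ^ 2)) := by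
        have : (n : ℝ) = √n * √n := (Real.mul_self_sqrt hn'.le).symm
        rw [show (n : ℝ)⁻¹ = (√(n : ℝ) * √n)⁻¹ by rw [← this]]
        field_simp

theorem SymmLink.integral_pow_empiricalSpectralMeasure {ι : Type u} (L : SymmLink ι) (x : ι → ℝ)
    (n m : ℕ) : ∫ s, s ^ (m + 1) ∂empiricalSpectralMeasure (L.scaledMatrix x n)
      (L.scaledMatrix_isHermitian x n) = walkSum (L.toFun n) m x / (n * √n ^ (m + 1)) := by
  rw [integral_empiricalSpectralMeasure _ (fun s => s ^ (m + 1)),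
    ← Matrix.IsHermitian.trace_pow_eq_sum, trace_pow_succ, walkSum]
  simp only [scaledMatrix, Matrix.of_apply, Finset.prod_mul_distrib, Finset.prod_const,
    Finset.card_univ, Fintype.card_fin, ← Finset.mul_sum]
  simp only [cyclicStep, div_eq_mul_inv, mul_inv, inv_pow]
  ring

end EmpiricalMeasure

/-! ### The method of moments -/

/-- Differentiating a Taylor remainder gives `I` times the preceding remainder; this is the
induction step of the remainder estimate. -/
theorem hasDerivAt_exp_sub_taylor (N : ℕ) (y : ℝ) :
    HasDerivAt (fun y : ℝ => Complex.exp (Complex.I * y) -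
        ∑ j ∈ Finset.range (N + 1), (Complex.I * y) ^ j / (j.factorial : ℂ))
      (Complex.I * (Complex.exp (Complex.I * y) -
        ∑ j ∈ Finset.range N, (Complex.I * y) ^ j / (j.factorial : ℂ))) y := by
  have hlin : HasDerivAt (fun y : ℝ => Complex.I * (y : ℂ)) Complex.I y := by
    simpa using (Complex.ofRealCLM.hasDerivAt (x := y)).const_mul Complex.I
  have h1 := hlin.cexp
  have h2 : HasDerivAt (fun y : ℝ => ∑ j ∈ Finset.range (N + 1),
      (Complex.I * (y : ℂ)) ^ j / (j.factorial : ℂ))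
      (∑ j ∈ Finset.range (N + 1),
        (j : ℂ) * (Complex.I * (y : ℂ)) ^ (j - 1) * Complex.I / (j.factorial : ℂ)) y :=
    HasDerivAt.fun_sum fun j _ => (hlin.pow j).div_const _
  refine (h1.sub h2).congr_deriv (Eq.symm ?_)
  rw [Finset.sum_range_succ', mul_sub, Finset.mul_sum]
  simp only [Nat.cast_zero, zero_mul, zero_div, add_zero, Nat.add_sub_cancel]
  congr 1
  · ring
  · refine Finset.sum_congr rfl fun j _ => ?_
    rw [Nat.factorial_succ]
    have : (j.factorial : ℂ) ≠ 0 := by exact_mod_cast j.factorial_ne_zero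
    have : ((j + 1 : ℕ) : ℂ) ≠ 0 := by exact_mod_cast j.succ_ne_zero
    push_cast at *
    field_simp

theorem norm_exp_sub_taylor_le_of_nonneg (N : ℕ) {y : ℝ} (hy : 0 ≤ y) :
    ‖Complex.exp (Complex.I * y) -
      ∑ j ∈ Finset.range N, (Complex.I * y) ^ j / (j.factorial : ℂ)‖ ≤ y ^ N / N.factorial := by
  induction N generalizing y with
  | zero => simp [mul_comm Complex.I, Complex.norm_exp_ofReal_mul_I]
  | succ N ih =>
    have hB : ∀ t : ℝ, HasDerivAt (fun t : ℝ => t ^ (N + 1) / ((N + 1).factorial : ℝ))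
        (t ^ N / (N.factorial : ℝ)) t := fun t => by
      refine ((hasDerivAt_pow (N + 1) t).div_const ((N + 1).factorial : ℝ)).congr_deriv ?_
      rw [Nat.factorial_succ]
      have : (N.factorial : ℝ) ≠ 0 := by exact_mod_cast N.factorial_ne_zero
      push_cast
      field_simp
    refine image_norm_le_of_norm_deriv_right_le_deriv_boundary (a := 0) (b := y)
      (f' := fun y : ℝ => Complex.I * (Complex.exp (Complex.I * y) -
        ∑ j ∈ Finset.range N, (Complex.I * y) ^ j / (j.factorial : ℂ)))
      (B' := fun t => t ^ N / N.factorial)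
      (fun t _ => (hasDerivAt_exp_sub_taylor N t).continuousAt.continuousWithinAt)
      (fun t _ => (hasDerivAt_exp_sub_taylor N t).hasDerivWithinAt) ?_
      hB (fun t ht => ?_) (Set.right_mem_Icc.2 hy)
    · simp [Finset.sum_range_succ']
    · rw [norm_mul, Complex.norm_I, one_mul]
      exact ih ht.1

theorem norm_exp_sub_taylor_le (N : ℕ) (y : ℝ) :
    ‖Complex.exp (Complex.I * y) -
      ∑ j ∈ Finset.range N, (Complex.I * y) ^ j / (j.factorial : ℂ)‖ ≤ |y| ^ N / N.factorial := by
  rcases le_total 0 y with hy | hy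
  · rw [abs_of_nonneg hy]
    exact norm_exp_sub_taylor_le_of_nonneg N hy
  · have h := norm_exp_sub_taylor_le_of_nonneg N (neg_nonneg.2 hy)
    rw [abs_of_nonpos hy, ← RCLike.norm_conj]
    refine le_of_eq_of_le ?_ h
    congr 1
    simp [← Complex.exp_conj]

/-- The difference between the characteristic function and its Taylor polynomial. -/
theorem norm_charFun_sub_taylor_le (ν : Measure ℝ) [IsProbabilityMeasure ν]
    (hν : ∀ j : ℕ, Integrable (fun s : ℝ => s ^ j) ν) (t : ℝ) (k : ℕ) :
    ‖charFun ν t - ∑ j ∈ Finset.range (2 * k),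
      (Complex.I * t) ^ j / (j.factorial : ℂ) * ((∫ s, s ^ j ∂ν : ℝ) : ℂ)‖ ≤
      |t| ^ (2 * k) / (2 * k).factorial * ∫ s, s ^ (2 * k) ∂ν := by
  have hint : ∀ j : ℕ, Integrable (fun s : ℝ => (Complex.I * (t * s : ℝ)) ^ j /
      (j.factorial : ℂ)) ν := fun j => by
    have := ((hν j).ofReal (𝕜 := ℂ)).const_mul ((Complex.I * t) ^ j / (j.factorial : ℂ))
    refine this.congr (ae_of_all _ fun s => ?_)
    simp only [Complex.coe_algebraMap, Complex.ofReal_mul, Complex.ofReal_pow]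
    ring
  have hexp : Integrable (fun s : ℝ => Complex.exp (Complex.I * (t * s : ℝ))) ν := by
    refine Integrable.of_bound (C := 1) (by fun_prop) (ae_of_all _ fun s => ?_)
    rw [mul_comm, Complex.norm_exp_ofReal_mul_I]
  have h1 : charFun ν t - ∑ j ∈ Finset.range (2 * k),
      (Complex.I * t) ^ j / (j.factorial : ℂ) * ((∫ s, s ^ j ∂ν : ℝ) : ℂ) =
      ∫ s, (Complex.exp (Complex.I * (t * s : ℝ)) - ∑ j ∈ Finset.range (2 * k),
        (Complex.I * (t * s : ℝ)) ^ j / (j.factorial : ℂ)) ∂ν := by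
    rw [integral_sub hexp (integrable_finsetSum _ fun j _ => hint j),
      integral_finsetSum _ fun j _ => hint j, charFun_apply_real]
    congr 1
    · congr with s
      congr 1; push_cast; ring
    · refine Finset.sum_congr rfl fun j _ => ?_
      rw [← integral_complex_ofReal, ← integral_const_mul]
      congr with s
      push_cast; ring
  rw [h1, ← integral_const_mul]
  refine norm_integral_le_of_norm_le ((hν (2 * k)).const_mul _) (ae_of_all _ fun s => ?_)
  refine (norm_exp_sub_taylor_le _ _).trans (le_of_eq ?_)
  rw [abs_mul, mul_pow, (even_two_mul k).pow_abs s]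
  ring

/-- Two families of laws whose moments have the same limits, which do not grow too fast, have
asymptotically equal characteristic functions. -/
theorem tendsto_charFun_sub_of_moments {a b : Type*} {F : Filter a} {G : Filter b}
    {ν : a → Measure ℝ} {ν' : b → Measure ℝ} [∀ i, IsProbabilityMeasure (ν i)]
    [∀ i, IsProbabilityMeasure (ν' i)]
    (hν : ∀ i (j : ℕ), Integrable (fun s : ℝ => s ^ j) (ν i))
    (hν' : ∀ i (j : ℕ), Integrable (fun s : ℝ => s ^ j) (ν' i)) {β : ℕ → ℝ}
    (hβ : ∀ j, Tendsto (fun i => ∫ s, s ^ j ∂ν i) F (𝓝 (β j)))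
    (hβ' : ∀ j, Tendsto (fun i => ∫ s, s ^ j ∂ν' i) G (𝓝 (β j))) (t : ℝ)
    (hgrow : Tendsto (fun k : ℕ => |t| ^ (2 * k) / (2 * k).factorial * β (2 * k)) atTop (𝓝 0)) :
    Tendsto (fun p : a × b => charFun (ν p.1) t - charFun (ν' p.2) t) (F ×ˢ G) (𝓝 0) := by
  have hF : ∀ j, Tendsto (fun p : a × b => ∫ s, s ^ j ∂ν p.1) (F ×ˢ G) (𝓝 (β j)) :=
    fun j => (hβ j).comp tendsto_fst
  have hG : ∀ j, Tendsto (fun p : a × b => ∫ s, s ^ j ∂ν' p.2) (F ×ˢ G) (𝓝 (β j)) :=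
    fun j => (hβ' j).comp tendsto_snd
  rw [Metric.tendsto_nhds]
  intro ε hε
  -- The degree is fixed first, so that the limits of the two Taylor remainder bounds together are
  -- below `ε`. For this degree the polynomials differ by finitely many moment differences, all
  -- tending to `0`.
  obtain ⟨k, hk⟩ := ((hgrow.const_mul 2).eventually_lt_const (u := ε) (by simpa using hε)).exists
  let R : a × b → ℝ := fun p =>
    ‖∑ j ∈ Finset.range (2 * k), (Complex.I * t) ^ j / (j.factorial : ℂ) *
      (((∫ s, s ^ j ∂ν p.1 : ℝ) : ℂ) - ((∫ s, s ^ j ∂ν' p.2 : ℝ) : ℂ))‖ +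
    (|t| ^ (2 * k) / (2 * k).factorial * ∫ s, s ^ (2 * k) ∂ν p.1 +
      |t| ^ (2 * k) / (2 * k).factorial * ∫ s, s ^ (2 * k) ∂ν' p.2)
  have hR : Tendsto R (F ×ˢ G) (𝓝 (2 * (|t| ^ (2 * k) / (2 * k).factorial * β (2 * k)))) := by
    have h1 : Tendsto (fun p : a × b => ∑ j ∈ Finset.range (2 * k),
        (Complex.I * t) ^ j / (j.factorial : ℂ) *
        (((∫ s, s ^ j ∂ν p.1 : ℝ) : ℂ) - ((∫ s, s ^ j ∂ν' p.2 : ℝ) : ℂ))) (F ×ˢ G) (𝓝 0) := by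
      rw [show (0 : ℂ) = ∑ j ∈ Finset.range (2 * k), (Complex.I * t) ^ j / (j.factorial : ℂ) *
        ((β j : ℂ) - (β j : ℂ)) by simp]
      exact tendsto_finsetSum _ fun j _ => (((Complex.continuous_ofReal.tendsto _).comp
        (hF j)).sub ((Complex.continuous_ofReal.tendsto _).comp (hG j))).const_mul _
    have := h1.norm.add (((hF (2 * k)).const_mul (|t| ^ (2 * k) / (2 * k).factorial)).add
      ((hG (2 * k)).const_mul (|t| ^ (2 * k) / (2 * k).factorial)))
    rw [norm_zero, zero_add, ← two_mul] at this
    exact this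
  filter_upwards [hR.eventually_lt_const hk] with p hp
  rw [dist_zero_right]
  refine lt_of_le_of_lt ?_ hp
  have h1 := norm_charFun_sub_taylor_le (ν p.1) (hν p.1) t k
  have h2 := norm_charFun_sub_taylor_le (ν' p.2) (hν' p.2) t k
  simp only [R, mul_sub, Finset.sum_sub_distrib]
  calc _ = ‖(∑ j ∈ Finset.range (2 * k), (Complex.I * t) ^ j / (j.factorial : ℂ) *
        ((∫ s, s ^ j ∂ν p.1 : ℝ) : ℂ) - ∑ j ∈ Finset.range (2 * k),
        (Complex.I * t) ^ j / (j.factorial : ℂ) * ((∫ s, s ^ j ∂ν' p.2 : ℝ) : ℂ)) +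
        ((charFun (ν p.1) t - ∑ j ∈ Finset.range (2 * k),
          (Complex.I * t) ^ j / (j.factorial : ℂ) * ((∫ s, s ^ j ∂ν p.1 : ℝ) : ℂ)) -
        (charFun (ν' p.2) t - ∑ j ∈ Finset.range (2 * k),
          (Complex.I * t) ^ j / (j.factorial : ℂ) * ((∫ s, s ^ j ∂ν' p.2 : ℝ) : ℂ)))‖ := by
        congr 1; ring
    _ ≤ _ := (norm_add_le _ _).trans (add_le_add le_rfl ((norm_sub_le _ _).trans
        (add_le_add h1 h2)))

/-- Chebyshev's inequality bounds the tails by `C / r ^ 2` uniformly. -/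
theorem isTightMeasureSet_of_second_moment (S : Set (Measure ℝ)) (C : ℝ)
    (hS : ∀ ν ∈ S, IsProbabilityMeasure ν ∧ Integrable (fun s : ℝ => s ^ 2) ν ∧ ∫ s, s ^ 2 ∂ν ≤ C) :
    IsTightMeasureSet S := by
  apply isTightMeasureSet_of_tendsto_measure_norm_gt
  have hlim : Tendsto (fun r : ℝ => ENNReal.ofReal (C / r ^ 2)) atTop (𝓝 0) := by
    rw [← ENNReal.ofReal_zero]
    refine ENNReal.tendsto_ofReal ?_
    exact tendsto_const_nhds.div_atTop (tendsto_pow_atTop two_ne_zero)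
  refine tendsto_of_tendsto_of_tendsto_of_le_of_le' tendsto_const_nhds hlim
    (Eventually.of_forall fun _ => zero_le) ?_
  filter_upwards [eventually_gt_atTop 0] with r hr
  refine iSup₂_le fun ν hν => ?_
  obtain ⟨h1, h2, h3⟩ := hS ν hν
  have hmk := mul_meas_ge_le_integral_of_nonneg (μ := ν) (f := fun s : ℝ => s ^ 2)
    (ae_of_all _ fun s => sq_nonneg s) h2 (r ^ 2)
  have hsub : {s : ℝ | r < ‖s‖} ⊆ {s : ℝ | r ^ 2 ≤ s ^ 2} := fun s hs => by
    simp only [Set.mem_ofPred_eq, Real.norm_eq_abs] at hs ⊢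
    rw [← sq_abs s]
    gcongr
  refine (measure_mono hsub).trans ?_
  rw [← ENNReal.ofReal_toReal (measure_ne_top ν _)]
  refine ENNReal.ofReal_le_ofReal ?_
  rw [le_div_iff₀ (by positivity), mul_comm]
  exact hmk.trans h3

/-- The limit law of the method of moments. -/
theorem exists_limit_of_moments {ν : ℕ → ProbabilityMeasure ℝ}
    (hν : ∀ i (j : ℕ), Integrable (fun s : ℝ => s ^ j) (ν i : Measure ℝ)) {β : ℕ → ℝ}
    (hβ : ∀ j, Tendsto (fun i => ∫ s, s ^ j ∂(ν i : Measure ℝ)) atTop (𝓝 (β j)))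
    (hgrow : ∀ t : ℝ, Tendsto (fun k : ℕ => |t| ^ (2 * k) / (2 * k).factorial * β (2 * k))
      atTop (𝓝 0)) :
    ∃ μ : ProbabilityMeasure ℝ, ∀ ν' : ℕ → ProbabilityMeasure ℝ,
      (∀ i (j : ℕ), Integrable (fun s : ℝ => s ^ j) (ν' i : Measure ℝ)) →
      (∀ j, Tendsto (fun i => ∫ s, s ^ j ∂(ν' i : Measure ℝ)) atTop (𝓝 (β j))) →
      Tendsto ν' atTop (𝓝 μ) := by
  obtain ⟨C, hC⟩ := (hβ 2).bddAbove_range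
  have htight : IsTightMeasureSet {((μ : ProbabilityMeasure ℝ) : Measure ℝ) | μ ∈ Set.range ν} := by
    refine isTightMeasureSet_of_second_moment _ C ?_
    rintro _ ⟨_, ⟨i, rfl⟩, rfl⟩
    exact ⟨inferInstance, hν i 2, hC ⟨i, rfl⟩⟩
  have hcomp := isCompact_closure_of_isTightMeasureSet htight
  -- An ultrafilter finer than `atTop` replaces the choice of a convergent subsequence; compactness
  -- of the closure comes from tightness.
  let U : Ultrafilter ℕ := Ultrafilter.of atTop
  have hU : (U : Filter ℕ) ≤ atTop := Ultrafilter.of_le _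
  obtain ⟨μ, -, hμ⟩ := hcomp.ultrafilter_le_nhds (U.map ν) (by
    rw [le_principal_iff]
    exact Filter.mem_map.2 (Filter.univ_mem' fun i => subset_closure ⟨i, rfl⟩))
  have hμ' : Tendsto ν U (𝓝 μ) := hμ
  refine ⟨μ, fun ν' hν' hβ' => ProbabilityMeasure.tendsto_of_tendsto_charFun fun t => ?_⟩
  have hchar : Tendsto (fun i => charFun (ν i : Measure ℝ) t) U
      (𝓝 (charFun (μ : Measure ℝ) t)) := by
    rw [ProbabilityMeasure.tendsto_iff_forall_integral_rclike_tendsto ℂ] at hμ'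
    simp_rw [charFun_eq_integral_innerProbChar]
    exact hμ' _
  -- The laws `ν` along `U` are compared with the arbitrary `ν'` along `atTop`. Adding the limit of
  -- the former leaves a function of the second index only, which is then projected out of the
  -- product filter.
  have h1 := tendsto_charFun_sub_of_moments (F := (U : Filter ℕ)) (G := atTop)
    (ν := fun i => (ν i : Measure ℝ)) (ν' := fun i => (ν' i : Measure ℝ)) hν hν'
    (fun j => (hβ j).mono_left hU) hβ' t (hgrow t)
  have h2 := (hchar.comp tendsto_fst).sub h1
  simp only [sub_zero] at h2
  have h3 : Tendsto (fun p : ℕ × ℕ => charFun (ν' p.2 : Measure ℝ) t) ((U : Filter ℕ) ×ˢ atTop)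
      (𝓝 (charFun (μ : Measure ℝ) t)) := h2.congr fun p => by simp
  have h4 : Tendsto (fun i => charFun (ν' i : Measure ℝ) t)
      (Filter.map Prod.snd ((U : Filter ℕ) ×ˢ atTop)) (𝓝 (charFun (μ : Measure ℝ) t)) :=
    Filter.tendsto_map'_iff.2 h3
  rwa [Filter.map_snd_prod] at h4

/-! ### The limit law and bounded inputs -/

/-- By `k! * k ^ k ≤ (2k)!` the sequence is dominated by `(2 t² D²) ^ k / k!`. -/
theorem tendsto_growth_zero {β : ℕ → ℝ} {D : ℕ} (h0 : ∀ h, 0 ≤ β h)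
    (hβ : ∀ k, β (2 * k) ≤ ((2 * k) ^ k : ℕ) * (D : ℝ) ^ (2 * k)) (t : ℝ) :
    Tendsto (fun k : ℕ => |t| ^ (2 * k) / (2 * k).factorial * β (2 * k)) atTop (𝓝 0) := by
  refine squeeze_zero (fun k => mul_nonneg (by positivity) (h0 _)) (fun k => ?_)
    (FloorSemiring.tendsto_pow_div_factorial_atTop (2 * (t ^ 2 * D ^ 2)))
  have hfac : k.factorial * k ^ k ≤ (2 * k).factorial :=
    calc k.factorial * k ^ k ≤ k.factorial * (k + 1) ^ k := by gcongr; omega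
      _ ≤ (k + k).factorial := Nat.factorial_mul_pow_le_factorial
      _ = _ := by rw [two_mul]
  have hfac' : (k.factorial : ℝ) * (k : ℝ) ^ k ≤ (2 * k).factorial := by exact_mod_cast hfac
  have hk : (0 : ℝ) < k.factorial := by exact_mod_cast k.factorial_pos
  have h2k : (0 : ℝ) < (2 * k).factorial := by exact_mod_cast (2 * k).factorial_pos
  calc |t| ^ (2 * k) / (2 * k).factorial * β (2 * k)
      ≤ |t| ^ (2 * k) / (2 * k).factorial * (((2 * k) ^ k : ℕ) * (D : ℝ) ^ (2 * k)) := by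
        gcongr; exact hβ k
    _ = (2 * (t ^ 2 * D ^ 2)) ^ k * ((k : ℝ) ^ k / (2 * k).factorial) := by
        rw [pow_mul |t|, sq_abs, pow_mul (D : ℝ)]
        push_cast
        simp only [mul_pow]
        ring
    _ ≤ (2 * (t ^ 2 * D ^ 2)) ^ k * (1 / k.factorial) := by
        refine mul_le_mul_of_nonneg_left ?_ (by positivity)
        rw [div_le_div_iff₀ h2k hk]
        linarith
    _ = _ := by ring

theorem InputA1.inputA3 {ι : Type u} {Ω : Type w} [MeasurableSpace Ω] {P : Measure Ω}
    [IsProbabilityMeasure P] {x : ι → Ω → ℝ} (hx : InputA1 x P) : InputA3 x P := by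
  obtain ⟨h1, C, hC⟩ := hx
  refine ⟨h1, fun k => ⟨|C| ^ k, fun t => ?_⟩⟩
  have hle : ∀ᵐ ω ∂P, ‖|x t ω| ^ k‖ ≤ |C| ^ k := by
    filter_upwards [hC t] with ω hω
    rw [norm_pow, Real.norm_eq_abs, abs_abs]
    exact pow_le_pow_left₀ (abs_nonneg _) (hω.trans (le_abs_self C)) k
  have hint : Integrable (fun ω => |x t ω| ^ k) P :=
    Integrable.of_bound ((h1.measurable t).abs.pow_const k).aestronglyMeasurable _ hle
  refine ⟨hint, ?_⟩
  refine (le_abs_self _).trans ?_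
  have := norm_integral_le_of_norm_le (integrable_const (|C| ^ k)) hle
  simpa using this

/-- Independent random signs. -/
theorem exists_inputA1 (ι : Type u) : ∃ (Ω : Type u) (_ : MeasurableSpace Ω) (P : Measure Ω)
    (_ : IsProbabilityMeasure P) (x : ι → Ω → ℝ), InputA1 x P := by
  let ν : Measure ℝ := (2 : ℝ≥0∞)⁻¹ • (Measure.dirac 1 + Measure.dirac (-1))
  have hν : IsProbabilityMeasure ν := ⟨by
    simp only [ν, Measure.smul_apply, Measure.add_apply, measure_univ, smul_eq_mul]
    rw [one_add_one_eq_two]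
    exact ENNReal.inv_mul_cancel two_ne_zero ENNReal.ofNat_ne_top⟩
  have hint : ∀ f : ℝ → ℝ, ∫ s, f s ∂ν = (f 1 + f (-1)) / 2 := fun f => by
    simp only [ν]
    rw [integral_smul_measure, integral_add_measure (integrable_dirac (by simp))
      (integrable_dirac (by simp))]
    simp
    ring
  have hmap : ∀ t : ι, (Measure.infinitePi fun _ : ι => ν).map (fun ω => ω t) = ν := fun t =>
    Measure.infinitePi_map_eval (fun _ : ι => ν) t
  have hcomp : ∀ (t : ι) (f : ℝ → ℝ), Measurable f →
      ∫ ω, f (ω t) ∂(Measure.infinitePi fun _ : ι => ν) = (f 1 + f (-1)) / 2 := fun t f hf => by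
    rw [← hint f, ← hmap t, integral_map (measurable_pi_apply t).aemeasurable
      hf.aestronglyMeasurable, hmap]
  have hbound : ∀ t : ι, ∀ᵐ ω ∂(Measure.infinitePi fun _ : ι => ν), |ω t| ≤ 1 := fun t => by
    have h1 : ∀ᵐ s ∂ν, |s| ≤ 1 := by
      refine Measure.ae_smul_measure ?_ _
      rw [ae_add_measure_iff]
      constructor <;> rw [ae_dirac_iff (measurableSet_le (f := fun s : ℝ => |s|) (by fun_prop)
        measurable_const)] <;>
        simp
    rw [← hmap t] at h1
    exact ae_of_ae_map (measurable_pi_apply t).aemeasurable h1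
  refine ⟨ι → ℝ, inferInstance, Measure.infinitePi fun _ => ν, inferInstance, fun t ω => ω t,
    ⟨fun t => measurable_pi_apply t, iIndepFun_infinitePi (X := fun _ s => s)
      fun _ => measurable_id, fun t => ?_, fun t => ?_, fun t => ?_⟩, 1, hbound⟩
  · exact MemLp.of_bound (measurable_pi_apply t).aestronglyMeasurable 1 (hbound t)
  · have := hcomp t (fun s => s) measurable_id
    simpa using this
  · have hmean := hcomp t (fun s => s) measurable_id
    rw [variance_of_integral_eq_zero (measurable_pi_apply t).aemeasurable (by simpa using hmean)]
    have := hcomp t (fun s => s ^ 2) (by fun_prop)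
    simpa using this

theorem measure_singleton_eq_zero_of_continuousAt_cdf {μ : Measure ℝ} [IsProbabilityMeasure μ]
    {s : ℝ} (hs : ContinuousAt (fun r => μ.real (Set.Iic r)) s) : μ {s} = 0 := by
  have h1 : ∀ r < s, μ.real (Set.Iic r) + μ.real {s} ≤ μ.real (Set.Iic s) := fun r hr => by
    rw [← measureReal_union (by simpa using hr) (measurableSet_singleton s)]
    refine measureReal_mono ?_
    rintro y (hy | rfl)
    · exact le_trans hy hr.le
    · exact le_refl y
  have h2 : Tendsto (fun r => μ.real (Set.Iic r) + μ.real {s}) (𝓝[<] s)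
      (𝓝 (μ.real (Set.Iic s) + μ.real {s})) :=
    (hs.tendsto.mono_left nhdsWithin_le_nhds).add_const _
  have h3 := le_of_tendsto h2 (eventually_nhdsWithin_of_forall h1)
  have h4 : μ.real {s} = 0 := le_antisymm (by linarith) measureReal_nonneg
  rwa [measureReal_eq_zero_iff] at h4

namespace SymmLink

variable {ι : Type u}

/-- The empirical spectral measure of the matrix of size `n + 1`. -/
noncomputable def spectralLaw (L : SymmLink ι) (y : ι → ℝ) (n : ℕ) : ProbabilityMeasure ℝ :=
  ⟨empiricalSpectralMeasure (L.scaledMatrix y (n + 1)) (L.scaledMatrix_isHermitian y (n + 1)),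
    isProbabilityMeasure_empiricalSpectralMeasure _ n.succ_pos⟩

theorem tendsto_esd_of_tendsto_spectralLaw {L : SymmLink ι} {y : ι → ℝ}
    {μ : ProbabilityMeasure ℝ} (h : Tendsto (L.spectralLaw y) atTop (𝓝 μ)) {s : ℝ}
    (hs : ContinuousAt (fun r => (μ : Measure ℝ).real (Set.Iic r)) s) :
    Tendsto (fun n => L.esd y n s) atTop (𝓝 ((μ : Measure ℝ).real (Set.Iic s))) := by
  rw [← tendsto_add_atTop_iff_nat 1]
  have h1 := ProbabilityMeasure.tendsto_measure_of_null_frontier_of_tendsto' h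
    (E := Set.Iic s) (by rw [frontier_Iic]; exact measure_singleton_eq_zero_of_continuousAt_cdf hs)
  exact (ENNReal.tendsto_toReal (measure_ne_top _ _)).comp h1

theorem tendsto_spectralLaw_of_walkSum {L : SymmLink ι} {β : ℕ → ℝ} (hβ : L.HasPairLimits β)
    {y : ι → ℝ} (hy : ∀ m, Tendsto (fun n : ℕ => walkSum (L.toFun n) m y / (n * √n ^ (m + 1)))
      atTop (𝓝 (β (m + 1)))) (j : ℕ) :
    Tendsto (fun n => ∫ s, s ^ j ∂(L.spectralLaw y n : Measure ℝ)) atTop (𝓝 (β j)) := by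
  cases j with
  | zero =>
    -- The moment of order `0` is not a walk sum; a circuit of length `0` is a single vertex, so the
    -- normalized count is `1`.
    have h0 : β 0 = 1 := by
      refine tendsto_nhds_unique (hβ 0) (tendsto_const_nhds.congr' ?_)
      filter_upwards [eventually_gt_atTop 0] with n hn
      have : L.pairCircuits 0 n = Set.univ :=
        Set.eq_univ_of_forall fun π => ⟨rfl, fun i => i.elim0⟩
      have hn' : (n : ℝ) ≠ 0 := by exact_mod_cast hn.ne'
      simp [this, Set.ncard_univ, hn']
    simp [h0]
  | succ m =>
    simp only [spectralLaw, ProbabilityMeasure.coe_mk, integral_pow_empiricalSpectralMeasure]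
    exact (hy m).comp (tendsto_add_atTop_nat 1)

/-- The law `μ` is the limit of all spectral laws whose moments converge to `β`. -/
def IsMomentLimit (β : ℕ → ℝ) (μ : ProbabilityMeasure ℝ) : Prop :=
  ∀ ν : ℕ → ProbabilityMeasure ℝ,
    (∀ i (j : ℕ), Integrable (fun s : ℝ => s ^ j) (ν i : Measure ℝ)) →
    (∀ j, Tendsto (fun i => ∫ s, s ^ j ∂(ν i : Measure ℝ)) atTop (𝓝 (β j))) →
    Tendsto ν atTop (𝓝 μ)

theorem integrable_pow_spectralLaw (L : SymmLink ι) (y : ι → ℝ) (n j : ℕ) :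
    Integrable (fun s : ℝ => s ^ j) (L.spectralLaw y n : Measure ℝ) :=
  integrable_empiricalSpectralMeasure _ n.succ_pos _

/-- Random signs supply one sequence of spectral laws whose moments tend to `β`. The limit law
obtained from it then serves every such sequence, whatever its inputs or probability space. -/
theorem exists_isMomentLimit {L : SymmLink ι} {D : ℕ}
    (hD : ∀ n (k : Fin n) t, {l | L.toFun n k l = t}.ncard ≤ D) {β : ℕ → ℝ}
    (hβ : L.HasPairLimits β)
    (hgrow : ∀ k, β (2 * k) ≤ ((2 * k) ^ k : ℕ) * (D : ℝ) ^ (2 * k)) :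
    ∃ μ : ProbabilityMeasure ℝ, IsMomentLimit β μ := by
  obtain ⟨Ω, _, P, _, x, hx⟩ := exists_inputA1 ι
  obtain ⟨ω, hω⟩ := (ae_all_iff.2 fun m => ae_tendsto_walkSum hD hβ hx.inputA3 m).exists
  have h0 : ∀ h, 0 ≤ β h := fun h =>
    ge_of_tendsto (hβ h) (Eventually.of_forall fun n => by positivity)
  exact exists_limit_of_moments (L.integrable_pow_spectralLaw fun t => x t ω)
    (tendsto_spectralLaw_of_walkSum hβ hω) (tendsto_growth_zero h0 hgrow)

theorem ae_tendsto_spectralLaw {L : SymmLink ι} {D : ℕ}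
    (hD : ∀ n (k : Fin n) t, {l | L.toFun n k l = t}.ncard ≤ D) {β : ℕ → ℝ}
    (hβ : L.HasPairLimits β) {μ : ProbabilityMeasure ℝ} (hμ : IsMomentLimit β μ)
    {Ω : Type w} [MeasurableSpace Ω] {P : Measure Ω} [IsProbabilityMeasure P] {x : ι → Ω → ℝ}
    (hx : InputA3 x P) :
    ∀ᵐ ω ∂P, Tendsto (L.spectralLaw fun t => x t ω) atTop (𝓝 μ) := by
  filter_upwards [ae_all_iff.2 fun m => ae_tendsto_walkSum hD hβ hx m] with ω hω
  exact hμ _ (L.integrable_pow_spectralLaw _) (tendsto_spectralLaw_of_walkSum hβ hω)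

end SymmLink

/-! ### Truncation -/

section Truncation

variable {ι : Type u} {Ω : Type w} [MeasurableSpace Ω] {P : Measure Ω} {x : ι → Ω → ℝ}

/-- Truncation at level `b`. -/
noncomputable def truncateAt (b : ℝ) : ℝ → ℝ := Set.indicator {s | |s| ≤ b} id

theorem measurable_truncateAt (b : ℝ) : Measurable (truncateAt b) :=
  measurable_id.indicator (measurableSet_le (f := fun s : ℝ => |s|) (by fun_prop) measurable_const)

theorem abs_truncateAt_le_abs (b s : ℝ) : |truncateAt b s| ≤ |s| := by
  unfold truncateAt Set.indicator
  split_ifs <;> simp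

theorem abs_truncateAt_le {b : ℝ} (hb : 0 ≤ b) (s : ℝ) : |truncateAt b s| ≤ b := by
  by_cases h : |s| ≤ b
  · simp [truncateAt, Set.indicator, h]
  · simpa [truncateAt, Set.indicator, h] using hb

theorem mul_truncateAt (b s : ℝ) : s * truncateAt b s = truncateAt b s ^ 2 := by
  by_cases h : |s| ≤ b <;> simp [truncateAt, Set.indicator, h, sq]

theorem truncateAt_of_le {b s : ℝ} (h : |s| ≤ b) : truncateAt b s = s := by
  simp [truncateAt, Set.indicator, h]

variable [IsProbabilityMeasure P]

/-- Identically distributed standardized inputs are close in mean square to bounded ones. -/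
theorem InputA2.exists_bounded_approx (hx : InputA2 x P) {ε : ℝ} (hε : 0 < ε) :
    ∃ g : ℝ → ℝ, Measurable g ∧ InputA1 (fun t ω => g (x t ω)) P ∧
      ∀ t, ∫ ω, (x t ω - g (x t ω)) ^ 2 ∂P ≤ ε := by
  obtain ⟨hs, hid⟩ := hx
  rcases isEmpty_or_nonempty ι with hι | ⟨⟨t₀⟩⟩
  · exact ⟨fun s => s, measurable_id, ⟨hs, 0, fun t => hι.elim t⟩, fun t => hι.elim t⟩
  have hx1 : ∀ t, Integrable (x t) P := fun t => (hs.memLp t).integrable one_le_two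
  have hx2 : ∀ t, Integrable (fun ω => x t ω ^ 2) P := fun t => (hs.memLp t).integrable_sq
  have hbd : ∀ (b : ℕ) t, MemLp (fun ω => truncateAt b (x t ω)) 2 P := fun b t =>
    MemLp.of_bound ((measurable_truncateAt b).comp (hs.measurable t)).aestronglyMeasurable b
      (ae_of_all _ fun ω => abs_truncateAt_le (Nat.cast_nonneg b) _)
  have hev : ∀ s : ℝ, ∀ᶠ b : ℕ in atTop, truncateAt b s = s := fun s => by
    filter_upwards [eventually_ge_atTop ⌈|s|⌉₊] with b hb
    exact truncateAt_of_le ((Nat.le_ceil _).trans (by exact_mod_cast hb))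
  have hmean : Tendsto (fun b : ℕ => ∫ ω, truncateAt b (x t₀ ω) ∂P) atTop (𝓝 0) := by
    rw [← hs.mean t₀]
    refine tendsto_integral_of_dominated_convergence (fun ω => |x t₀ ω|)
      (fun b => ((hbd b t₀).aestronglyMeasurable)) (hx1 t₀).abs
      (fun b => ae_of_all _ fun ω => abs_truncateAt_le_abs _ _)
      (ae_of_all _ fun ω => ?_)
    exact tendsto_const_nhds.congr' (by filter_upwards [hev (x t₀ ω)] with b hb using hb.symm)
  have hsq : Tendsto (fun b : ℕ => ∫ ω, truncateAt b (x t₀ ω) ^ 2 ∂P) atTop (𝓝 1) := by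
    rw [← hs.integral_sq t₀]
    refine tendsto_integral_of_dominated_convergence (fun ω => x t₀ ω ^ 2)
      (fun b => ((hbd b t₀).integrable_sq.aestronglyMeasurable)) (hx2 t₀)
      (fun b => ae_of_all _ fun ω => ?_) (ae_of_all _ fun ω => ?_)
    · rw [Real.norm_eq_abs, abs_pow, ← sq_abs (x t₀ ω)]
      exact pow_le_pow_left₀ (abs_nonneg _) (abs_truncateAt_le_abs _ _) 2
    · exact tendsto_const_nhds.congr'
        (by filter_upwards [hev (x t₀ ω)] with b hb using by rw [hb])
  have hvar := hsq.sub (hmean.pow 2)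
  rw [show (1 : ℝ) - 0 ^ 2 = 1 by norm_num] at hvar
  -- Writing `a` and `σ²` for the second moment and the variance of the truncated input, the mean
  -- square error of the standardized truncation is exactly `2 - 2 a / σ`, and `a` and `σ` tend to
  -- `1`.
  have herr := (hsq.div ((Real.continuous_sqrt.tendsto 1).comp hvar) (by simp)).const_mul 2
    |>.const_sub 2
  simp only [Real.sqrt_one, div_one, mul_one, sub_self] at herr
  obtain ⟨b, hb1, hb2⟩ := ((hvar.eventually_const_lt one_pos).and
    (herr.eventually_lt_const hε)).exists
  simp only [Function.comp_def, Pi.div_apply] at hb2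
  set a := ∫ ω, truncateAt b (x t₀ ω) ^ 2 ∂P
  set m := ∫ ω, truncateAt b (x t₀ ω) ∂P
  set σ := √(a - m ^ 2)
  have hσ : 0 < σ := Real.sqrt_pos.2 hb1
  have hσ2 : σ ^ 2 = a - m ^ 2 := Real.sq_sqrt hb1.le
  have ha : ∀ t, ∫ ω, truncateAt b (x t ω) ^ 2 ∂P = a := fun t =>
    ((hid t t₀).comp ((measurable_truncateAt b).pow_const 2)).integral_eq
  have hm : ∀ t, ∫ ω, truncateAt b (x t ω) ∂P = m := fun t =>
    ((hid t t₀).comp (measurable_truncateAt b)).integral_eq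
  -- The truncation is centered and rescaled; the same `m` and `σ` serve all indices because the
  -- inputs are identically distributed.
  let g : ℝ → ℝ := fun s => (truncateAt b s - m) / σ
  have hg : Measurable g := ((measurable_truncateAt b).sub_const m).div_const σ
  have hgb : ∀ s, |g s| ≤ (b + |m|) / σ := fun s => by
    simp only [g]
    rw [abs_div, abs_of_pos hσ]
    gcongr
    exact (abs_sub _ _).trans (add_le_add (abs_truncateAt_le (Nat.cast_nonneg b) s) le_rfl)
  have hgm : ∀ t, ∫ ω, g (x t ω) ∂P = 0 := fun t => by
    simp only [g]
    rw [integral_div, integral_sub ((hbd b t).integrable one_le_two) (integrable_const _), hm]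
    simp
  have hgL : ∀ t, MemLp (fun ω => g (x t ω)) 2 P := fun t =>
    MemLp.of_bound (hg.comp (hs.measurable t)).aestronglyMeasurable _
      (ae_of_all _ fun ω => hgb _)
  have hg2 : ∀ t, ∫ ω, g (x t ω) ^ 2 ∂P = 1 := fun t => by
    have h1 : ∀ ω, g (x t ω) ^ 2 = (truncateAt b (x t ω) ^ 2 - 2 * m * truncateAt b (x t ω) +
        m ^ 2) / σ ^ 2 := fun ω => by simp only [g, div_pow]; ring
    simp only [h1]
    have i1 := (hbd b t).integrable_sq
    have i2 := ((hbd b t).integrable one_le_two).const_mul (2 * m)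
    have i3 : Integrable (fun ω => truncateAt b (x t ω) ^ 2 - 2 * m * truncateAt b (x t ω)) P :=
      i1.sub i2
    rw [integral_div, integral_add i3 (integrable_const _), integral_sub i1 i2,
      integral_const_mul, ha, hm, hσ2]
    simp only [integral_const, probReal_univ, smul_eq_mul, one_mul]
    rw [div_eq_one_iff_eq (ne_of_gt hb1)]
    ring
  -- The product of `s` with its truncation is the squared truncation, and the centering constant
  -- contributes nothing because `x t` has mean `0`.
  have hcross : ∀ t, ∫ ω, x t ω * g (x t ω) ∂P = a / σ := fun t => by
    have h1 : ∀ ω, x t ω * g (x t ω) = (truncateAt b (x t ω) ^ 2 - m * x t ω) / σ := fun ω => by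
      simp only [g]
      rw [← mul_truncateAt]; ring
    simp only [h1]
    rw [integral_div, integral_sub (hbd b t).integrable_sq ((hx1 t).const_mul m), ha,
      integral_const_mul, hs.mean, mul_zero, sub_zero]
  refine ⟨g, hg, ⟨⟨fun t => hg.comp (hs.measurable t), hs.indep.comp (fun _ => g) fun _ => hg,
    hgL, hgm, fun t => ?_⟩, (b + |m|) / σ, fun t => ae_of_all _ fun ω => hgb _⟩, fun t => ?_⟩
  · rw [variance_of_integral_eq_zero (X := fun ω => g (x t ω))
      (hg.comp (hs.measurable t)).aemeasurable (hgm t), hg2]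
  · have h1 : ∀ ω, (x t ω - g (x t ω)) ^ 2 =
        x t ω ^ 2 - 2 * (x t ω * g (x t ω)) + g (x t ω) ^ 2 := fun ω => by ring
    have i1 : Integrable (fun ω => x t ω * g (x t ω)) P := (hs.memLp t).integrable_mul (hgL t)
    have i2 : Integrable (fun ω => x t ω ^ 2 - 2 * (x t ω * g (x t ω))) P :=
      (hx2 t).sub (i1.const_mul 2)
    simp only [h1]
    rw [integral_add i2 (hgL t).integrable_sq,
      integral_sub (hx2 t) (i1.const_mul 2), integral_const_mul, hcross, hg2, hs.integral_sq]
    linarith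

end Truncation

/-! ### The law of large numbers along increasing index sets -/

/-- List `V 0`, then append the new elements of `V 1`, `V 2` and so on. Each list is a prefix of the
later ones, so the `k`-th entry does not depend on the list from which it is read. -/
theorem exists_enumeration {ι : Type u} [DecidableEq ι] {V : ℕ → Finset ι} (hV : Monotone V)
    (hcard : Tendsto (fun n => (V n).card) atTop atTop) :
    ∃ e : ℕ → ι, Function.Injective e ∧ ∀ n, (Finset.range (V n).card).image e = V n := by
  let l : ℕ → List ι := fun n =>
    Nat.rec (V 0).toList (fun n l => l ++ (V (n + 1) \ V n).toList) n
  have hl0 : l 0 = (V 0).toList := rfl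
  have hls : ∀ n, l (n + 1) = l n ++ (V (n + 1) \ V n).toList := fun n => rfl
  have hmem : ∀ n t, t ∈ l n ↔ t ∈ V n := by
    intro n
    induction n with
    | zero => simp [hl0]
    | succ n ih =>
      intro t
      have := @hV n (n + 1) (Nat.le_succ n) t
      simp only [hls, List.mem_append, ih, Finset.mem_toList, Finset.mem_sdiff]
      tauto
  have hnodup : ∀ n, (l n).Nodup := by
    intro n
    induction n with
    | zero => exact Finset.nodup_toList _
    | succ n ih =>
      rw [hls]
      refine List.Nodup.append ih (Finset.nodup_toList _) fun t h1 h2 => ?_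
      rw [hmem] at h1
      simp [h1] at h2
  have hlen : ∀ n, (l n).length = (V n).card := fun n => by
    rw [← List.toFinset_card_of_nodup (hnodup n)]
    congr 1
    ext t; simp [hmem]
  have hpre : ∀ m n, m ≤ n → l m <+: l n := fun m n h => by
    induction n, h using Nat.le_induction with
    | base => exact List.prefix_rfl
    | succ n _ ih => exact ih.trans ⟨_, (hls n).symm⟩
  have hex : ∀ k, ∃ n, k < (l n).length := fun k => by
    obtain ⟨n, hn⟩ := (hcard.eventually_gt_atTop k).exists
    exact ⟨n, by rw [hlen]; exact hn⟩
  choose N hN using hex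
  have hget : ∀ k n (h : k < (l n).length), (l (N k))[k]'(hN k) = (l n)[k]'h := fun k n h => by
    rcases le_total (N k) n with h1 | h1
    · exact (hpre _ _ h1).getElem (hN k)
    · exact ((hpre _ _ h1).getElem h).symm
  refine ⟨fun k => (l (N k))[k]'(hN k), fun k k' h => ?_, fun n => ?_⟩
  · simp only at h
    obtain ⟨n, hn⟩ := (hcard.eventually_gt_atTop (max k k')).exists
    rw [← hlen] at hn
    rw [hget k n (lt_of_le_of_lt (le_max_left _ _) hn),
      hget k' n (lt_of_le_of_lt (le_max_right _ _) hn)] at h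
    exact (hnodup n).getElem_inj_iff.1 h
  · ext t
    rw [← hmem, List.mem_iff_getElem]
    simp only [Finset.mem_image, Finset.mem_range]
    constructor
    · rintro ⟨k, hk, rfl⟩
      rw [← hlen] at hk
      exact ⟨k, hk, (hget k n hk).symm⟩
    · rintro ⟨k, hk, rfl⟩
      exact ⟨k, by rwa [← hlen], hget k n hk⟩

/-- Along the enumeration, the average over `V n` is a partial average of one sequence, taken at the
index `|V n|`. -/
theorem strong_law_increasing_sets {ι : Type u} {Ω : Type w} [MeasurableSpace Ω] {P : Measure Ω}
    {z : ι → Ω → ℝ} (hind : iIndepFun z P) (hid : ∀ s t, IdentDistrib (z s) (z t) P P)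
    (hint : ∀ t, Integrable (z t) P) {V : ℕ → Finset ι} (hV : Monotone V)
    (hcard : Tendsto (fun n => (V n).card) atTop atTop) (t₀ : ι) :
    ∀ᵐ ω ∂P, Tendsto (fun n => (∑ t ∈ V n, z t ω) / (V n).card) atTop
      (𝓝 (∫ ω, z t₀ ω ∂P)) := by
  classical
  obtain ⟨e, he, hVe⟩ := exists_enumeration hV hcard
  have h := strong_law_ae_real (fun k => z (e k)) (hint _)
    (fun i j hij => hind.indepFun (he.ne hij)) (fun i => hid _ _)
  filter_upwards [h] with ω hω
  rw [(hid t₀ (e 0)).integral_eq]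
  refine (hω.comp hcard).congr fun n => ?_
  simp only [Function.comp_def]
  congr 1
  conv_rhs => rw [← hVe n]
  rw [Finset.sum_image he.injOn]

/-! ### Identically distributed inputs -/

/-- In the application `p` is `α_n`, `q` is `k_n`, `c` is the number of labels used up to size `n`,
and `S` is the sum of the squared errors over these labels. The estimate combines `k_n α_n = O(n²)`,
`c = O(k_n)` and the bound on the average error. -/
theorem inv_sq_mul_average_le {n p q S c C₁ C₂ b : ℝ} (hn : 0 < n) (hp : 0 ≤ p) (hS : 0 ≤ S)
    (hc : 0 < c) (hC₂ : 0 ≤ C₂) (h₁ : q * p ≤ C₁ * n ^ 2) (h₂ : c ≤ C₂ * q) (h₃ : S / c ≤ b) :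
    (n ^ 2)⁻¹ * (p * S) ≤ C₁ * C₂ * b := by
  have h4 : 0 ≤ S / c := div_nonneg hS hc.le
  have h5 : (0 : ℝ) ≤ C₁ * n ^ 2 := by
    refine le_trans (mul_nonneg ?_ hp) h₁
    by_contra hq
    nlinarith
  calc (n ^ 2)⁻¹ * (p * S) = (n ^ 2)⁻¹ * (p * (c * (S / c))) := by rw [mul_div_cancel₀ _ hc.ne']
    _ ≤ (n ^ 2)⁻¹ * (p * (C₂ * q * (S / c))) := by gcongr
    _ = (n ^ 2)⁻¹ * (q * p * (C₂ * (S / c))) := by ring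
    _ ≤ (n ^ 2)⁻¹ * (C₁ * n ^ 2 * (C₂ * b)) := by gcongr
    _ = (n ^ 2)⁻¹ * n ^ 2 * (C₁ * C₂ * b) := by ring
    _ = C₁ * C₂ * b := by rw [inv_mul_cancel₀ (by positivity), one_mul]

namespace SymmLink

variable {ι : Type u}

/-- The normalized squared Frobenius distance of two patterned matrices. -/
noncomputable def sqDist (L : SymmLink ι) (y y' : ι → ℝ) (n : ℕ) : ℝ :=
  ((n : ℝ) ^ 2)⁻¹ * ∑ i, ∑ j, (y (L.toFun n i j) - y' (L.toFun n i j)) ^ 2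

theorem abs_integral_spectralLaw_sub_le (L : SymmLink ι) (y y' : ι → ℝ) (n : ℕ) {f : ℝ → ℝ}
    {K : ℝ} (hK : 0 ≤ K) (hf : ∀ s t, |f s - f t| ≤ K * |s - t|) :
    |∫ s, f s ∂(L.spectralLaw y n : Measure ℝ) - ∫ s, f s ∂(L.spectralLaw y' n : Measure ℝ)| ≤
      K * √(L.sqDist y y' (n + 1)) := by
  refine (abs_integral_empiricalSpectralMeasure_sub_le (L.scaledMatrix_isHermitian y (n + 1))
    (L.scaledMatrix_isHermitian y' (n + 1)) hK hf).trans (le_of_eq ?_)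
  congr 2
  simp only [scaledMatrix, Matrix.of_apply, ← mul_sub, mul_pow, ← Finset.mul_sum, inv_pow]
  rw [Real.sq_sqrt (by positivity), sqDist, ← mul_assoc, ← mul_inv, ← sq]

theorem finite_values (L : SymmLink ι) (n : ℕ) : (L.values n).Finite := Set.finite_range _

theorem ncard_label_le_maxOccurrences (L : SymmLink ι) (n : ℕ) (t : ι) :
    Set.ncard {p : Fin n × Fin n | L.toFun n p.1 p.2 = t} ≤ L.maxOccurrences n := by
  have hbdd : BddAbove (Set.range fun t : ι =>
      Set.ncard {p : Fin n × Fin n | L.toFun n p.1 p.2 = t}) := by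
    refine ⟨Nat.card (Fin n × Fin n), ?_⟩
    rintro _ ⟨t, rfl⟩
    rw [← Set.ncard_univ]
    exact Set.ncard_le_ncard (Set.subset_univ _)
  exact le_ciSup hbdd t

theorem sum_labels_le (L : SymmLink ι) (n : ℕ) {z : ι → ℝ} (hz : ∀ t, 0 ≤ z t) {V : Finset ι}
    (hV : L.values n ⊆ V) :
    ∑ i, ∑ j, z (L.toFun n i j) ≤ L.maxOccurrences n * ∑ t ∈ V, z t := by
  classical
  rw [← Fintype.sum_prod_type' fun i j => z (L.toFun n i j),
    ← Finset.sum_fiberwise_of_maps_to (t := V) (g := fun p : Fin n × Fin n => L.toFun n p.1 p.2)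
      (fun p _ => hV ⟨p, rfl⟩), Finset.mul_sum]
  refine Finset.sum_le_sum fun t _ => ?_
  rw [Finset.sum_congr rfl (g := fun _ => z t) fun p hp => by rw [(Finset.mem_filter.1 hp).2],
    Finset.sum_const, nsmul_eq_mul]
  refine mul_le_mul_of_nonneg_right ?_ (hz t)
  have h1 := L.ncard_label_le_maxOccurrences n t
  rw [Set.ncard_eq_toFinset_card'] at h1
  have h2 : (Finset.univ.filter fun p : Fin n × Fin n => L.toFun n p.1 p.2 = t).card ≤
      L.maxOccurrences n := by
    refine le_trans (le_of_eq ?_) h1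
    congr 1
    ext; simp
  exact_mod_cast h2

theorem abs_sub_le_of_lipschitzWith {f : ℝ → ℝ} {K : NNReal} (hf : LipschitzWith K f) (s t : ℝ) :
    |f s - f t| ≤ K * |s - t| := by
  simpa [Real.dist_eq] using hf.dist_le_mul s t

/-- For each `k` the spectral laws of the bounded inputs `g k (x t)` converge, and the strong law
makes their Frobenius distance to the original matrices eventually small, with a bound tending to
`0` in `k`. Only countably many `k` are used, so one almost sure event suffices. -/
theorem ae_tendsto_spectralLaw_of_iid {L : SymmLink ι} {D : ℕ}
    (hD : ∀ n (k : Fin n) t, {l | L.toFun n k l = t}.ncard ≤ D) (hL : L.LinkCond)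
    (hcum : L.CumulativeValuesBound) {β : ℕ → ℝ}
    (hβ : L.HasPairLimits β) {μ : ProbabilityMeasure ℝ} (hμ : IsMomentLimit β μ)
    {Ω : Type w} [MeasurableSpace Ω] {P : Measure Ω} [IsProbabilityMeasure P] {x : ι → Ω → ℝ}
    (hx : InputA2 x P) :
    ∀ᵐ ω ∂P, Tendsto (L.spectralLaw fun t => x t ω) atTop (𝓝 μ) := by
  classical
  let t₀ : ι := L.toFun 1 0 0
  have hfin : ∀ n, (⋃ m ∈ Finset.range (n + 1), L.values m).Finite := fun n =>
    Set.Finite.biUnion (Finset.finite_toSet _) fun m _ => L.finite_values m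
  -- The cumulative label sets are used because the strong law needs increasing sets.
  let V : ℕ → Finset ι := fun n => (hfin n).toFinset
  have hVcard : ∀ n, (V n).card = (⋃ m ∈ Finset.range (n + 1), L.values m).ncard := fun n =>
    (Set.ncard_eq_toFinset_card _ (hfin n)).symm
  have hVsub : ∀ n, L.values n ⊆ V n := fun n t ht => by
    simp only [V, Set.Finite.coe_toFinset, Set.mem_iUnion]
    exact ⟨n, by simp, ht⟩
  have hVmono : Monotone V := fun n n' h t ht => by
    simp only [V, Set.Finite.mem_toFinset, Set.mem_iUnion, Finset.mem_range] at ht ⊢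
    obtain ⟨m, hm, ht⟩ := ht
    exact ⟨m, by omega, ht⟩
  have hVlim : Tendsto (fun n => (V n).card) atTop atTop := by
    refine tendsto_atTop_mono (fun n => ?_) hL.1
    rw [← Set.ncard_coe_finset]
    exact Set.ncard_le_ncard (hVsub n) (V n).finite_toSet
  obtain ⟨C₁, hC₁, hb₁⟩ := hL.2.exists_pos
  obtain ⟨C₂, hC₂, hb₂⟩ := hcum.exists_pos
  rw [isBigOWith_iff] at hb₁ hb₂
  have happrox : ∀ k : ℕ, ∃ g : ℝ → ℝ, Measurable g ∧ InputA1 (fun t ω => g (x t ω)) P ∧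
      ∀ t, ∫ ω, (x t ω - g (x t ω)) ^ 2 ∂P ≤ 1 / ((k : ℝ) + 1) := fun k =>
    hx.exists_bounded_approx (by positivity)
  choose g hg hgA1 hgε using happrox
  have hz : ∀ k, Measurable fun s => (s - g k s) ^ 2 := fun k =>
    (measurable_id.sub (hg k)).pow_const 2
  have hslln := ae_all_iff.2 fun k => strong_law_increasing_sets
    (z := fun t ω => (x t ω - g k (x t ω)) ^ 2) (hx.1.indep.comp (fun _ s => (s - g k s) ^ 2)
      fun _ => hz k) (fun s t => (hx.2 s t).comp (hz k))
    (fun t => ((hx.1.memLp t).sub ((hgA1 k).1.memLp t)).integrable_sq) hVmono hVlim t₀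
  have hgood := ae_all_iff.2 fun k => ae_tendsto_spectralLaw hD hβ hμ (hgA1 k).inputA3
  filter_upwards [hslln, hgood] with ω h1 h2
  have hdist : ∀ k, ∀ᶠ n in atTop, L.sqDist (fun t => x t ω) (fun t => g k (x t ω)) n ≤
      C₁ * C₂ * (2 / ((k : ℝ) + 1)) := by
    intro k
    -- The numerator `2` leaves a strict gap above the limit of the averages, so the averages are
    -- eventually below it.
    have hlt : ∫ ω, (x t₀ ω - g k (x t₀ ω)) ^ 2 ∂P < 2 / ((k : ℝ) + 1) := by
      refine (hgε k t₀).trans_lt ?_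
      gcongr
      norm_num
    filter_upwards [hb₁, hb₂, (h1 k).eventually_lt_const hlt, eventually_gt_atTop 0]
      with n e1 e2 e3 hn
    have hn' : (0 : ℝ) < n := by exact_mod_cast hn
    simp only [Real.norm_eq_abs] at e1 e2
    rw [abs_of_nonneg (by positivity), abs_of_nonneg (by positivity)] at e1
    rw [abs_of_nonneg (by positivity), abs_of_nonneg (by positivity), ← hVcard] at e2
    have hVpos : (0 : ℝ) < (V n).card := by
      have : L.toFun n ⟨0, hn⟩ ⟨0, hn⟩ ∈ V n := hVsub n ⟨(⟨0, hn⟩, ⟨0, hn⟩), rfl⟩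
      exact Nat.cast_pos.2 (Finset.card_pos.2 ⟨_, this⟩)
    refine le_trans (mul_le_mul_of_nonneg_left (L.sum_labels_le n
      (z := fun t => (x t ω - g k (x t ω)) ^ 2) (fun t => sq_nonneg _) (hVsub n))
      (by positivity)) ?_
    exact inv_sq_mul_average_le hn' (Nat.cast_nonneg _)
      (Finset.sum_nonneg fun t _ => sq_nonneg _) hVpos hC₂.le e1 e2 e3.le
  rw [tendsto_iff_forall_lipschitz_integral_tendsto]
  rintro f hfb ⟨K, hf⟩
  rw [Metric.tendsto_nhds]
  intro η hη
  have hk : Tendsto (fun k : ℕ => (K : ℝ) * √(C₁ * C₂ * (2 / ((k : ℝ) + 1)))) atTop (𝓝 0) := by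
    have h3 : Tendsto (fun k : ℕ => C₁ * C₂ * (2 / ((k : ℝ) + 1))) atTop (𝓝 0) := by
      have := ((tendsto_one_div_add_atTop_nhds_zero_nat (𝕜 := ℝ)).const_mul (C₁ * C₂ * 2))
      rw [mul_zero] at this
      exact this.congr fun k => by ring
    have := ((Real.continuous_sqrt.tendsto 0).comp h3).const_mul (K : ℝ)
    simpa using this
  obtain ⟨k, hk⟩ := (hk.eventually_lt_const (half_pos hη)).exists
  have h3 := tendsto_iff_forall_lipschitz_integral_tendsto.1 (h2 k) f hfb ⟨K, hf⟩
  filter_upwards [(Metric.tendsto_nhds.1 h3) _ (half_pos hη),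
    (tendsto_add_atTop_nat 1).eventually (hdist k)] with n e1 e2
  have e3 := L.abs_integral_spectralLaw_sub_le (fun t => x t ω) (fun t => g k (x t ω)) n
    K.2 (abs_sub_le_of_lipschitzWith hf)
  have e4 : (K : ℝ) * √(L.sqDist (fun t => x t ω) (fun t => g k (x t ω)) (n + 1)) ≤
      K * √(C₁ * C₂ * (2 / ((k : ℝ) + 1))) := by gcongr
  calc _ ≤ dist _ _ + dist _ _ := dist_triangle _
          (∫ s, f s ∂(L.spectralLaw (fun t => g k (x t ω)) n : Measure ℝ)) _
    _ < η / 2 + η / 2 := add_lt_add (lt_of_le_of_lt (e3.trans e4) hk) e1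
    _ = η := add_halves η

/-- The integral is continuous in the matrix entries by the Frobenius estimate. Arrays are
symmetrized so that the map is defined on the whole space; on the symmetric matrices at hand this
changes nothing. -/
theorem measurable_integral_spectralLaw (L : SymmLink ι) (n : ℕ) {f : ℝ → ℝ} {K : NNReal}
    (hf : LipschitzWith K f) {Ω : Type w} [MeasurableSpace Ω] {x : ι → Ω → ℝ}
    (hx : ∀ t, Measurable (x t)) :
    Measurable fun ω => ∫ s, f s ∂(L.spectralLaw (fun t => x t ω) n : Measure ℝ) := by
  let A : (Fin (n + 1) → Fin (n + 1) → ℝ) → Matrix (Fin (n + 1)) (Fin (n + 1)) ℝ :=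
    fun M => Matrix.of fun i j => (M i j + M j i) / 2
  have hA : ∀ M, (A M).IsHermitian := fun M => by
    ext i j
    simp [A, add_comm]
  let Φ : (Fin (n + 1) → Fin (n + 1) → ℝ) → ℝ := fun M =>
    ∫ s, f s ∂empiricalSpectralMeasure (A M) (hA M)
  have hΦ : Continuous Φ := by
    rw [continuous_iff_continuousAt]
    intro M₀
    rw [ContinuousAt, tendsto_iff_dist_tendsto_zero]
    have hlim : Tendsto (fun M => (K : ℝ) * √(((n + 1 : ℕ) : ℝ)⁻¹ *
        ∑ i, ∑ j, (A M i j - A M₀ i j) ^ 2)) (𝓝 M₀) (𝓝 0) := by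
      have hc : Continuous fun M : Fin (n + 1) → Fin (n + 1) → ℝ =>
          (K : ℝ) * √(((n + 1 : ℕ) : ℝ)⁻¹ * ∑ i, ∑ j, (A M i j - A M₀ i j) ^ 2) := by
        simp only [A, Matrix.of_apply]
        fun_prop
      have := hc.tendsto M₀
      simpa using this
    exact squeeze_zero (fun _ => dist_nonneg) (fun M =>
      abs_integral_empiricalSpectralMeasure_sub_le (hA M) (hA M₀) K.2
        (abs_sub_le_of_lipschitzWith hf)) hlim
  have hmeas : Measurable fun ω => Φ fun i j => L.scaledMatrix (fun t => x t ω) (n + 1) i j := by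
    refine hΦ.measurable.comp (measurable_pi_lambda _ fun i => measurable_pi_lambda _ fun j => ?_)
    exact (hx _).const_mul _
  convert hmeas using 2 with ω
  simp only [Φ, spectralLaw, ProbabilityMeasure.coe_mk]
  congr 2
  ext i j
  simp only [A, Matrix.of_apply]
  have := congrFun (congrFun (L.scaledMatrix_isHermitian (fun t => x t ω) (n + 1)) i) j
  simp only [Matrix.conjTranspose_apply, star_trivial] at this
  rw [this]; ring

theorem integral_sqDist_le (L : SymmLink ι) {Ω : Type w} [MeasurableSpace Ω] {P : Measure Ω}
    [IsProbabilityMeasure P] {x x' : ι → Ω → ℝ} (hx : ∀ t, MemLp (x t) 2 P)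
    (hx' : ∀ t, MemLp (x' t) 2 P) {ε : ℝ} (hε : ∀ t, ∫ ω, (x t ω - x' t ω) ^ 2 ∂P ≤ ε) (n : ℕ) :
    Integrable (fun ω => L.sqDist (fun t => x t ω) (fun t => x' t ω) (n + 1)) P ∧
      ∫ ω, L.sqDist (fun t => x t ω) (fun t => x' t ω) (n + 1) ∂P ≤ ε := by
  have hint : ∀ t, Integrable (fun ω => (x t ω - x' t ω) ^ 2) P := fun t =>
    ((hx t).sub (hx' t)).integrable_sq
  have hint2 : ∀ i : Fin (n + 1), Integrable (fun ω => ∑ j,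
      (x (L.toFun (n + 1) i j) ω - x' (L.toFun (n + 1) i j) ω) ^ 2) P := fun i =>
    integrable_finsetSum _ fun j _ => hint _
  refine ⟨(integrable_finsetSum _ fun i _ => hint2 i).const_mul _, ?_⟩
  simp only [sqDist]
  rw [integral_const_mul, integral_finsetSum _ fun i _ => hint2 i]
  rw [inv_mul_le_iff₀ (by positivity)]
  calc _ ≤ ∑ _i : Fin (n + 1), ∑ _j : Fin (n + 1), ε := by
        refine Finset.sum_le_sum fun i _ => ?_
        rw [integral_finsetSum _ fun j _ => hint _]
        exact Finset.sum_le_sum fun j _ => hε _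
    _ = _ := by simp; ring

/-- Under (A2), integrals of bounded Lipschitz functions converge in probability. -/
theorem tendstoInMeasure_integral_spectralLaw {L : SymmLink ι} {D : ℕ}
    (hD : ∀ n (k : Fin n) t, {l | L.toFun n k l = t}.ncard ≤ D) {β : ℕ → ℝ}
    (hβ : L.HasPairLimits β) {μ : ProbabilityMeasure ℝ} (hμ : IsMomentLimit β μ)
    {Ω : Type w} [MeasurableSpace Ω] {P : Measure Ω} [IsProbabilityMeasure P] {x : ι → Ω → ℝ}
    (hx : InputA2 x P) {f : ℝ → ℝ} (hfb : ∃ C : ℝ, ∀ s t, dist (f s) (f t) ≤ C) {K : NNReal}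
    (hf : LipschitzWith K f) :
    TendstoInMeasure P (fun n ω => ∫ s, f s ∂(L.spectralLaw (fun t => x t ω) n : Measure ℝ)) atTop
      (fun _ => ∫ s, f s ∂(μ : Measure ℝ)) := by
  rw [tendstoInMeasure_iff_measureReal_dist]
  intro η hη
  rw [Metric.tendsto_nhds]
  intro δ hδ
  -- The threshold is such that squared distance below `c` changes the integral by at most `η / 2`;
  -- dividing by `K + 1` also covers `K = 0`. The mean square error `c * (δ / 2)` then gives
  -- probability at most `δ / 2` by Markov's inequality.
  obtain ⟨c, hc⟩ : ∃ c : ℝ, c = (η / 2 / (K + 1)) ^ 2 := ⟨_, rfl⟩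
  have hc0 : 0 < c := by rw [hc]; positivity
  obtain ⟨g, hg, hgA1, hgε⟩ := hx.exists_bounded_approx (ε := c * (δ / 2)) (by positivity)
  have hconv : TendstoInMeasure P (fun n ω => ∫ s, f s
      ∂(L.spectralLaw (fun t => g (x t ω)) n : Measure ℝ)) atTop
      (fun _ => ∫ s, f s ∂(μ : Measure ℝ)) := by
    refine tendstoInMeasure_of_tendsto_ae (fun n => (L.measurable_integral_spectralLaw n hf
      (fun t => hg.comp (hx.1.measurable t))).aestronglyMeasurable) ?_
    filter_upwards [ae_tendsto_spectralLaw hD hβ hμ hgA1.inputA3] with ω hω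
    exact tendsto_iff_forall_lipschitz_integral_tendsto.1 hω f hfb ⟨K, hf⟩
  rw [tendstoInMeasure_iff_measureReal_dist] at hconv
  filter_upwards [(hconv (η / 2) (half_pos hη)).eventually_lt_const (half_pos hδ)] with n hn
  rw [Real.dist_0_eq_abs, abs_of_nonneg measureReal_nonneg]
  obtain ⟨hi, hle⟩ := L.integral_sqDist_le hx.1.memLp hgA1.1.memLp hgε n
  have hnn : ∀ ω, 0 ≤ L.sqDist (fun t => x t ω) (fun t => g (x t ω)) (n + 1) := fun ω => by
    unfold sqDist; positivity
  have hmarkov := mul_meas_ge_le_integral_of_nonneg (ae_of_all P hnn) hi c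
  have hbad : P.real {ω | c ≤ L.sqDist (fun t => x t ω) (fun t => g (x t ω)) (n + 1)} ≤ δ / 2 :=
    le_of_mul_le_mul_left (hmarkov.trans hle) hc0
  have hsub : {ω | η ≤ dist (∫ s, f s ∂(L.spectralLaw (fun t => x t ω) n : Measure ℝ))
      (∫ s, f s ∂(μ : Measure ℝ))} ⊆
      {ω | c ≤ L.sqDist (fun t => x t ω) (fun t => g (x t ω)) (n + 1)} ∪
      {ω | η / 2 ≤ dist (∫ s, f s ∂(L.spectralLaw (fun t => g (x t ω)) n : Measure ℝ))
        (∫ s, f s ∂(μ : Measure ℝ))} := by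
    intro ω hω
    by_contra hcon
    simp only [Set.mem_union, Set.mem_ofPred_eq, not_or, not_le] at hcon hω
    have e3 := L.abs_integral_spectralLaw_sub_le (fun t => x t ω) (fun t => g (x t ω)) n
      K.2 (abs_sub_le_of_lipschitzWith hf)
    have e4 : √(L.sqDist (fun t => x t ω) (fun t => g (x t ω)) (n + 1)) ≤ η / 2 / (K + 1) := by
      rw [Real.sqrt_le_left (by positivity), ← hc]
      exact hcon.1.le
    have e5 : (K : ℝ) * (η / 2 / (K + 1)) ≤ η / 2 := by
      rw [← mul_div_assoc, div_le_iff₀ (by positivity)]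
      nlinarith [K.2]
    have e6 := dist_triangle (∫ s, f s ∂(L.spectralLaw (fun t => x t ω) n : Measure ℝ))
      (∫ s, f s ∂(L.spectralLaw (fun t => g (x t ω)) n : Measure ℝ)) (∫ s, f s ∂(μ : Measure ℝ))
    have e7 : dist (∫ s, f s ∂(L.spectralLaw (fun t => x t ω) n : Measure ℝ))
      (∫ s, f s ∂(L.spectralLaw (fun t => g (x t ω)) n : Measure ℝ)) ≤ η / 2 :=
      e3.trans ((mul_le_mul_of_nonneg_left e4 K.2).trans e5)
    linarith [hcon.2]
  calc _ ≤ _ := measureReal_mono hsub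
    _ ≤ _ := measureReal_union_le _ _
    _ < δ / 2 + δ / 2 := add_lt_add_of_le_of_lt hbad hn
    _ = δ := add_halves δ

/-- A Lipschitz function that equals `1` up to `s` and `0` from `s + d` on. -/
noncomputable def ramp (s d r : ℝ) : ℝ := max 0 (min 1 (1 - (r - s) / d))

theorem ramp_nonneg (s d r : ℝ) : 0 ≤ ramp s d r := le_max_left _ _

theorem ramp_le_one (s d r : ℝ) : ramp s d r ≤ 1 := max_le zero_le_one (min_le_left _ _)

theorem ramp_of_le {s d r : ℝ} (hd : 0 < d) (h : r ≤ s) : ramp s d r = 1 := by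
  have : (r - s) / d ≤ 0 := div_nonpos_of_nonpos_of_nonneg (by linarith) hd.le
  rw [ramp, min_eq_left (by linarith), max_eq_right zero_le_one]

theorem ramp_of_ge {s d r : ℝ} (hd : 0 < d) (h : s + d ≤ r) : ramp s d r = 0 := by
  have : 1 ≤ (r - s) / d := by rw [le_div_iff₀ hd]; linarith
  rw [ramp, max_eq_left]
  exact (min_le_right _ _).trans (by linarith)

theorem lipschitzWith_ramp (s : ℝ) {d : ℝ} (hd : 0 < d) :
    LipschitzWith (Real.toNNReal d⁻¹) (ramp s d) := by
  have h1 : LipschitzWith (Real.toNNReal d⁻¹) fun r : ℝ => 1 - (r - s) / d :=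
    LipschitzWith.of_dist_le_mul fun r r' => by
      rw [Real.coe_toNNReal _ (by positivity), Real.dist_eq, Real.dist_eq,
        show 1 - (r - s) / d - (1 - (r' - s) / d) = -(d⁻¹ * (r - r')) by field_simp; ring,
        abs_neg, abs_mul, abs_of_pos (inv_pos.2 hd)]
  exact (h1.const_min 1).const_max 0

theorem dist_ramp_le (s d : ℝ) : ∃ C : ℝ, ∀ r r', dist (ramp s d r) (ramp s d r') ≤ C :=
  ⟨1, fun r r' => by
    rw [Real.dist_eq, abs_le]
    constructor <;> linarith [ramp_nonneg s d r, ramp_nonneg s d r', ramp_le_one s d r,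
      ramp_le_one s d r']⟩

theorem integrable_ramp (ν : Measure ℝ) [IsProbabilityMeasure ν] (s : ℝ) {d : ℝ} (hd : 0 < d) :
    Integrable (ramp s d) ν :=
  Integrable.of_bound (lipschitzWith_ramp s hd).continuous.aestronglyMeasurable 1
    (ae_of_all _ fun r => by
      rw [Real.norm_eq_abs, abs_of_nonneg (ramp_nonneg s d r)]
      exact ramp_le_one s d r)

theorem measureReal_Iic_le_integral_ramp (ν : Measure ℝ) [IsProbabilityMeasure ν] (s : ℝ) {d : ℝ}
    (hd : 0 < d) : ν.real (Set.Iic s) ≤ ∫ r, ramp s d r ∂ν := by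
  rw [← integral_indicator_one measurableSet_Iic]
  refine integral_mono ((integrable_const (1 : ℝ)).indicator measurableSet_Iic)
    (integrable_ramp ν s hd) fun r => ?_
  by_cases hr : r ≤ s
  · simp [hr, ramp_of_le hd hr]
  · simp [hr, ramp_nonneg]

theorem integral_ramp_le_measureReal_Iic (ν : Measure ℝ) [IsProbabilityMeasure ν] (s : ℝ) {d : ℝ}
    (hd : 0 < d) : ∫ r, ramp s d r ∂ν ≤ ν.real (Set.Iic (s + d)) := by
  rw [← integral_indicator_one measurableSet_Iic]
  refine integral_mono (integrable_ramp ν s hd)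
    ((integrable_const (1 : ℝ)).indicator measurableSet_Iic) fun r => ?_
  by_cases hr : r ≤ s + d
  · simp [hr, ramp_le_one]
  · simp [hr, ramp_of_ge hd (not_le.1 hr).le]

/-- The distribution function at `s` lies between the integrals of the ramps starting at `s - d` and
at `s`. Their limits lie between the values of the limit distribution function at `s - d` and `s +
d`, which are within `η / 2` of its value at `s`. -/
theorem esdTendstoInProbability_of_iid {L : SymmLink ι} {D : ℕ}
    (hD : ∀ n (k : Fin n) t, {l | L.toFun n k l = t}.ncard ≤ D) {β : ℕ → ℝ}
    (hβ : L.HasPairLimits β) {μ : ProbabilityMeasure ℝ} (hμ : IsMomentLimit β μ)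
    {Ω : Type w} [MeasurableSpace Ω] {P : Measure Ω} [IsProbabilityMeasure P] {x : ι → Ω → ℝ}
    (hx : InputA2 x P) : L.ESDTendstoInProbability x P μ := by
  intro s hs
  rw [tendstoInMeasure_iff_measureReal_dist]
  intro η hη
  rw [← tendsto_add_atTop_iff_nat 1]
  obtain ⟨d', hd', hd''⟩ := Metric.continuousAt_iff.1 hs (η / 2) (half_pos hη)
  obtain ⟨d, hd, hdd⟩ : ∃ d, 0 < d ∧ d < d' := ⟨d' / 2, half_pos hd', half_lt_self hd'⟩
  have hup : (μ : Measure ℝ).real (Set.Iic (s + d)) < (μ : Measure ℝ).real (Set.Iic s) + η / 2 := by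
    have := hd'' (x := s + d) (by rw [Real.dist_eq, add_sub_cancel_left, abs_of_pos hd]; exact hdd)
    rw [Real.dist_eq, abs_lt] at this
    linarith [this.2]
  have hlo : (μ : Measure ℝ).real (Set.Iic s) - η / 2 < (μ : Measure ℝ).real (Set.Iic (s - d)) := by
    have := hd'' (x := s - d) (by
      rw [Real.dist_eq, sub_sub_cancel_left, abs_neg, abs_of_pos hd]; exact hdd)
    rw [Real.dist_eq, abs_lt] at this
    linarith [this.1]
  have h1 := tendstoInMeasure_iff_measureReal_dist.1 (tendstoInMeasure_integral_spectralLaw hD hβ hμ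
    hx (dist_ramp_le s d) (lipschitzWith_ramp s hd)) (η / 2) (half_pos hη)
  have h2 := tendstoInMeasure_iff_measureReal_dist.1 (tendstoInMeasure_integral_spectralLaw hD hβ hμ
    hx (dist_ramp_le (s - d) d) (lipschitzWith_ramp (s - d) hd)) (η / 2) (half_pos hη)
  have h12 := h1.add h2
  rw [add_zero] at h12
  refine squeeze_zero (fun _ => measureReal_nonneg) (fun n => ?_) h12
  refine (measureReal_mono ?_).trans (measureReal_union_le _ _)
  intro ω hω
  by_contra hcon
  simp only [Set.mem_union, Set.mem_ofPred_eq, not_or, not_le] at hcon hω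
  obtain ⟨c1, c2⟩ := hcon
  have hesd : L.esd (fun t => x t ω) (n + 1) s =
      (L.spectralLaw (fun t => x t ω) n : Measure ℝ).real (Set.Iic s) := rfl
  have a1 := measureReal_Iic_le_integral_ramp (L.spectralLaw (fun t => x t ω) n : Measure ℝ) s hd
  have a2 := integral_ramp_le_measureReal_Iic (μ : Measure ℝ) s hd
  have a3 := integral_ramp_le_measureReal_Iic (L.spectralLaw (fun t => x t ω) n : Measure ℝ)
    (s - d) hd
  have a4 := measureReal_Iic_le_integral_ramp (μ : Measure ℝ) (s - d) hd
  rw [sub_add_cancel] at a3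
  rw [hesd] at hω
  rw [Real.dist_eq, abs_lt] at c1 c2
  rw [Real.dist_eq] at hω
  refine absurd hω (not_le.2 (abs_lt.2 ⟨?_, ?_⟩)) <;> linarith [c1.1, c1.2, c2.1, c2.2]

/-- A link with Property B and (Lcond) whose pair-matched circuits have limit frequencies `β` has
the law with moments `β` as its LSD. -/
theorem isLSD_of_hasPairLimits {L : SymmLink ι} (hB : L.PropertyB) (hL : L.LinkCond) {β : ℕ → ℝ}
    (hβ : L.HasPairLimits β) {μ : ProbabilityMeasure ℝ} (hμ : IsMomentLimit β μ) :
    SymmLink.IsLSD.{u, w} L (μ : Measure ℝ) := by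
  obtain ⟨D, -, hD⟩ := hB.exists_bound
  refine ⟨inferInstance, fun Ω _ P _ x => ⟨fun hx => ?_, fun hx => ?_, fun hx hcum => ?_,
    fun hx => esdTendstoInProbability_of_iid hD hβ hμ hx⟩⟩
  · filter_upwards [ae_tendsto_spectralLaw hD hβ hμ hx.inputA3] with ω hω s hs
    exact tendsto_esd_of_tendsto_spectralLaw hω hs
  · filter_upwards [ae_tendsto_spectralLaw hD hβ hμ hx] with ω hω s hs
    exact tendsto_esd_of_tendsto_spectralLaw hω hs
  · filter_upwards [ae_tendsto_spectralLaw_of_iid hD hL hcum hβ hμ hx] with ω hω s hs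
    exact tendsto_esd_of_tendsto_spectralLaw hω hs

end SymmLink

/-! ### Relabelled links -/

namespace SymmLink

variable {ι : Type u} {κ : Type v} {L : SymmLink ι} {ρ : ℕ → ι → κ}

theorem stepValue_mem_values (L : SymmLink ι) {n h : ℕ} (π : Fin (h + 1) → Fin n) (i : Fin h) :
    L.stepValue π i ∈ L.values n :=
  ⟨(π i.castSucc, π i.succ), rfl⟩

theorem values_map (L : SymmLink ι) (ρ : ℕ → ι → κ) (n : ℕ) :
    (L.map ρ).values n = ρ n '' L.values n := by
  rw [values, values, ← Set.range_comp]
  rfl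

theorem map_toFun_eq_iff (hρ : ∀ n, Set.InjOn (ρ n) (L.values n)) {n : ℕ} {t : ι}
    (ht : t ∈ L.values n) (i j : Fin n) :
    (L.map ρ).toFun n i j = ρ n t ↔ L.toFun n i j = t :=
  (hρ n).eq_iff ⟨(i, j), rfl⟩ ht

theorem map_stepValue_eq_iff (hρ : ∀ n, Set.InjOn (ρ n) (L.values n)) {n h : ℕ}
    (π : Fin (h + 1) → Fin n) (i j : Fin h) :
    (L.map ρ).stepValue π i = (L.map ρ).stepValue π j ↔ L.stepValue π i = L.stepValue π j :=
  (hρ n).eq_iff (L.stepValue_mem_values π i) (L.stepValue_mem_values π j)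

theorem PropertyB.map (hB : L.PropertyB) (hρ : ∀ n, Set.InjOn (ρ n) (L.values n)) :
    (L.map ρ).PropertyB := by
  refine lt_of_le_of_lt (iSup_le fun n => iSup_le fun t => iSup_le fun ht => iSup_le fun k => ?_) hB
  rw [values_map] at ht
  obtain ⟨t, ht, rfl⟩ := ht
  simp only [map_toFun_eq_iff hρ ht]
  exact le_iSup_of_le n (le_iSup_of_le t (le_iSup_of_le ht (le_iSup_of_le k le_rfl)))

theorem maxOccurrences_map_le (hρ : ∀ n, Set.InjOn (ρ n) (L.values n)) (n : ℕ) :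
    (L.map ρ).maxOccurrences n ≤ L.maxOccurrences n := by
  refine ciSup_le' fun t => ?_
  by_cases ht : t ∈ (L.map ρ).values n
  · rw [values_map] at ht
    obtain ⟨t, ht, rfl⟩ := ht
    simp only [map_toFun_eq_iff hρ ht]
    exact L.ncard_label_le_maxOccurrences n t
  · have : {p : Fin n × Fin n | (L.map ρ).toFun n p.1 p.2 = t} = ∅ :=
      Set.eq_empty_of_forall_notMem fun p hp => ht ⟨p, hp⟩
    simp [this]

theorem LinkCond.map (hL : L.LinkCond) (hρ : ∀ n, Set.InjOn (ρ n) (L.values n)) :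
    (L.map ρ).LinkCond := by
  have hnum : (L.map ρ).numValues = L.numValues := by
    ext n
    rw [numValues, values_map, (hρ n).ncard_image, numValues]
  refine ⟨by rw [hnum]; exact hL.1, IsBigO.trans (IsBigO.of_norm_le fun n => ?_) hL.2⟩
  rw [hnum, Real.norm_of_nonneg (by positivity)]
  gcongr
  exact maxOccurrences_map_le hρ n

theorem circuitsStar_map (hρ : ∀ n, Set.InjOn (ρ n) (L.values n)) {h : ℕ} (W : Word h) (n : ℕ) :
    (L.map ρ).circuitsStar W n = L.circuitsStar W n := by
  simp only [circuitsStar, map_stepValue_eq_iff hρ]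

/-- Pair matching depends only on which labels of a circuit coincide. -/
theorem HasPairLimits.map {β : ℕ → ℝ} (hβ : L.HasPairLimits β)
    (hρ : ∀ n, Set.InjOn (ρ n) (L.values n)) : (L.map ρ).HasPairLimits β := by
  have : ∀ h n, (L.map ρ).pairCircuits h n = L.pairCircuits h n := fun h n => by
    classical
    simp only [pairCircuits, letterCount_eq_ncard, map_stepValue_eq_iff hρ]
  simpa only [HasPairLimits, this] using hβ

/-- A link with Property B and (Lcond) whose word limits exist has the same LSD as each of its
injective relabellings. -/
theorem exists_isLSD_map (hB : L.PropertyB) (hL : L.LinkCond) (hW : L.WordLimitsExist)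
    (hρ : ∀ n, Set.InjOn (ρ n) (L.values n)) :
    ∃ μ : Measure ℝ, SymmLink.IsLSD.{u, w} L μ ∧ SymmLink.IsLSD.{v, w} (L.map ρ) μ := by
  obtain ⟨D, -, hD⟩ := hB.exists_bound
  obtain ⟨β, hβ, hgrow⟩ := exists_hasPairLimits hD hW
  obtain ⟨μ, hμ⟩ := exists_isMomentLimit hD hβ hgrow
  exact ⟨μ, isLSD_of_hasPairLimits hB hL hβ hμ,
    isLSD_of_hasPairLimits (hB.map hρ) (hL.map hρ) (hβ.map hρ) hμ⟩

end SymmLink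

/-! ### Counting lattice points -/

section LatticePoints

variable {A : Type*} [Fintype A]

/-- A convex set has a null frontier, so its rescaled lattice points equidistribute. The rest
identifies points of `n⁻¹ ℤ^A` with integer vectors. -/
theorem Convex.tendsto_ncard_lattice_points {s : Set (A → ℝ)} (hs : Convex ℝ s)
    (hb : Bornology.IsBounded s) (hm : MeasurableSet s) :
    Tendsto (fun n : ℕ => ({x : A → ℤ | (fun a => (x a : ℝ) / n) ∈ s}.ncard : ℝ) /
      (n : ℝ) ^ Fintype.card A) atTop (𝓝 (volume.real s)) := by
  refine (tendsto_card_div_pow_atTop_volume s hb hm (hs.addHaar_frontier volume)).congr' ?_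
  filter_upwards [eventually_gt_atTop 0] with n hn
  have hn' : (n : ℝ) ≠ 0 := Nat.cast_ne_zero.2 hn.ne'
  congr 2
  rw [Nat.card_coe_set_eq]
  let g : (A → ℤ) → A → ℝ := fun x a => (x a : ℝ) / n
  have hg : Function.Injective g := fun x y hxy => by
    funext a
    have := congrFun hxy a
    simp only [g] at this
    exact_mod_cast (div_left_inj' hn').1 this
  rw [← Set.ncard_image_of_injective _ hg]
  congr 1
  ext y
  simp only [Set.mem_inter_iff, Set.mem_image, Set.mem_ofPred_eq]
  constructor
  · rintro ⟨hy, z, hz, rfl⟩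
    rw [SetLike.mem_coe, Module.Basis.mem_span_iff_repr_mem] at hz
    choose x hx using hz
    have hgx : g x = (n : ℝ)⁻¹ • z := by
      funext a
      have := hx a
      simp only [Pi.basisFun_repr, algebraMap_int_eq, eq_intCast] at this
      simp only [g, this, Pi.smul_apply, smul_eq_mul]
      rw [div_eq_inv_mul]
    exact ⟨x, by change g x ∈ s; rw [hgx]; exact hy, hgx⟩
  · rintro ⟨x, hx, rfl⟩
    refine ⟨hx, fun a => (x a : ℝ), ?_, ?_⟩
    · rw [SetLike.mem_coe, Module.Basis.mem_span_iff_repr_mem]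
      intro a
      exact ⟨x a, by simp⟩
    · funext a
      simp [g, div_eq_inv_mul]

/-- The integer points of the box `[-n, n]^A` that satisfy the linear relation with coefficients
`c`. -/
def boxRelation (c : A → ℤ) (n : ℕ) : Set (A → ℤ) :=
  {x | (∀ a, |x a| ≤ n) ∧ ∑ a, c a * x a = 0}

theorem finite_box (A : Type*) [Finite A] (n : ℕ) : {x : A → ℤ | ∀ a, |x a| ≤ n}.Finite := by
  refine (Set.Finite.pi fun _ : A => Set.finite_Icc (-(n : ℤ)) n).subset fun x hx a _ => ?_
  exact abs_le.1 (hx a)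

/-- The relation determines the coordinate `b` from the others, each of which has `2n + 1` values.
-/
theorem ncard_boxRelation_le {c : A → ℤ} {b : A} (hc : c b ≠ 0) (n : ℕ) :
    (boxRelation c n).ncard ≤ (2 * n + 1) ^ (Fintype.card A - 1) := by
  classical
  let T : Finset ({a // a ≠ b} → ℤ) := Fintype.piFinset fun _ => Finset.Icc (-(n : ℤ)) n
  have hT : T.card = (2 * n + 1) ^ (Fintype.card A - 1) := by
    rw [Fintype.card_piFinset, Finset.prod_const, Finset.card_univ, Int.card_Icc,
      Fintype.card_subtype_compl,
      Fintype.card_subtype_eq]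
    congr 1
    omega
  rw [← hT, ← Set.ncard_coe_finset]
  refine Set.ncard_le_ncard_of_injOn (fun x a => x a) (fun x hx => ?_) ?_ T.finite_toSet
  · rw [Finset.mem_coe, Fintype.mem_piFinset]
    intro a
    exact Finset.mem_Icc.2 (abs_le.1 (hx.1 a))
  · intro x hx y hy hxy
    have hne : ∀ a ≠ b, x a = y a := fun a ha => congrFun hxy ⟨a, ha⟩
    have hb : c b * x b = c b * y b := by
      have h1 := hx.2.trans hy.2.symm
      rw [← Finset.add_sum_erase _ _ (Finset.mem_univ b),
        ← Finset.add_sum_erase _ (fun a => c a * y a) (Finset.mem_univ b)] at h1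
      rw [Finset.sum_congr rfl fun a ha => by rw [hne a (Finset.ne_of_mem_erase ha)]] at h1
      exact add_right_cancel h1
    funext a
    by_cases ha : a = b
    · rw [ha]; exact mul_left_cancel₀ hc hb
    · exact hne a ha

theorem ncard_le_add_card_mul {B J : Type*} [Fintype J] {S T : Set B} {R : J → Set B} {M : ℕ}
    (hS : S ⊆ T ∪ ⋃ j, R j) (hT : T.Finite) (hR : ∀ j, (R j).Finite) (hM : ∀ j, (R j).ncard ≤ M) :
    S.ncard ≤ T.ncard + Fintype.card J * M := by
  refine (Set.ncard_le_ncard hS (hT.union (Set.finite_iUnion hR))).trans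
    ((Set.ncard_union_le _ _).trans (Nat.add_le_add_left ?_ _))
  refine (Set.ncard_iUnion_le_of_fintype R).trans ((Finset.sum_le_card_nsmul _ _ M fun j _ =>
    hM j).trans ?_)
  rw [smul_eq_mul, Finset.card_univ]

end LatticePoints

/-! ### Paths with prescribed steps -/

section SignedPath

variable {I : Type*} {h : ℕ} {R : Type*} [CommRing R]

/-- The path that starts at `x none` and whose `j`-th step is `e j * x (f j)`. -/
def signedPath (f : Fin h → I) (e : Fin h → ℤˣ) (x : Option I → R) (i : Fin (h + 1)) : R :=
  x none + ∑ j with j.castSucc < i, ((e j : ℤ) : R) * x (some (f j))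

variable (f : Fin h → I) (e : Fin h → ℤˣ)

@[simp]
theorem signedPath_zero (x : Option I → R) : signedPath f e x 0 = x none := by
  simp [signedPath]

theorem signedPath_succ (x : Option I → R) (i : Fin h) :
    signedPath f e x i.succ = signedPath f e x i.castSucc + ((e i : ℤ) : R) * x (some (f i)) := by
  have : Finset.univ.filter (fun j : Fin h => j.castSucc < i.succ) =
      insert i (Finset.univ.filter fun j : Fin h => j.castSucc < i.castSucc) := by
    ext j
    simp only [Finset.mem_filter, Finset.mem_univ, true_and, Finset.mem_insert, Fin.lt_def,
      Fin.val_castSucc, Fin.val_succ, Fin.ext_iff]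
    omega
  rw [signedPath, this, Finset.sum_insert (by simp), signedPath]
  ring

theorem signedPath_last (x : Option I → R) :
    signedPath f e x (Fin.last h) = x none + ∑ j, ((e j : ℤ) : R) * x (some (f j)) := by
  rw [signedPath, Finset.filter_true_of_mem fun j _ => Fin.castSucc_lt_last j]

theorem signedPath_intCast_div (x : Option I → ℤ) (n : ℝ) (i : Fin (h + 1)) :
    signedPath f e (fun a => (x a : ℝ) / n) i = ((signedPath f e x i : ℤ) : ℝ) / n := by
  simp only [signedPath, Int.cast_add, Int.cast_sum, Int.cast_mul, add_div, Finset.sum_div,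
    mul_div_assoc, Int.cast_id]

/-- A sequence with the steps of a signed path is that path. -/
theorem eq_signedPath {y : Fin (h + 1) → R} {x : Option I → R} (h0 : y 0 = x none)
    (hs : ∀ i : Fin h, y i.succ - y i.castSucc = ((e i : ℤ) : R) * x (some (f i)))
    (i : Fin (h + 1)) : y i = signedPath f e x i := by
  induction i using Fin.induction with
  | zero => rw [signedPath_zero, h0]
  | succ i ih => rw [signedPath_succ, ← ih, ← hs i]; ring

/-- The points whose signed path stays in `[0, 1)`. -/
def unitPathRegion : Set (Option I → ℝ) := {x | ∀ i, signedPath f e x i ∈ Set.Ico (0 : ℝ) 1}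

theorem isLinearMap_signedPath (i : Fin (h + 1)) :
    IsLinearMap ℝ fun x : Option I → ℝ => signedPath f e x i where
  map_add x y := by
    simp only [signedPath, Pi.add_apply, mul_add, Finset.sum_add_distrib]; ring
  map_smul c x := by
    simp only [signedPath, Pi.smul_apply, smul_eq_mul, mul_add, Finset.mul_sum]
    congr 1
    exact Finset.sum_congr rfl fun j _ => by ring

theorem convex_unitPathRegion : Convex ℝ (unitPathRegion f e) := by
  have : unitPathRegion f e = ⋂ i, (fun x => signedPath f e x i) ⁻¹' Set.Ico (0 : ℝ) 1 := by
    ext x; simp [unitPathRegion]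
  rw [this]
  exact convex_iInter fun i => (convex_Ico 0 1).is_linear_preimage (isLinearMap_signedPath f e i)

theorem measurableSet_unitPathRegion : MeasurableSet (unitPathRegion f e) := by
  have : unitPathRegion f e = ⋂ i, (fun x => signedPath f e x i) ⁻¹' Set.Ico (0 : ℝ) 1 := by
    ext x; simp [unitPathRegion]
  rw [this]
  refine MeasurableSet.iInter fun i => measurableSet_Ico.preimage ?_
  unfold signedPath
  fun_prop

variable [Fintype I]

variable {f e} in
-- Each coordinate is the starting point or, since `e (p a) = 1`, a difference of two consecutive
-- points of the path in `[0, 1)`.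
theorem isBounded_unitPathRegion {p : I → Fin h} (hp : ∀ a, f (p a) = a) (he : ∀ a, e (p a) = 1) :
    Bornology.IsBounded (unitPathRegion f e) := by
  refine (Metric.isBounded_closedBall (x := (0 : Option I → ℝ)) (r := 1)).subset fun x hx => ?_
  rw [mem_closedBall_zero_iff, pi_norm_le_iff_of_nonneg zero_le_one]
  rintro (_ | a)
  · have := hx 0
    rw [signedPath_zero] at this
    rw [Real.norm_eq_abs, abs_of_nonneg this.1]
    exact this.2.le
  · have h1 := hx (p a).succ
    have h2 := hx (p a).castSucc
    rw [signedPath_succ, hp, he] at h1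
    simp only [Units.val_one, Int.cast_one, one_mul] at h1
    rw [Real.norm_eq_abs, abs_le]
    constructor <;> linarith [h1.1, h1.2, h2.1, h2.2]

variable {f e} in
theorem tendsto_ncard_signedPath {p : I → Fin h} (hp : ∀ a, f (p a) = a)
    (he : ∀ a, e (p a) = 1) :
    Tendsto (fun n : ℕ => ({x : Option I → ℤ | ∀ i, signedPath f e x i ∈ Set.Ico (0 : ℤ) n}.ncard :
      ℝ) / (n : ℝ) ^ (1 + Fintype.card I)) atTop (𝓝 (volume.real (unitPathRegion f e))) := by
  have := (convex_unitPathRegion f e).tendsto_ncard_lattice_points (isBounded_unitPathRegion hp he)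
    (measurableSet_unitPathRegion f e)
  rw [Fintype.card_option, add_comm] at this
  refine this.congr' ?_
  filter_upwards [eventually_gt_atTop 0] with n hn
  have hn' : (0 : ℝ) < n := Nat.cast_pos.2 hn
  congr 3
  ext x
  simp only [Set.mem_ofPred_eq, unitPathRegion, signedPath_intCast_div, Set.mem_Ico,
    le_div_iff₀ hn', div_lt_one hn', zero_mul]
  exact forall_congr' fun i => by norm_cast

end SignedPath

/-! ### Words of Toeplitz circuits -/

section ToeplitzCircuits

variable {I : Type*} {h n : ℕ} (f : Fin h → I) (p : I → Fin h)

open Classical in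
/-- The signs `1` at the chosen positions `p a` of the letters `a`, and `-1` elsewhere. -/
noncomputable def oppositeSigns (i : Fin h) : ℤˣ := if i = p (f i) then 1 else -1

/-- The starting point of a path and its steps at the positions `p a`. -/
def pathCoords (π : Fin (h + 1) → Fin n) : Option I → ℤ
  | none => π 0
  | some a => (π (p a).succ : ℤ) - π (p a).castSucc

/-- The circuits whose Toeplitz labels match exactly as the letters of the word `f`. -/
def toeplitzCircuits (n : ℕ) : Set (Fin (h + 1) → Fin n) :=
  {π | π 0 = π (Fin.last h) ∧
    ∀ i j, f i = f j ↔ toeplitzLink.stepValue π i = toeplitzLink.stepValue π j}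

theorem toeplitz_stepValue (π : Fin (h + 1) → Fin n) (i : Fin h) :
    toeplitzLink.stepValue π i = ((π i.succ : ℤ) - π i.castSucc).natAbs := by
  change ((π i.castSucc : ℤ) - π i.succ).natAbs = _
  rw [← Int.natAbs_neg, neg_sub]

variable {f p}

theorem oppositeSigns_apply (hp : ∀ a, f (p a) = a) (a : I) : oppositeSigns f p (p a) = 1 := by
  rw [oppositeSigns, if_pos (by rw [hp])]

theorem abs_pathCoords_le (π : Fin (h + 1) → Fin n) (a : Option I) :
    |pathCoords p π a| ≤ n := by
  rcases a with _ | a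
  · have := (π 0).2
    rw [pathCoords, abs_le]
    omega
  · have h1 := (π (p a).succ).2
    have h2 := (π (p a).castSucc).2
    rw [pathCoords, abs_le]
    omega

/-- The signs of the steps of `π` relative to the steps at the chosen positions are `e`. -/
def HasSigns (f : Fin h → I) (p : I → Fin h) (e : Fin h → ℤˣ) (π : Fin (h + 1) → Fin n) : Prop :=
  ∀ i, (π i.succ : ℤ) - π i.castSucc = (e i : ℤ) * pathCoords p π (some (f i))

theorem HasSigns.coe_eq {e : Fin h → ℤˣ} {π : Fin (h + 1) → Fin n} (hπ : HasSigns f p e π)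
    (i : Fin (h + 1)) : (π i : ℤ) = signedPath f e (pathCoords p π) i :=
  eq_signedPath f e (y := fun i => (π i : ℤ)) rfl (fun i => by rw [hπ i, Int.cast_id]) i

theorem injOn_pathCoords (e : Fin h → ℤˣ) :
    Set.InjOn (pathCoords p) {π : Fin (h + 1) → Fin n | HasSigns f p e π} := by
  intro π hπ π' hπ' he
  funext i
  have h1 := HasSigns.coe_eq hπ i
  rw [he, ← HasSigns.coe_eq hπ' i] at h1
  exact Fin.ext (by exact_mod_cast h1)

/-- Equal Toeplitz labels mean steps that agree up to sign; the sign is recorded relative to the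
chosen position of the letter. -/
theorem exists_hasSigns (hp : ∀ a, f (p a) = a) {π : Fin (h + 1) → Fin n}
    (hπ : π ∈ toeplitzCircuits f n) :
    ∃ e : Fin h → ℤˣ, (∀ a, e (p a) = 1) ∧ HasSigns f p e π := by
  have key : ∀ i, ∃ s : ℤˣ, (i = p (f i) → s = 1) ∧
      (π i.succ : ℤ) - π i.castSucc = (s : ℤ) * pathCoords p π (some (f i)) := by
    intro i
    by_cases hi : i = p (f i)
    · refine ⟨1, fun _ => rfl, ?_⟩
      rw [pathCoords, ← hi, Units.val_one, one_mul]
    · have h1 := (hπ.2 i (p (f i))).1 (hp _).symm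
      rw [toeplitz_stepValue, toeplitz_stepValue, Int.natAbs_eq_natAbs_iff] at h1
      rcases h1 with h1 | h1
      · exact ⟨1, fun h => (hi h).elim, by rw [h1, pathCoords, Units.val_one, one_mul]⟩
      · exact ⟨-1, fun h => (hi h).elim, by
          rw [h1, pathCoords, Units.val_neg, Units.val_one, neg_one_mul]⟩
  choose e he he' using key
  exact ⟨e, fun a => he _ (by rw [hp]), he'⟩

theorem filter_eq_pair [DecidableEq I] (hf : ∀ a, (Finset.univ.filter fun i => f i = a).card = 2)
    (hp : ∀ a, f (p a) = a) {i : Fin h} (hi : i ≠ p (f i)) :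
    Finset.univ.filter (fun j => f j = f i) = {p (f i), i} := by
  symm
  refine Finset.eq_of_subset_of_card_le (fun j hj => ?_) ?_
  · rcases Finset.mem_insert.1 hj with rfl | hj
    · simp [hp]
    · rw [Finset.mem_singleton] at hj
      simp [hj]
  · rw [hf, Finset.card_pair (Ne.symm hi)]

theorem exists_ne_position [DecidableEq I]
    (hf : ∀ a, (Finset.univ.filter fun i => f i = a).card = 2) (p : I → Fin h) (a : I) :
    ∃ i, f i = a ∧ i ≠ p a := by
  obtain ⟨i, hi, hne⟩ := Finset.exists_mem_ne (s := Finset.univ.filter fun i => f i = a)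
    (by rw [hf]; norm_num) (p a)
  exact ⟨i, (Finset.mem_filter.1 hi).2, hne⟩

variable [Fintype I]

theorem sum_signs_eq [DecidableEq I] (e : Fin h → ℤˣ) (x : Option I → ℤ) :
    ∑ j, (e j : ℤ) * x (some (f j)) =
      ∑ a, (∑ j with f j = a, (e j : ℤ)) * x (some a) := by
  rw [← Finset.sum_fiberwise_of_maps_to (t := Finset.univ) (g := f) fun j _ => Finset.mem_univ _]
  refine Finset.sum_congr rfl fun a _ => ?_
  rw [Finset.sum_mul]
  exact Finset.sum_congr rfl fun j hj => by rw [(Finset.mem_filter.1 hj).2]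

/-- The two steps of each letter cancel, so closing costs no degree of freedom. -/
theorem signedPath_oppositeSigns_last [DecidableEq I]
    (hf : ∀ a, (Finset.univ.filter fun i => f i = a).card = 2) (hp : ∀ a, f (p a) = a)
    (x : Option I → ℤ) : signedPath f (oppositeSigns f p) x (Fin.last h) = x none := by
  rw [signedPath_last]
  simp only [Int.cast_id]
  rw [sum_signs_eq, Finset.sum_eq_zero, add_zero]
  intro a _
  obtain ⟨i, rfl, hi⟩ := exists_ne_position hf p a
  rw [filter_eq_pair hf hp hi, Finset.sum_pair (Ne.symm hi), oppositeSigns_apply hp,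
    oppositeSigns, if_neg hi]
  simp

/-- The coefficients of the closing condition of a signed path. -/
noncomputable def closingCoeff (f : Fin h → I) (e : Fin h → ℤˣ) : Option I → ℤ
  | none => 0
  | some a => letI := Classical.decEq I; ∑ j with f j = a, (e j : ℤ)

omit [Fintype I] in
-- A sign vector other than the opposite one gives sign `1` to both positions of some letter, whose
-- coefficient is then `2`.
theorem exists_closingCoeff_ne_zero [DecidableEq I]
    (hf : ∀ a, (Finset.univ.filter fun i => f i = a).card = 2) (hp : ∀ a, f (p a) = a)
    {e : Fin h → ℤˣ} (he : ∀ a, e (p a) = 1) (hne : e ≠ oppositeSigns f p) :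
    ∃ b, closingCoeff f e b ≠ 0 := by
  obtain ⟨i, hi⟩ := Function.ne_iff.1 hne
  have hi' : i ≠ p (f i) := by
    intro h
    rw [oppositeSigns, if_pos h, h, he] at hi
    exact hi rfl
  rw [oppositeSigns, if_neg hi'] at hi
  have h1 : e i = 1 := (Int.units_eq_one_or (e i)).resolve_right hi
  refine ⟨some (f i), ?_⟩
  have h2 : closingCoeff f e (some (f i)) = ∑ j with f j = f i, (e j : ℤ) := by
    rw [closingCoeff]; congr
  rw [h2, filter_eq_pair hf hp hi', Finset.sum_pair (Ne.symm hi'), he, h1]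
  norm_num

theorem HasSigns.mem_boxRelation {e : Fin h → ℤˣ} {π : Fin (h + 1) → Fin n}
    (hπ : HasSigns f p e π) (h0 : π 0 = π (Fin.last h)) :
    pathCoords p π ∈ boxRelation (closingCoeff f e) n := by
  classical
  refine ⟨abs_pathCoords_le π, ?_⟩
  have h1 := hπ.coe_eq (Fin.last h)
  rw [signedPath_last, ← h0, pathCoords] at h1
  simp only [Int.cast_id] at h1
  rw [sum_signs_eq] at h1
  rw [Fintype.sum_option, closingCoeff, zero_mul, zero_add]
  have h2 : ∀ a, closingCoeff f e (some a) = ∑ j with f j = a, (e j : ℤ) := fun a => by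
    rw [closingCoeff]
  simp only [h2]
  linarith

/-- The coefficients of the relation `x a + s * x b = 0`. -/
def pairCoeff [DecidableEq I] (q : I × I × ℤˣ) : Option I → ℤ :=
  Pi.single (some q.1) 1 + Pi.single (some q.2.1) (q.2.2 : ℤ)

theorem sum_pairCoeff_mul [DecidableEq I] (q : I × I × ℤˣ) (x : Option I → ℤ) :
    ∑ a, pairCoeff q a * x a = x (some q.1) + q.2.2 * x (some q.2.1) := by
  simp [pairCoeff, add_mul, Finset.sum_add_distrib, Pi.single_apply]

omit [Fintype I] in
theorem pairCoeff_ne_zero [DecidableEq I] {q : I × I × ℤˣ} (hq : q.1 ≠ q.2.1) :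
    pairCoeff q (some q.1) ≠ 0 := by
  simp [pairCoeff, hq]

variable (f p) in
/-- The integer points whose signed path, with opposite signs at matched positions, stays in
`[0, n)`. -/
def latticePaths (n : ℕ) : Set (Option I → ℤ) :=
  {x | ∀ i, signedPath f (oppositeSigns f p) x i ∈ Set.Ico (0 : ℤ) n}

omit [Fintype I] in
theorem abs_le_of_mem_latticePaths (hp : ∀ a, f (p a) = a) {x : Option I → ℤ}
    (hx : x ∈ latticePaths f p n) (a : Option I) : |x a| ≤ n := by
  rcases a with _ | a
  · have := hx 0
    rw [signedPath_zero, Set.mem_Ico] at this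
    rw [abs_le]
    omega
  · have h1 := hx (p a).succ
    have h2 := hx (p a).castSucc
    rw [signedPath_succ, hp, oppositeSigns_apply hp] at h1
    simp only [Units.val_one, Int.cast_one, one_mul, Set.mem_Ico] at h1 h2
    rw [abs_le]
    omega

/-- A lattice path without coincidences between the sizes of different steps comes from a
circuit. -/
theorem mem_image_pathCoords [DecidableEq I]
    (hf : ∀ a, (Finset.univ.filter fun i => f i = a).card = 2) (hp : ∀ a, f (p a) = a)
    {x : Option I → ℤ} (hx : x ∈ latticePaths f p n)
    (hne : ∀ a b, a ≠ b → (x (some a)).natAbs ≠ (x (some b)).natAbs) :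
    x ∈ pathCoords p '' toeplitzCircuits f n := by
  let y := signedPath f (oppositeSigns f p) x
  have hy : ∀ i, (y i).toNat < n := fun i => by
    have : y i ∈ Set.Ico (0 : ℤ) n := hx i
    rw [Set.mem_Ico] at this
    omega
  have hy' : ∀ i, ((y i).toNat : ℤ) = y i := fun i => Int.toNat_of_nonneg (hx i).1
  have hstep : ∀ i : Fin h, y i.succ - y i.castSucc = (oppositeSigns f p i : ℤ) * x (some (f i)) :=
    fun i => by simp only [y]; rw [signedPath_succ, Int.cast_id]; ring
  let π : Fin (h + 1) → Fin n := fun i => ⟨(y i).toNat, hy i⟩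
  have hlabel : ∀ i, toeplitzLink.stepValue π i = (x (some (f i))).natAbs := fun i => by
    rw [toeplitz_stepValue]
    simp only [π, hy', hstep, Int.natAbs_mul, Int.units_natAbs, one_mul]
  refine ⟨π, ⟨Fin.ext ?_, fun i j => ?_⟩, ?_⟩
  · have : y (Fin.last h) = y 0 := by
      simp only [y]
      rw [signedPath_oppositeSigns_last hf hp, signedPath_zero]
    simp only [π, this]
  · rw [hlabel, hlabel]
    exact ⟨fun h => by rw [h], fun h => by_contra fun hij => hne _ _ hij h⟩
  · funext a
    rcases a with _ | a
    · simp only [pathCoords, π, hy']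
      exact signedPath_zero _ _ _
    · simp only [pathCoords, π, hy', hstep]
      rw [hp, oppositeSigns_apply hp]
      simp

/-- A lattice path fails to come from a circuit only if two different letters have steps of equal
size. This is one of finitely many relations `x a = ± x b`, each costing a dimension. -/
theorem ncard_latticePaths_le [DecidableEq I]
    (hf : ∀ a, (Finset.univ.filter fun i => f i = a).card = 2) (hp : ∀ a, f (p a) = a) (n : ℕ) :
    (latticePaths f p n).ncard ≤ (toeplitzCircuits f n).ncard +
      Fintype.card {q : I × I × ℤˣ // q.1 ≠ q.2.1} * (2 * n + 1) ^ Fintype.card I := by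
  refine le_trans (ncard_le_add_card_mul (T := pathCoords p '' toeplitzCircuits f n)
    (R := fun q : {q : I × I × ℤˣ // q.1 ≠ q.2.1} => boxRelation (pairCoeff q.1) n)
    (M := (2 * n + 1) ^ Fintype.card I) (fun x hx => ?_) (Set.toFinite _)
    (fun q => (finite_box _ n).subset fun x hx => hx.1) fun q => ?_)
    (Nat.add_le_add_right (Set.ncard_image_le (Set.toFinite _)) _)
  · by_cases hne : ∀ a b, a ≠ b → (x (some a)).natAbs ≠ (x (some b)).natAbs
    · exact Or.inl (mem_image_pathCoords hf hp hx hne)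
    · push Not at hne
      obtain ⟨a, b, hab, h1⟩ := hne
      refine Or.inr (Set.mem_iUnion.2 ?_)
      rcases Int.natAbs_eq_natAbs_iff.1 h1 with h1 | h1
      · refine ⟨⟨(a, b, -1), hab⟩, abs_le_of_mem_latticePaths hp hx, ?_⟩
        rw [sum_pairCoeff_mul]
        simp [h1]
      · refine ⟨⟨(a, b, 1), hab⟩, abs_le_of_mem_latticePaths hp hx, ?_⟩
        rw [sum_pairCoeff_mul]
        simp [h1]
  · refine (ncard_boxRelation_le (pairCoeff_ne_zero q.2) n).trans (le_of_eq ?_)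
    rw [Fintype.card_option, Nat.add_sub_cancel]

/-- Circuits with opposite signs are lattice paths. For any other signs, closing the circuit is a
nontrivial linear relation between the coordinates. -/
theorem ncard_toeplitzCircuits_le [DecidableEq I]
    (hf : ∀ a, (Finset.univ.filter fun i => f i = a).card = 2) (hp : ∀ a, f (p a) = a) (n : ℕ) :
    (toeplitzCircuits f n).ncard ≤ (latticePaths f p n).ncard +
      Nat.card (Fin h → ℤˣ) * (2 * n + 1) ^ Fintype.card I := by
  classical
  let J := {e : Fin h → ℤˣ // (∀ a, e (p a) = 1) ∧ e ≠ oppositeSigns f p}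
  refine le_trans (ncard_le_add_card_mul
    (T := {π ∈ toeplitzCircuits f n | HasSigns f p (oppositeSigns f p) π})
    (R := fun e : J => {π ∈ toeplitzCircuits f n | HasSigns f p e.1 π})
    (M := (2 * n + 1) ^ Fintype.card I) (fun π hπ => ?_) (Set.toFinite _)
    (fun _ => Set.toFinite _) fun e => ?_) (Nat.add_le_add ?_ (Nat.mul_le_mul_right _ ?_))
  · obtain ⟨e, he, h1⟩ := exists_hasSigns hp hπ
    by_cases heq : e = oppositeSigns f p
    · exact Or.inl ⟨hπ, heq ▸ h1⟩
    · exact Or.inr (Set.mem_iUnion.2 ⟨⟨e, he, heq⟩, hπ, h1⟩)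
  · obtain ⟨b, hb⟩ := exists_closingCoeff_ne_zero hf hp e.2.1 e.2.2
    calc _ ≤ (boxRelation (closingCoeff f e.1) n).ncard :=
          Set.ncard_le_ncard_of_injOn (pathCoords p)
            (fun π hπ => HasSigns.mem_boxRelation hπ.2 hπ.1.1)
            ((injOn_pathCoords e.1).mono fun π hπ => hπ.2)
            ((finite_box _ n).subset fun x hx => hx.1)
      _ ≤ _ := ncard_boxRelation_le hb n
      _ = _ := by rw [Fintype.card_option, Nat.add_sub_cancel]
  · refine Set.ncard_le_ncard_of_injOn (pathCoords p) (fun π hπ i => ?_)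
      ((injOn_pathCoords (oppositeSigns f p)).mono fun π hπ => hπ.2)
      ((finite_box _ n).subset fun x hx => abs_le_of_mem_latticePaths hp hx)
    rw [← HasSigns.coe_eq hπ.2 i]
    exact ⟨by positivity, by exact_mod_cast (π i).2⟩
  · rw [← Nat.card_eq_fintype_card]
    exact Nat.card_le_card_of_injective _ Subtype.val_injective

/-- The two counting inequalities sandwich the number of circuits between lattice counts, up to
errors of order `n ^ |I|`. The limit is the volume of the polytope of paths with opposite signs. -/
theorem exists_tendsto_ncard_toeplitzCircuits [DecidableEq I]
    (hf : ∀ a, (Finset.univ.filter fun i => f i = a).card = 2) :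
    ∃ r : ℝ, Tendsto (fun n : ℕ => ((toeplitzCircuits f n).ncard : ℝ) /
      (n : ℝ) ^ (1 + Fintype.card I)) atTop (𝓝 r) := by
  have hex : ∀ a, ∃ i, f i = a := fun a => by
    obtain ⟨i, hi⟩ := Finset.card_pos.1 ((hf a).symm ▸ Nat.zero_lt_two)
    exact ⟨i, (Finset.mem_filter.1 hi).2⟩
  choose p hp using hex
  have hlim : Tendsto (fun n : ℕ => ((latticePaths f p n).ncard : ℝ) /
      (n : ℝ) ^ (1 + Fintype.card I)) atTop
      (𝓝 (volume.real (unitPathRegion f (oppositeSigns f p)))) :=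
    tendsto_ncard_signedPath hp (oppositeSigns_apply hp)
  refine ⟨volume.real (unitPathRegion f (oppositeSigns f p)), ?_⟩
  have herr : ∀ C : ℕ, Tendsto (fun n : ℕ => ((C * (2 * n + 1) ^ Fintype.card I : ℕ) : ℝ) /
      (n : ℝ) ^ (1 + Fintype.card I)) atTop (𝓝 0) := by
    intro C
    have h1 : Tendsto (fun n : ℕ => (C : ℝ) * 3 ^ Fintype.card I * (n : ℝ)⁻¹) atTop (𝓝 0) := by
      simpa using tendsto_inv_atTop_nhds_zero_nat (𝕜 := ℝ).const_mul ((C : ℝ) * 3 ^ Fintype.card I)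
    refine squeeze_zero' (Eventually.of_forall fun n => by positivity) ?_ h1
    filter_upwards [eventually_ge_atTop 1] with n hn
    have hn' : (1 : ℝ) ≤ n := Nat.one_le_cast.2 hn
    rw [div_le_iff₀ (by positivity)]
    push_cast
    calc (C : ℝ) * (2 * n + 1) ^ Fintype.card I ≤ C * (3 * n) ^ Fintype.card I := by
          gcongr; linarith
      _ = C * 3 ^ Fintype.card I * ((n : ℝ)⁻¹ * n) * n ^ Fintype.card I := by
          rw [inv_mul_cancel₀ (by positivity), mul_pow]; ring
      _ = _ := by rw [pow_add]; ring
  have hlow := hlim.sub (herr (Fintype.card {q : I × I × ℤˣ // q.1 ≠ q.2.1}))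
  have hup := hlim.add (herr (Nat.card (Fin h → ℤˣ)))
  rw [sub_zero] at hlow
  rw [add_zero] at hup
  refine tendsto_of_tendsto_of_tendsto_of_le_of_le hlow hup (fun n => ?_) fun n => ?_
  · have h1 := (Nat.cast_le (α := ℝ)).2 (ncard_latticePaths_le hf hp n)
    rw [Nat.cast_add, ← sub_le_iff_le_add] at h1
    refine (sub_div _ _ _).symm.trans_le (div_le_div_of_nonneg_right h1 (by positivity))
  · have h1 := (Nat.cast_le (α := ℝ)).2 (ncard_toeplitzCircuits_le hf hp n)
    rw [Nat.cast_add] at h1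
    refine (div_le_div_of_nonneg_right h1 (by positivity)).trans_eq (add_div _ _ _)

end ToeplitzCircuits

/-! ### The Toeplitz link -/

theorem toeplitzLink_wordLimitsExist : toeplitzLink.WordLimitsExist := by
  classical
  intro k W hW
  -- The letters are restricted to those that occur, so that the alphabet is a finite type with
  -- exactly `k` elements.
  let f := Set.rangeFactorization W.letter
  have hff : ∀ i j, f i = f j ↔ W.letter i = W.letter j := fun i j => Subtype.ext_iff
  have hf : ∀ a, (Finset.univ.filter fun i => f i = a).card = 2 := by
    rintro ⟨_, i, rfl⟩
    refine Eq.trans ?_ (hW i)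
    rw [← Set.ncard_coe_finset]
    congr 1
    ext j
    simp [f, Set.rangeFactorization, Subtype.ext_iff]
  have hcard : Fintype.card (Set.range W.letter) = k := by
    have := Finset.card_eq_sum_card_fiberwise (f := f) (s := Finset.univ) (t := Finset.univ)
      fun i _ => Finset.mem_coe.2 (Finset.mem_univ _)
    simp only [hf, Finset.sum_const, Finset.card_univ, Fintype.card_fin, smul_eq_mul] at this
    omega
  have hset : ∀ n, toeplitzLink.circuits W n = toeplitzCircuits f n := fun n => by
    simp only [SymmLink.circuits, toeplitzCircuits, hff]
  obtain ⟨r, hr⟩ := exists_tendsto_ncard_toeplitzCircuits hf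
  rw [hcard] at hr
  exact ⟨r, by simpa only [hset] using hr⟩

theorem ncard_toeplitzLink_row_le (n : ℕ) (k : Fin n) (t : ℕ) :
    {l : Fin n | toeplitzLink.toFun n k l = t}.ncard ≤ 2 := by
  refine le_trans (Set.ncard_le_ncard_of_injOn (fun l : Fin n => (l : ℤ))
    (t := {(k : ℤ) + t, (k : ℤ) - t}) (fun l hl => ?_) ?_ (Set.toFinite _))
    ((Set.ncard_insert_le _ _).trans (by rw [Set.ncard_singleton]))
  · have : ((k : ℤ) - l).natAbs = t := hl
    simp only [Set.mem_insert_iff, Set.mem_singleton_iff]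
    omega
  · intro l _ l' _ h
    exact Fin.ext (Nat.cast_injective (R := ℤ) h)

theorem toeplitzLink_propertyB : toeplitzLink.PropertyB := by
  refine lt_of_le_of_lt (b := (2 : ℕ∞)) (iSup_le fun n => iSup_le fun t => iSup_le fun _ =>
    iSup_le fun k => ?_) (ENat.natCast_lt_top 2)
  rw [← Set.Finite.cast_ncard_eq (Set.toFinite _)]
  exact_mod_cast ncard_toeplitzLink_row_le n k t

theorem toeplitzLink_values (n : ℕ) : toeplitzLink.values n = Set.Iio n := by
  ext t
  constructor
  · rintro ⟨⟨i, j⟩, rfl⟩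
    change ((i : ℤ) - j).natAbs < n
    omega
  · intro ht
    have hn : 0 < n := lt_of_le_of_lt (Nat.zero_le t) ht
    exact ⟨(⟨t, ht⟩, ⟨0, hn⟩), by simp [toeplitzLink]⟩

theorem toeplitzLink_maxOccurrences_le (n : ℕ) : toeplitzLink.maxOccurrences n ≤ 2 * n := by
  refine ciSup_le' fun t => ?_
  refine le_trans (Set.ncard_le_mul_ncard_image _ Prod.fst 2 fun k _ => ?_)
    (Nat.mul_le_mul_left 2 ?_)
  · refine le_trans (Set.ncard_le_ncard_of_injOn Prod.snd (t :=
      {l : Fin n | toeplitzLink.toFun n k l = t}) ?_ ?_) (ncard_toeplitzLink_row_le n k t)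
    · rintro ⟨i, j⟩ ⟨h1, rfl⟩
      exact h1
    · rintro ⟨i, j⟩ ⟨-, rfl⟩ ⟨i', j'⟩ ⟨-, h2⟩ h3
      exact Prod.ext h2.symm h3
  · refine (Set.ncard_le_ncard (Set.subset_univ _)).trans (le_of_eq ?_)
    rw [Set.ncard_univ, Nat.card_eq_fintype_card, Fintype.card_fin]

theorem toeplitzLink_linkCond : toeplitzLink.LinkCond := by
  have hnum : toeplitzLink.numValues = id := by
    funext n
    rw [SymmLink.numValues, toeplitzLink_values, ← Finset.coe_Iio, Set.ncard_coe_finset,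
      Nat.card_Iio, id]
  refine ⟨hnum ▸ tendsto_id, IsBigO.of_bound 2 (Eventually.of_forall fun n => ?_)⟩
  rw [hnum, id, Real.norm_of_nonneg (by positivity), Real.norm_of_nonneg (by positivity)]
  calc (n : ℝ) * toeplitzLink.maxOccurrences n ≤ n * ((2 * n : ℕ) : ℝ) := by
        gcongr
        exact toeplitzLink_maxOccurrences_le n
    _ = 2 * (n : ℝ) ^ 2 := by push_cast; ring

theorem squaredDifferenceLink_eq_map :
    squaredDifferenceLink = toeplitzLink.map fun _ m => m ^ 2 := by
  have : squaredDifferenceLink.toFun = (toeplitzLink.map fun _ m => m ^ 2).toFun := by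
    funext n i j
    exact Int.natAbs_pow _ 2
  cases h : squaredDifferenceLink
  cases h' : toeplitzLink.map fun _ m => m ^ 2
  simp only [h, h'] at this
  simp only [this]

theorem mainTheorem5 :
    (∀ (ι : Type u) (κ : Type v) (LX : SymmLink ι) (ρ : ℕ → ι → κ),
      LX.PropertyB → LX.LinkCond → LX.WordLimitsExist →
      (∀ n, Set.InjOn (ρ n) (LX.values n)) →
        (LX.map ρ).PropertyB ∧ (LX.map ρ).LinkCond ∧
        (∀ (h : ℕ) (W : Word h) (n : ℕ), LX.circuitsStar W n = (LX.map ρ).circuitsStar W n) ∧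
        ∃ μ : Measure ℝ,
          SymmLink.IsLSD.{u, w} LX μ ∧ SymmLink.IsLSD.{v, w} (LX.map ρ) μ) ∧
    (toeplitzLink.PropertyB ∧ toeplitzLink.LinkCond ∧ toeplitzLink.WordLimitsExist ∧
      ∃ μ : Measure ℝ,
        SymmLink.IsLSD.{0, w} toeplitzLink μ ∧ SymmLink.IsLSD.{0, w} squaredDifferenceLink μ) := by
  refine ⟨fun ι κ LX ρ hB hL hW hρ => ⟨hB.map hρ, hL.map hρ,
    fun h W n => (SymmLink.circuitsStar_map hρ W n).symm, SymmLink.exists_isLSD_map hB hL hW hρ⟩,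
    toeplitzLink_propertyB, toeplitzLink_linkCond, toeplitzLink_wordLimitsExist, ?_⟩
  rw [squaredDifferenceLink_eq_map]
  exact SymmLink.exists_isLSD_map toeplitzLink_propertyB toeplitzLink_linkCond
    toeplitzLink_wordLimitsExist fun n => (Nat.pow_left_injective two_ne_zero).injOn
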